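/- **Conventions.** A *metric surface* is a metric space homeomorphic to a (second countable) topological $2$-manifold, with or without boundary; it is equipped with its Hausdorff $2$-measure $\mathcal H^2$, normalized to agree with Lebesgue measure on $\mathbb R^2$. A *path* is a continuous map from a compact interval. A Borel function $\rho\colon X\to[0,\infty]$ is *admissible* for a path family $\Gamma$ in $X$ if $\int_\gamma \rho\,ds\ge 1$ for every rectifiable $\gamma\in\Gamma$, and $\operatorname{Mod}\Gamma=\inf_\rho\int_X\rho^2\,d\mathcal H^2$ over all admissible $\rho$ (with $\inf\emptyset=\infty$). A map is *monotone* if the preimage of each point is connected. A continuous, surjective, monotone map $h\colon X\to Y$ is *weakly $K$-quasiconformal* if $\operatorname{Mod}\Gamma\le K\operatorname{Mod}h(\Gamma)$ for every path family $\Gamma$ in $X$, where $h(\Gamma)=\{h\circ\gamma:\gamma\in\Gamma\}$. A Borel function $g\colon X\to[0,\infty]$ is a *weak upper gradient* of $h$ if $d_Y(h(a),h(b))\le\int_\gamma g\,ds$ for all rectifiable paths $\gamma$, with endpoints $a,b$, outside a path family of modulus zero. $N^{1,2}(X,Y)$ is the set of Borel maps $h\colon X\to Y$ that have a weak upper gradient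 in $L^2(X)$ and satisfy $d_Y(y,h(\cdot))\in L^2(X)$ for some $y\in Y$; and $h\in N^{1,2}_{\rm loc}(X,Y)$ if each point of $X$ has an open neighborhood $U$ with $h|_U\in N^{1,2}(U,Y)$. The *minimal weak upper gradient* $g_h$ is the (a.e. unique) weak upper gradient in $L^2_{\rm loc}(X)$ that is a.e. at most any other weak upper gradient in $L^2_{\rm loc}(X)$. **Theorem.** Let $X,Y$ be metric surfaces of locally finite Hausdorff $2$-measure, let $K\ge 1$, and let $h\colon X\to Y$ be continuous, surjective and monotone. Then $h$ is weakly $K$-quasiconformal if and only if $h\in N^{1,2}_{\rm loc}(X,Y)$ (so that $g_h$ exists), the set function $\nu(E)=\mathcal H^2(h(E))$ is a measure on the Borel sets of $X$, and $$g_h(x)^2\le K J_h(x)\qquad\text{for }\mathcal H^2\text{-a.e. }x\in X,$$ where $J_h=d\nu/d\mathcal H^2$ is the Radon–Nikodym derivative of (the absolutely continuous part of) $\nu$ with respect to $\mathcal H^2$. -/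

import Mathlib

open MeasureTheory Set Topology
open scoped ENNReal NNReal Manifold

noncomputable section

namespace QC

/-- A metric surface: a metric space that is a topological `2`-manifold, possibly with boundary
(second countable, and locally homeomorphic to open subsets of the closed half-plane). -/
class IsMetricSurface (X : Type*) [MetricSpace X] : Prop where
  secondCountable : SecondCountableTopology X
  charts : Nonempty (ChartedSpace (EuclideanHalfSpace 2) X)

/-- The Hausdorff `2`-measure, with the normalization that makes it equal to Lebesgue measure on the
Euclidean plane: `μH[2]` in Mathlib is built from `diam ^ 2`, here one uses `(π / 4) * diam ^ 2`. -/
def hausdorff2 (X : Type*) [MetricSpace X] [MeasurableSpace X] [BorelSpace X] : Measure X :=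
  ENNReal.ofReal (Real.pi / 4) • Measure.hausdorffMeasure 2

/-- A path: a continuous map from a compact interval `[lo, hi]` to `X`. -/
structure Curve (X : Type*) [TopologicalSpace X] where
  lo : ℝ
  hi : ℝ
  le : lo ≤ hi
  map : C(Icc lo hi, X)

namespace Curve

variable {X Y : Type*}

/-- The left end point of the parameter interval. -/
def left [TopologicalSpace X] (γ : Curve X) : Icc γ.lo γ.hi := ⟨γ.lo, left_mem_Icc.2 γ.le⟩

/-- The right end point of the parameter interval. -/
def right [TopologicalSpace X] (γ : Curve X) : Icc γ.lo γ.hi := ⟨γ.hi, right_mem_Icc.2 γ.le⟩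

/-- The initial point of a path. -/
def source [TopologicalSpace X] (γ : Curve X) : X := γ.map γ.left

/-- The terminal point of a path. -/
def target [TopologicalSpace X] (γ : Curve X) : X := γ.map γ.right

/-- The path `h ∘ γ`. -/
def comp [TopologicalSpace X] [TopologicalSpace Y] (h : C(X, Y)) (γ : Curve X) : Curve Y where
  lo := γ.lo
  hi := γ.hi
  le := γ.le
  map := h.comp γ.map

/-- The length of a path. -/
def length [MetricSpace X] (γ : Curve X) : ℝ≥0∞ := eVariationOn γ.map univ

/-- Rectifiable paths. Since paths are defined on compact intervals, this is the same as being
locally rectifiable. -/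
def Rectifiable [MetricSpace X] (γ : Curve X) : Prop := γ.length ≠ ∞

/-- The arc-length parametrization of a rectifiable path; it is relevant on `[0, γ.length]`. -/
def arcLength [MetricSpace X] (γ : Curve X) : ℝ → X :=
  haveI : Nonempty (Icc γ.lo γ.hi) := ⟨γ.left⟩
  naturalParameterization γ.map univ γ.left

/-- The line integral `∫_γ ρ ds` of a Borel function `ρ : X → [0, ∞]` along a rectifiable path,
that is, `∫_0^ℓ ρ (γ_s t) dt` where `γ_s` is the arc-length parametrization and `ℓ` the length. -/
def lineIntegral [MetricSpace X] (ρ : X → ℝ≥0∞) (γ : Curve X) : ℝ≥0∞ :=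
  ∫⁻ t in Icc (0 : ℝ) γ.length.toReal, ρ (γ.arcLength t)

end Curve

section

variable {X Y : Type*} [MetricSpace X] [MeasurableSpace X] [BorelSpace X]
  [MetricSpace Y] [MeasurableSpace Y] [BorelSpace Y]

/-- `ρ : X → [0, ∞]` is admissible for the path family `Γ`. -/
def Admissible (Γ : Set (Curve X)) (ρ : X → ℝ≥0∞) : Prop :=
  Measurable ρ ∧ ∀ γ ∈ Γ, γ.Rectifiable → 1 ≤ γ.lineIntegral ρ

/-- The `2`-modulus of a path family; it is `∞` if no function is admissible. -/
def modulus (Γ : Set (Curve X)) : ℝ≥0∞ :=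
  ⨅ (ρ : X → ℝ≥0∞) (_ : Admissible Γ ρ), ∫⁻ x, ρ x ^ 2 ∂(hausdorff2 X)

/-- A Borel function `g : X → [0, ∞]` is a weak upper gradient of `h` if the upper gradient
inequality holds for all rectifiable paths outside a path family of modulus zero. -/
def IsWeakUpperGradient (h : X → Y) (g : X → ℝ≥0∞) : Prop :=
  Measurable g ∧ ∃ Γ₀ : Set (Curve X), modulus Γ₀ = 0 ∧
    ∀ γ : Curve X, γ ∉ Γ₀ → γ.Rectifiable → edist (h γ.source) (h γ.target) ≤ γ.lineIntegral g

/-- The Sobolev space `N^{1,2}(X, Y)`. -/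
def MemN12 (h : X → Y) : Prop :=
  Measurable h ∧
    (∃ g : X → ℝ≥0∞, IsWeakUpperGradient h g ∧ ∫⁻ x, g x ^ 2 ∂(hausdorff2 X) < ∞) ∧
    ∃ y : Y, ∫⁻ x, edist y (h x) ^ 2 ∂(hausdorff2 X) < ∞

/-- The local Sobolev space `N^{1,2}_loc(X, Y)`: every point has an open neighborhood `U`, regarded
as a metric space in its own right, such that the restriction of `h` to `U` is in `N^{1,2}(U, Y)`. -/
def MemN12loc (h : X → Y) : Prop :=
  ∀ x : X, ∃ U : Set X, IsOpen U ∧ x ∈ U ∧ MemN12 (fun u : U => h u)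

/-- Local square integrability of a `[0, ∞]`-valued function. -/
def LocallyL2 (g : X → ℝ≥0∞) : Prop :=
  ∀ x : X, ∃ U ∈ 𝓝 x, ∫⁻ z in U, g z ^ 2 ∂(hausdorff2 X) < ∞

/-- `g` is (a representative of) the minimal weak upper gradient `g_h` of `h`: a locally
square-integrable weak upper gradient that is a.e. at most any other one. Two functions with this
property agree a.e. -/
def IsMinimalWeakUpperGradient (h : X → Y) (g : X → ℝ≥0∞) : Prop :=
  IsWeakUpperGradient h g ∧ LocallyL2 g ∧
    ∀ g' : X → ℝ≥0∞, IsWeakUpperGradient h g' → LocallyL2 g' → g ≤ᵐ[hausdorff2 X] g'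

/-- The Borel measure `ν` is the set function `E ↦ ℋ²(h(E))`; this determines `ν`, and such a `ν`
exists exactly if this set function is a measure on the Borel sets of `X`. -/
def IsImageMeasure (h : X → Y) (ν : Measure X) : Prop :=
  ∀ E : Set X, MeasurableSet E → ν E = hausdorff2 Y (h '' E)

/-- If `h` is continuous and `Y` has locally finite Hausdorff `2`-measure, then `E ↦ ℋ²(h(E))` is
locally finite whenever it is a measure. So its Radon-Nikodym derivative makes sense. -/
theorem IsImageMeasure.isLocallyFiniteMeasure {h : X → Y} {ν : Measure X}
    (hν : IsImageMeasure h ν) (hc : Continuous h) (hY : IsLocallyFiniteMeasure (hausdorff2 Y)) :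
    IsLocallyFiniteMeasure ν := by
  refine ⟨fun x => ?_⟩
  obtain ⟨V, hxV, hV, hfin⟩ := (hausdorff2 Y).exists_isOpen_measure_lt_top (h x)
  refine ⟨h ⁻¹' V, (hV.preimage hc).mem_nhds hxV, ?_⟩
  rw [hν _ (hV.preimage hc).measurableSet]
  exact (measure_mono (image_preimage_subset h V)).trans_lt hfin

/-- Weakly `K`-quasiconformal maps: continuous, surjective, monotone (the preimage of each point is
connected), with `Mod Γ ≤ K Mod h(Γ)` for every path family `Γ` in `X`. -/
structure IsWeaklyQuasiconformal (K : ℝ≥0) (h : X → Y) : Prop where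
  continuous : Continuous h
  surjective : Function.Surjective h
  monotone : ∀ y : Y, IsConnected (h ⁻¹' {y})
  modulus_le : ∀ Γ : Set (Curve X),
    modulus Γ ≤ K * modulus ((fun γ => Curve.comp ⟨h, continuous⟩ γ) '' Γ)

end

end QC

end

/-! Everything is measured along paths. The length of a path is a measure on its parameter line, so
the lengths of `γ` and `h ∘ γ` can be compared as measures, and `g` acts as a gradient when, for
almost every `γ`, the length measure of `h ∘ γ` is at most `g ds`.

Analytic to geometric (`modulus_le_of_sq_le_rnDeriv`): if `ρ` is admissible for `h(Γ)`, then `g · (ρ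
∘ h)` is admissible for `Γ` up to a family of modulus zero. Its energy is at most `K ∫ (ρ ∘ h)² dν =
K ∫ ρ² dℋ²`, because `ν` pushes forward to `ℋ²` on `Y`.

Geometric to analytic. The modulus inequality turns each `w ∈ L²(Y)` into some `g ∈ L²(X)` with `∫
g² ≤ K ∫ w²` and `∫_{h∘γ} w ≤ ∫_γ g` for almost every `γ` (`exists_gradient_of_modulus_le`). Paths
are cut into pieces of `w`-length `δ`, an almost optimal admissible function is scaled by `δ`, and
`δ → 0` in a Hilbert space. A positive weight `w` yields a weak upper gradient. An indicator `w =
1_A`, with the minimality of `g_h`, yields `∫_{h⁻¹A} g_h² ≤ K ℋ²(A)`, and differentiation gives the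
pointwise bound.

For `ν` to be a measure, almost every fiber must be a point (`ae_subsingleton_fiber`). At almost
every `y` the area density is finite, so the nonconstant paths from `y` to other points are
negligible (`eventually_target_eq_of_source_eq`); hence the paths leaving the fiber over `y` have
modulus zero. If this fiber has empty interior and more than one point, that is impossible
(`modulus_leaving_ne_zero`): planar topology provides an interval of levels of a Lipschitz function,
each containing a continuum that leaves the fiber. Almost all of these continua have finite length
and can be traversed by curves, and Eilenberg's inequality integrates the resulting bounds. Only
countably many fibers have interior. -/

noncomputable section

set_option linter.unusedSectionVars false

namespace QC

/-! ### Comparison of measures on the line -/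

section MeasureOnReals

theorem tendsto_measure_Iic_right (μ : Measure ℝ) [IsFiniteMeasure μ] (a : ℝ) :
    ContinuousWithinAt (fun x => (μ (Iic x)).toReal) (Ici a) a := by
  rw [← continuousWithinAt_Ioi_iff_Ici]
  have h := tendsto_measure_biInter_gt (μ := μ) (s := fun x : ℝ => Iic x) (a := a)
    (fun r _ => measurableSet_Iic.nullMeasurableSet) (fun i j _ hij => Iic_subset_Iic.2 hij)
    ⟨a + 1, by simp, measure_ne_top _ _⟩
  have e : (⋂ r > a, Iic r) = Iic a := by
    ext x
    simp only [mem_iInter, mem_Iic]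
    exact ⟨fun h => le_of_forall_gt_imp_ge_of_dense h, fun h r hr => h.trans (le_of_lt hr)⟩
  rw [e] at h
  exact (ENNReal.tendsto_toReal (measure_ne_top _ _)).comp h

/-- Finite measures on the line can be compared on half-open intervals. -/
theorem measure_le_of_Ioc_le {μ ν : Measure ℝ} [IsFiniteMeasure μ] [IsFiniteMeasure ν]
    (h : ∀ a b : ℝ, a < b → μ (Ioc a b) ≤ ν (Ioc a b)) : μ ≤ ν := by
  have key : ∀ (m : Measure ℝ) [IsFiniteMeasure m] (a b : ℝ), a ≤ b →
      (m (Iic b)).toReal - (m (Iic a)).toReal = (m (Ioc a b)).toReal := by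
    intro m _ a b hab
    have : m (Iic b) = m (Iic a) + m (Ioc a b) := by
      rw [← Iic_union_Ioc_eq_Iic hab, measure_union
        (Set.disjoint_left.2 fun x hx hx' => not_lt.2 (mem_Iic.1 hx) hx'.1) measurableSet_Ioc]
    rw [this, ENNReal.toReal_add (measure_ne_top _ _) (measure_ne_top _ _)]
    ring
  have hle : ∀ a b : ℝ, a ≤ b → (μ (Ioc a b)).toReal ≤ (ν (Ioc a b)).toReal := by
    intro a b hab
    rcases hab.eq_or_lt with rfl | hab
    · simp
    · exact ENNReal.toReal_mono (measure_ne_top _ _) (h a b hab)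
  -- The difference of the two distribution functions is again a distribution function, and its
  -- Stieltjes measure is what `μ` lacks of `ν`.
  let D : StieltjesFunction ℝ :=
    { toFun := fun x => (ν (Iic x)).toReal - (μ (Iic x)).toReal
      mono' := fun a b hab => by
        have h1 := key μ a b hab
        have h2 := key ν a b hab
        have h3 := hle a b hab
        simp only
        linarith
      right_continuous' := fun x =>
        (tendsto_measure_Iic_right ν x).sub (tendsto_measure_Iic_right μ x) }
  have : ν = μ + D.measure := by
    refine Measure.ext_of_Ioc _ _ fun a b hab => ?_
    rw [Measure.add_apply, D.measure_Ioc]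
    have e : D b - D a = (ν (Ioc a b)).toReal - (μ (Ioc a b)).toReal := by
      change ((ν (Iic b)).toReal - (μ (Iic b)).toReal) -
        ((ν (Iic a)).toReal - (μ (Iic a)).toReal) = _
      rw [← key ν a b hab.le, ← key μ a b hab.le]
      ring
    rw [e, ENNReal.ofReal_sub _ ENNReal.toReal_nonneg,
      ENNReal.ofReal_toReal (measure_ne_top _ _), ENNReal.ofReal_toReal (measure_ne_top _ _)]
    exact (add_tsub_cancel_of_le (h a b hab)).symm
  rw [this]
  exact Measure.le_add_right le_rfl

end MeasureOnReals

/-! ### Paths and their length measures -/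

namespace Curve

section Extension

variable {X Y : Type*} [TopologicalSpace X] [TopologicalSpace Y]

/-- The extension of a path to the line that is constant outside the parameter interval. -/
def ext (γ : Curve X) : ℝ → X := IccExtend γ.le γ.map

theorem continuous_ext (γ : Curve X) : Continuous γ.ext := γ.map.continuous.Icc_extend'

theorem ext_coe (γ : Curve X) (u : Icc γ.lo γ.hi) : γ.ext u = γ.map u := IccExtend_val _ _ _

theorem ext_lo (γ : Curve X) : γ.ext γ.lo = γ.source := γ.ext_coe γ.left

theorem ext_hi (γ : Curve X) : γ.ext γ.hi = γ.target := γ.ext_coe γ.right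

theorem ext_comp (h : C(X, Y)) (γ : Curve X) : (γ.comp h).ext = h ∘ γ.ext := rfl

/-- The restriction of a path to a subinterval of the parameter interval. -/
def sub (γ : Curve X) (a b : ℝ) (hab : a ≤ b) : Curve X where
  lo := a
  hi := b
  le := hab
  map := ⟨fun u => γ.ext u, γ.continuous_ext.comp continuous_subtype_val⟩

theorem ext_sub (γ : Curve X) {a b : ℝ} (hab : a ≤ b) :
    (γ.sub a b hab).ext = fun u => γ.ext (projIcc a b hab u) := rfl

theorem comp_sub (h : C(X, Y)) (γ : Curve X) {a b : ℝ} (hab : a ≤ b) :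
    (γ.sub a b hab).comp h = (γ.comp h).sub a b hab := rfl

end Extension

section Length

variable {X Y : Type*} [MetricSpace X] [MetricSpace Y]

theorem projIcc_image_univ {a b : ℝ} (hab : a ≤ b) : projIcc a b hab '' univ = univ := by
  rw [image_univ, (projIcc_surjective hab).range_eq]

theorem eVariationOn_ext (γ : Curve X) : eVariationOn γ.ext univ = γ.length := by
  have := eVariationOn.comp_eq_of_monotoneOn (γ.map : _ → X) (t := univ)
    (projIcc γ.lo γ.hi γ.le) ((monotone_projIcc γ.le).monotoneOn _)
  rw [projIcc_image_univ] at this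
  exact this

/-- The length of the part of a path up to a given parameter. -/
def lengthUpTo (γ : Curve X) (u : ℝ) : ℝ := variationOnFromTo γ.ext univ γ.lo u

theorem lengthUpTo_eq (γ : Curve X) (u : ℝ) : γ.lengthUpTo u =
    variationOnFromTo γ.map univ γ.left (projIcc γ.lo γ.hi γ.le u) := by
  have := variationOnFromTo.comp_eq_of_monotoneOn (γ.map : _ → X) (t := univ)
    (projIcc γ.lo γ.hi γ.le) ((monotone_projIcc γ.le).monotoneOn _) (mem_univ γ.lo) (mem_univ u)
  rw [projIcc_image_univ, projIcc_left] at this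
  exact this

theorem Rectifiable.locallyBoundedVariationOn {γ : Curve X} (hγ : γ.Rectifiable) :
    LocallyBoundedVariationOn γ.ext univ := by
  have : BoundedVariationOn γ.ext univ := by
    rw [BoundedVariationOn, eVariationOn_ext]
    exact hγ
  exact this.locallyBoundedVariationOn

theorem Rectifiable.monotone_lengthUpTo {γ : Curve X} (hγ : γ.Rectifiable) :
    Monotone γ.lengthUpTo := fun a b hab =>
  variationOnFromTo.monotoneOn hγ.locallyBoundedVariationOn (mem_univ _) (mem_univ a) (mem_univ b)
    hab

theorem Rectifiable.continuous_lengthUpTo {γ : Curve X} (hγ : γ.Rectifiable) :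
    Continuous γ.lengthUpTo := by
  change Continuous (variationOnFromTo γ.ext univ γ.lo)
  rw [continuous_iff_continuousAt]
  intro u
  rw [continuousAt_iff_continuous_left'_right']
  constructor
  · have := variationOnFromTo.tendsto_left (l := γ.ext u) (mem_univ γ.lo) (mem_univ u)
      hγ.locallyBoundedVariationOn (γ.continuous_ext.continuousAt.tendsto.mono_left inf_le_left)
    simpa [univ_inter, ContinuousWithinAt, lengthUpTo] using this
  · have := variationOnFromTo.tendsto_right (l := γ.ext u) (mem_univ γ.lo) (mem_univ u)
      hγ.locallyBoundedVariationOn (γ.continuous_ext.continuousAt.tendsto.mono_left inf_le_left)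
    simpa [univ_inter, ContinuousWithinAt] using this

theorem lengthUpTo_lo (γ : Curve X) : γ.lengthUpTo γ.lo = 0 := variationOnFromTo.self _ _ _

theorem lengthUpTo_hi (γ : Curve X) : γ.lengthUpTo γ.hi = γ.length.toReal := by
  rw [lengthUpTo_eq, projIcc_right, variationOnFromTo.eq_of_le _ _ (show γ.left ≤ _ from γ.le)]
  have : univ ∩ Icc γ.left ⟨γ.hi, right_mem_Icc.2 γ.le⟩ = univ := by
    ext x
    simpa [left] using ⟨x.2.1, x.2.2⟩
  rw [this]
  rfl

theorem lengthUpTo_mem (γ : Curve X) (hγ : γ.Rectifiable) (u : ℝ) :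
    γ.lengthUpTo u ∈ Icc 0 γ.length.toReal := by
  have h : γ.lengthUpTo u = γ.lengthUpTo (projIcc γ.lo γ.hi γ.le u) := by
    rw [lengthUpTo_eq γ u, lengthUpTo_eq γ (projIcc γ.lo γ.hi γ.le u : ℝ), projIcc_val]
  rw [h, ← lengthUpTo_lo γ, ← lengthUpTo_hi γ]
  exact ⟨hγ.monotone_lengthUpTo (projIcc _ _ _ u).2.1, hγ.monotone_lengthUpTo (projIcc _ _ _ u).2.2⟩

/-- A parameter at which the path has a given length. -/
def paramAtLength (γ : Curve X) (t : ℝ) : ℝ :=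
  haveI : Nonempty (Icc γ.lo γ.hi) := ⟨γ.left⟩
  (Function.invFunOn (variationOnFromTo γ.map univ γ.left) univ t : Icc γ.lo γ.hi)

theorem arcLength_eq (γ : Curve X) (t : ℝ) : γ.arcLength t = γ.ext (γ.paramAtLength t) := by
  rw [paramAtLength, ext_coe]
  rfl

theorem lengthUpTo_paramAtLength {γ : Curve X} (hγ : γ.Rectifiable) {t : ℝ}
    (ht : t ∈ Icc 0 γ.length.toReal) : γ.lengthUpTo (γ.paramAtLength t) = t := by
  rw [← lengthUpTo_lo γ, ← lengthUpTo_hi γ] at ht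
  obtain ⟨u, hu, hut⟩ := intermediate_value_Icc γ.le hγ.continuous_lengthUpTo.continuousOn ht
  have : Nonempty (Icc γ.lo γ.hi) := ⟨γ.left⟩
  rw [lengthUpTo_eq, paramAtLength, projIcc_val]
  refine Function.invFunOn_eq (f := variationOnFromTo γ.map univ γ.left)
    ⟨projIcc γ.lo γ.hi γ.le u, mem_univ _, ?_⟩
  rw [← lengthUpTo_eq, hut]

theorem monotoneOn_paramAtLength {γ : Curve X} (hγ : γ.Rectifiable) :
    MonotoneOn γ.paramAtLength (Icc 0 γ.length.toReal) := by
  intro s hs t ht hst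
  by_contra! hlt
  have := hγ.monotone_lengthUpTo hlt.le
  rw [lengthUpTo_paramAtLength hγ hs, lengthUpTo_paramAtLength hγ ht] at this
  have : s = t := le_antisymm hst this
  subst this
  exact lt_irrefl _ hlt

/-- The length measure of a path on its parameter interval. -/
def lengthMeasure (γ : Curve X) : Measure ℝ :=
  (volume.restrict (Icc 0 γ.length.toReal)).map γ.paramAtLength

theorem aemeasurable_paramAtLength {γ : Curve X} (hγ : γ.Rectifiable) :
    AEMeasurable γ.paramAtLength (volume.restrict (Icc 0 γ.length.toReal)) :=
  aemeasurable_restrict_of_monotoneOn measurableSet_Icc (monotoneOn_paramAtLength hγ)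

instance (γ : Curve X) : IsFiniteMeasure γ.lengthMeasure := by
  unfold lengthMeasure
  infer_instance

/-- Moves the integral from the arc-length interval to the original parameter, which `γ` and `h ∘ γ`
share. -/
theorem lineIntegral_eq_lintegral [MeasurableSpace X] [BorelSpace X] {γ : Curve X}
    (hγ : γ.Rectifiable) {ρ : X → ℝ≥0∞} (hρ : Measurable ρ) :
    γ.lineIntegral ρ = ∫⁻ u, ρ (γ.ext u) ∂γ.lengthMeasure := by
  rw [lengthMeasure, lintegral_map' (f := fun u => ρ (γ.ext u))
    (hρ.comp γ.continuous_ext.measurable).aemeasurable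
    (aemeasurable_paramAtLength hγ), lineIntegral]
  simp only [arcLength_eq]

/-- Monotonicity of `lengthUpTo` traps the preimage of `Ioc a b` between the open and the closed
interval with end points `lengthUpTo a` and `lengthUpTo b`. The parameter chosen by `paramAtLength`
where the path rests is therefore irrelevant. -/
theorem lengthMeasure_Ioc {γ : Curve X} (hγ : γ.Rectifiable) (a b : ℝ) :
    γ.lengthMeasure (Ioc a b) = ENNReal.ofReal (γ.lengthUpTo b - γ.lengthUpTo a) := by
  rw [lengthMeasure, Measure.map_apply_of_aemeasurable (aemeasurable_paramAtLength hγ)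
    measurableSet_Ioc]
  refine le_antisymm ?_ ?_
  · rw [Measure.restrict_apply' measurableSet_Icc]
    refine (measure_mono (t := Icc (γ.lengthUpTo a) (γ.lengthUpTo b)) ?_).trans_eq Real.volume_Icc
    rintro t ⟨ht, ht'⟩
    rw [← lengthUpTo_paramAtLength hγ ht']
    exact ⟨hγ.monotone_lengthUpTo ht.1.le, hγ.monotone_lengthUpTo ht.2⟩
  · rw [Measure.restrict_apply' measurableSet_Icc, ← Real.volume_Ioo]
    refine measure_mono ?_
    rintro t ⟨ht, ht'⟩
    have hm : t ∈ Icc 0 γ.length.toReal :=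
      ⟨(γ.lengthUpTo_mem hγ a).1.trans ht.le, ht'.le.trans (γ.lengthUpTo_mem hγ b).2⟩
    refine ⟨⟨?_, ?_⟩, hm⟩
    · by_contra! h
      have := hγ.monotone_lengthUpTo h
      rw [lengthUpTo_paramAtLength hγ hm] at this
      linarith
    · by_contra! h
      have := hγ.monotone_lengthUpTo h.le
      rw [lengthUpTo_paramAtLength hγ hm] at this
      linarith

theorem lengthMeasure_Ioc_eq_eVariationOn {γ : Curve X} (hγ : γ.Rectifiable) {a b : ℝ}
    (hab : a ≤ b) : γ.lengthMeasure (Ioc a b) = eVariationOn γ.ext (Icc a b) := by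
  rw [lengthMeasure_Ioc hγ, lengthUpTo, lengthUpTo,
    variationOnFromTo.sub_right hγ.locallyBoundedVariationOn (mem_univ _) (mem_univ _) (mem_univ _),
    variationOnFromTo.eq_of_le _ _ hab, univ_inter, ENNReal.ofReal_toReal]
  have := hγ.locallyBoundedVariationOn a b (mem_univ _) (mem_univ _)
  rwa [univ_inter] at this

theorem edist_le_lengthMeasure {γ : Curve X} (hγ : γ.Rectifiable) {a b : ℝ} (hab : a ≤ b) :
    edist (γ.ext a) (γ.ext b) ≤ γ.lengthMeasure (Ioc a b) := by
  rw [lengthMeasure_Ioc_eq_eVariationOn hγ hab]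
  exact eVariationOn.edist_le _ (left_mem_Icc.2 hab) (right_mem_Icc.2 hab)

theorem length_sub_le (γ : Curve X) {a b : ℝ} (hab : a ≤ b) :
    (γ.sub a b hab).length ≤ γ.length := by
  rw [← eVariationOn_ext γ, length]
  exact eVariationOn.comp_le_of_monotoneOn γ.ext (fun u : Icc a b => (u : ℝ))
    (fun _ _ _ _ h => h) (mapsTo_univ _ _)

theorem Rectifiable.sub {γ : Curve X} (hγ : γ.Rectifiable) {a b : ℝ} (hab : a ≤ b) :
    (γ.sub a b hab).Rectifiable := ne_top_of_le_ne_top hγ (γ.length_sub_le hab)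

/-- The extension of the subpath is `γ.ext` composed with the monotone projection to `[a, b]`, and
variation is invariant under monotone reparametrization. -/
theorem lengthMeasure_sub {γ : Curve X} (hγ : γ.Rectifiable) {a b : ℝ} (hab : a ≤ b) :
    (γ.sub a b hab).lengthMeasure = γ.lengthMeasure.restrict (Ioc a b) := by
  refine Measure.ext_of_Ioc _ _ fun c d hcd => ?_
  have hm : Monotone (fun u : ℝ => (projIcc a b hab u : ℝ)) := fun x y h => monotone_projIcc hab h
  have himg : (fun u : ℝ => (projIcc a b hab u : ℝ)) '' Icc c d =
      Icc (projIcc a b hab c : ℝ) (projIcc a b hab d) := by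
    refine (hm.mapsTo_Icc.image_subset).antisymm ?_
    exact intermediate_value_Icc hcd.le (continuous_projIcc.subtype_val).continuousOn
  rw [lengthMeasure_Ioc_eq_eVariationOn (hγ.sub hab) hcd.le, ext_sub,
    Measure.restrict_apply measurableSet_Ioc, Ioc_inter_Ioc]
  have e := eVariationOn.comp_eq_of_monotoneOn γ.ext (t := Icc c d)
    (fun u : ℝ => (projIcc a b hab u : ℝ)) (hm.monotoneOn _)
  rw [himg] at e
  refine e.trans ?_
  rw [← lengthMeasure_Ioc_eq_eVariationOn hγ (hm hcd.le)]
  simp only [coe_projIcc]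
  rcases le_or_gt (max c a) (min d b) with h | h
  · congr 2
    · rcases le_total c b with h' | h' <;> grind
    · grind
  · rw [Ioc_eq_empty_of_le h.le, Ioc_eq_empty_of_le]
    grind

end Length

end Curve

/-! ### Modulus, and properties of almost every path -/

section Modulus

variable {X Y : Type*} [MetricSpace X] [MeasurableSpace X] [BorelSpace X]
  [MetricSpace Y] [MeasurableSpace Y] [BorelSpace Y]

theorem Curve.lineIntegral_mono {ρ ρ' : X → ℝ≥0∞} (h : ρ ≤ ρ') (γ : Curve X) :
    γ.lineIntegral ρ ≤ γ.lineIntegral ρ' := lintegral_mono fun _ => h _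

theorem Curve.lineIntegral_const_mul {c : ℝ≥0∞} (hc : c ≠ ∞) (ρ : X → ℝ≥0∞) (γ : Curve X) :
    γ.lineIntegral (fun x => c * ρ x) = c * γ.lineIntegral ρ :=
  lintegral_const_mul' _ _ hc

theorem Curve.lineIntegral_sub {γ : Curve X} (hγ : γ.Rectifiable) {ρ : X → ℝ≥0∞}
    (hρ : Measurable ρ) {a b : ℝ} (hab : a ≤ b) :
    (γ.sub a b hab).lineIntegral ρ = ∫⁻ u in Ioc a b, ρ (γ.ext u) ∂γ.lengthMeasure := by
  rw [Curve.lineIntegral_eq_lintegral (hγ.sub hab) hρ, Curve.lengthMeasure_sub hγ]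
  refine setLIntegral_congr_fun measurableSet_Ioc fun u hu => ?_
  simp only [Curve.ext_sub]
  rw [projIcc_of_mem hab (Ioc_subset_Icc_self hu)]

theorem Curve.lineIntegral_sub_le {γ : Curve X} (hγ : γ.Rectifiable) {ρ : X → ℝ≥0∞}
    (hρ : Measurable ρ) {a b : ℝ} (hab : a ≤ b) :
    (γ.sub a b hab).lineIntegral ρ ≤ γ.lineIntegral ρ := by
  rw [Curve.lineIntegral_sub hγ hρ, Curve.lineIntegral_eq_lintegral hγ hρ]
  exact setLIntegral_le_lintegral _ _

theorem modulus_le_of_admissible {Γ : Set (Curve X)} {ρ : X → ℝ≥0∞} (h : Admissible Γ ρ) :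
    modulus Γ ≤ ∫⁻ x, ρ x ^ 2 ∂(hausdorff2 X) := iInf₂_le ρ h

theorem exists_admissible_lt {Γ : Set (Curve X)} {c : ℝ≥0∞} (h : modulus Γ < c) :
    ∃ ρ : X → ℝ≥0∞, Admissible Γ ρ ∧ ∫⁻ x, ρ x ^ 2 ∂(hausdorff2 X) < c := by
  simpa [modulus, iInf_lt_iff] using h

theorem Admissible.mono {Γ Γ' : Set (Curve X)} {ρ : X → ℝ≥0∞} (h : Admissible Γ' ρ)
    (hΓ : Γ ⊆ Γ') : Admissible Γ ρ := ⟨h.1, fun γ hγ => h.2 γ (hΓ hγ)⟩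

theorem modulus_mono {Γ Γ' : Set (Curve X)} (hΓ : Γ ⊆ Γ') : modulus Γ ≤ modulus Γ' :=
  le_iInf₂ fun _ h => modulus_le_of_admissible (h.mono hΓ)

theorem lintegral_iSup_sq_le {α ι : Type*} [MeasurableSpace α] [Countable ι] (μ : Measure α)
    {f : ι → α → ℝ≥0∞} (hf : ∀ i, Measurable (f i)) :
    ∫⁻ x, (⨆ i, f i x) ^ 2 ∂μ ≤ ∑' i, ∫⁻ x, f i x ^ 2 ∂μ := by
  rw [← lintegral_tsum fun i => ((hf i).pow_const 2).aemeasurable]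
  refine lintegral_mono fun x => ?_
  rw [Monotone.map_iSup_of_continuousAt (f := fun y : ℝ≥0∞ => y ^ 2)
    (ENNReal.continuous_pow 2).continuousAt (fun _ _ h => pow_le_pow_left' h 2) (by simp)]
  exact iSup_le fun i => ENNReal.le_tsum (f := fun i => f i x ^ 2) i

/-- Countable subadditivity of the modulus. -/
theorem modulus_iUnion_le {ι : Type*} [Countable ι] (Γ : ι → Set (Curve X)) :
    modulus (⋃ i, Γ i) ≤ ∑' i, modulus (Γ i) := by
  by_cases htop : ∑' i, modulus (Γ i) = ∞
  · simp [htop]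
  refine ENNReal.le_of_forall_pos_le_add fun ε hε _ => ?_
  obtain ⟨ε', hε', hsum⟩ := ENNReal.exists_pos_sum_of_countable (ENNReal.coe_pos.2 hε).ne' ι
  have hlt : ∀ i, modulus (Γ i) < modulus (Γ i) + ε' i := fun i =>
    ENNReal.lt_add_right (ENNReal.ne_top_of_tsum_ne_top htop i) (ENNReal.coe_pos.2 (hε' i)).ne'
  choose ρ hρ hρ' using fun i => exists_admissible_lt (hlt i)
  have hadm : Admissible (⋃ i, Γ i) (fun x => ⨆ i, ρ i x) := by
    refine ⟨.iSup fun i => (hρ i).1, fun γ hγ hr => ?_⟩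
    obtain ⟨i, hi⟩ := mem_iUnion.1 hγ
    exact ((hρ i).2 γ hi hr).trans (γ.lineIntegral_mono fun x => le_iSup (fun i => ρ i x) i)
  calc modulus (⋃ i, Γ i) ≤ _ := modulus_le_of_admissible hadm
    _ ≤ ∑' i, ∫⁻ x, ρ i x ^ 2 ∂(hausdorff2 X) := lintegral_iSup_sq_le _ fun i => (hρ i).1
    _ ≤ ∑' i, (modulus (Γ i) + ε' i) := ENNReal.tsum_le_tsum fun i => (hρ' i).le
    _ ≤ _ := by
      rw [ENNReal.tsum_add]
      gcongr

theorem modulus_iUnion_eq_zero {ι : Type*} [Countable ι] {Γ : ι → Set (Curve X)}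
    (h : ∀ i, modulus (Γ i) = 0) : modulus (⋃ i, Γ i) = 0 := by
  simpa [h] using modulus_iUnion_le Γ

theorem modulus_union_le (Γ Γ' : Set (Curve X)) : modulus (Γ ∪ Γ') ≤ modulus Γ + modulus Γ' := by
  have := modulus_iUnion_le (fun b : Bool => cond b Γ Γ')
  rwa [← union_eq_iUnion, tsum_bool, add_comm] at this

theorem modulus_empty : modulus (∅ : Set (Curve X)) = 0 := by
  have : Admissible (∅ : Set (Curve X)) 0 := ⟨measurable_zero, by simp⟩
  simpa using modulus_le_of_admissible this

variable (X) in
/-- The filter of path families whose complement has modulus zero. -/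
def modAE : Filter (Curve X) where
  sets := {P | modulus Pᶜ = 0}
  univ_sets := by simp [modulus_empty]
  sets_of_superset {P Q} hP hPQ :=
    le_antisymm ((modulus_mono (compl_subset_compl.2 hPQ)).trans_eq hP) zero_le
  inter_sets {P Q} hP hQ := by
    rw [mem_ofPred_eq] at *
    have := modulus_union_le Pᶜ Qᶜ
    rw [compl_inter]
    simpa [hP, hQ] using this

theorem eventually_modAE {P : Curve X → Prop} :
    (∀ᶠ γ in modAE X, P γ) ↔ modulus {γ | ¬ P γ} = 0 := Iff.rfl

instance : CountableInterFilter (modAE X) := by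
  refine ⟨fun S hS h => ?_⟩
  change modulus (⋂₀ S)ᶜ = 0
  rw [compl_sInter, sUnion_image, biUnion_eq_iUnion]
  have := hS.to_subtype
  exact modulus_iUnion_eq_zero fun s => h s s.2

/-- Admissibility tests rectifiable paths only, so the zero function is admissible for the others.
-/
theorem eventually_rectifiable : ∀ᶠ γ in modAE X, γ.Rectifiable := by
  rw [eventually_modAE]
  have : Admissible {γ : Curve X | ¬ γ.Rectifiable} 0 :=
    ⟨measurable_zero, fun γ h h' => absurd h' h⟩
  simpa using modulus_le_of_admissible this

/-- The Chebyshev inequality for the modulus. -/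
theorem modulus_lineIntegral_ge_le {f : X → ℝ≥0∞} (hf : Measurable f) {c : ℝ≥0∞} (hc : c ≠ 0)
    (hc' : c ≠ ∞) :
    modulus {γ : Curve X | c ≤ γ.lineIntegral f} ≤
      (c⁻¹) ^ 2 * ∫⁻ x, f x ^ 2 ∂(hausdorff2 X) := by
  have : Admissible {γ : Curve X | c ≤ γ.lineIntegral f} (fun x => c⁻¹ * f x) := by
    refine ⟨hf.const_mul _, fun γ hγ _ => ?_⟩
    rw [Curve.lineIntegral_const_mul (ENNReal.inv_ne_top.2 hc), ← ENNReal.inv_mul_cancel hc hc']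
    gcongr
    exact hγ
  refine (modulus_le_of_admissible this).trans_eq ?_
  simp only [mul_pow]
  exact lintegral_const_mul _ (hf.pow_const 2)

theorem eventually_lineIntegral_ne_top {f : X → ℝ≥0∞} (hf : Measurable f)
    (hf2 : ∫⁻ x, f x ^ 2 ∂(hausdorff2 X) ≠ ∞) :
    ∀ᶠ γ in modAE X, γ.lineIntegral f ≠ ∞ := by
  rw [eventually_modAE]
  have h : ∀ n : ℕ, modulus {γ : Curve X | ¬ γ.lineIntegral f ≠ ∞} ≤
      ((n + 1 : ℕ) : ℝ≥0∞)⁻¹ * ∫⁻ x, f x ^ 2 ∂(hausdorff2 X) := fun n => by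
    have h1 : (((n + 1 : ℕ) : ℝ≥0∞)⁻¹) ^ 2 ≤ ((n + 1 : ℕ) : ℝ≥0∞)⁻¹ := by
      refine pow_le_of_le_one zero_le (ENNReal.inv_le_one.2 ?_) two_ne_zero
      exact_mod_cast Nat.le_add_left 1 n
    refine (modulus_mono ?_).trans ((modulus_lineIntegral_ge_le hf (c := ((n + 1 : ℕ) : ℝ≥0∞))
      (by simp) (ENNReal.natCast_ne_top _)).trans (by gcongr))
    intro γ hγ
    simp only [ne_eq, not_not, mem_ofPred_eq] at hγ ⊢
    simp [hγ]
  have hlim : Filter.Tendsto (fun n : ℕ => ((n + 1 : ℕ) : ℝ≥0∞)⁻¹ *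
      ∫⁻ x, f x ^ 2 ∂(hausdorff2 X)) Filter.atTop (𝓝 0) := by
    have := ENNReal.Tendsto.mul_const (b := ∫⁻ x, f x ^ 2 ∂(hausdorff2 X))
      ((Filter.tendsto_add_atTop_iff_nat 1).2 ENNReal.tendsto_inv_nat_nhds_zero) (Or.inr hf2)
    simpa using this
  exact le_antisymm (ge_of_tendsto' hlim h) zero_le

/-- A property of almost every path holds for all subpaths of almost every path. -/
theorem eventually_forall_sub {P : Curve X → Prop} (h : ∀ᶠ γ in modAE X, P γ) :
    ∀ᶠ γ in modAE X, ∀ a b : ℝ, ∀ hab : a ≤ b, P (γ.sub a b hab) := by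
  rw [eventually_modAE] at h ⊢
  refine le_antisymm (le_trans ?_ h.le) zero_le
  -- A function admissible for the exceptional subpaths is admissible for every path that contains
  -- one of them.
  refine le_iInf₂ fun ρ hρ => modulus_le_of_admissible ⟨hρ.1, fun γ hγ hr => ?_⟩
  simp only [mem_ofPred_eq, not_forall] at hγ
  obtain ⟨a, b, hab, hP⟩ := hγ
  exact (hρ.2 _ hP (hr.sub hab)).trans (Curve.lineIntegral_sub_le hr hρ.1 hab)

/-- Almost every path spends no length in a given null set. -/
theorem eventually_ae_lengthMeasure {P : X → Prop} (h : ∀ᵐ x ∂(hausdorff2 X), P x) :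
    ∀ᶠ γ in modAE X, ∀ᵐ u ∂γ.lengthMeasure, P (γ.ext u) := by
  obtain ⟨N, hN, hNm, hN0⟩ := exists_measurable_superset_of_null (ae_iff.1 h)
  -- The function `∞ · 1_N` has zero energy, yet its line integral is infinite on any path that
  -- spends positive length in `N`.
  have hf : Measurable (N.indicator (fun _ => (∞ : ℝ≥0∞))) := measurable_const.indicator hNm
  have h0 : ∫⁻ x, (N.indicator (fun _ => (∞ : ℝ≥0∞)) x) ^ 2 ∂(hausdorff2 X) ≠ ∞ := by
    have : (fun x => (N.indicator (fun _ => (∞ : ℝ≥0∞)) x) ^ 2) =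
        N.indicator (fun _ => (∞ : ℝ≥0∞)) := by
      ext x
      by_cases hx : x ∈ N <;> simp [hx]
    rw [this, lintegral_indicator hNm, setLIntegral_const, hN0]
    simp
  filter_upwards [eventually_lineIntegral_ne_top hf h0, eventually_rectifiable] with γ hγ hr
  rw [Curve.lineIntegral_eq_lintegral hr hf] at hγ
  have := ae_lt_top (hf.comp γ.continuous_ext.measurable) hγ
  filter_upwards [this] with u hu
  by_contra hP
  have : γ.ext u ∈ N := hN hP
  simp [this] at hu

/-- Countably many neighborhoods of finite energy cover the space, and each path, being compact,
meets finitely many of them at a time: finitely many cover it. -/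
theorem eventually_lineIntegral_ne_top_of_locallyL2 [SecondCountableTopology X] {f : X → ℝ≥0∞}
    (hf : Measurable f) (hf2 : LocallyL2 f) : ∀ᶠ γ in modAE X, γ.lineIntegral f ≠ ∞ := by
  choose U hU hUf using hf2
  obtain ⟨t, htc, ht⟩ := TopologicalSpace.countable_cover_nhds fun x => interior_mem_nhds.2 (hU x)
  have h1 : ∀ x ∈ t, ∀ᶠ γ in modAE X,
      γ.lineIntegral ((interior (U x)).indicator f) ≠ ∞ := fun x _ => by
    refine eventually_lineIntegral_ne_top (hf.indicator isOpen_interior.measurableSet) ?_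
    have : (fun z => ((interior (U x)).indicator f z) ^ 2) =
        (interior (U x)).indicator fun z => f z ^ 2 := by
      ext z
      by_cases hz : z ∈ interior (U x) <;> simp [hz]
    rw [this, lintegral_indicator isOpen_interior.measurableSet]
    exact ((lintegral_mono_set interior_subset).trans_lt (hUf x)).ne
  filter_upwards [(eventually_countable_ball htc).2 h1, eventually_rectifiable] with γ hγ hr
  have hcomp : IsCompact (range γ.ext) := by
    have : range γ.ext = range γ.map := IccExtend_range _ _
    rw [this]
    exact isCompact_range γ.map.continuous
  obtain ⟨s, hst, hs⟩ := hcomp.elim_finite_subcover_image (b := t)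
    (c := fun x => interior (U x)) (fun _ _ => isOpen_interior) (by rw [ht]; exact subset_univ _)
  obtain ⟨hsf, hs⟩ := hs
  rw [Curve.lineIntegral_eq_lintegral hr hf]
  have hle : ∀ u, f (γ.ext u) ≤
      ∑ x ∈ hsf.toFinset, (interior (U x)).indicator f (γ.ext u) := by
    intro u
    obtain ⟨x, hx, hxu⟩ := mem_iUnion₂.1 (hs (mem_range_self u))
    refine le_trans ?_ (Finset.single_le_sum (fun _ _ => zero_le) (hsf.mem_toFinset.2 hx))
    rw [indicator_of_mem hxu]
  refine ne_top_of_le_ne_top ?_ (lintegral_mono hle)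
  rw [lintegral_finsetSum (f := fun x u => (interior (U x)).indicator f (γ.ext u)) _ fun x _ =>
    (hf.indicator isOpen_interior.measurableSet).comp γ.continuous_ext.measurable]
  refine ENNReal.sum_ne_top.2 fun x hx => ?_
  have := hγ x (hst (hsf.mem_toFinset.1 hx))
  rwa [Curve.lineIntegral_eq_lintegral hr (hf.indicator isOpen_interior.measurableSet)] at this

/-- A form of Fuglede's lemma: a sequence that converges rapidly to zero in `L²` converges to zero
in the mean along almost every path. -/
theorem eventually_tendsto_lineIntegral {e : ℕ → X → ℝ≥0∞} (he : ∀ n, Measurable (e n))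
    (h : ∀ n, ∫⁻ x, e n x ^ 2 ∂(hausdorff2 X) ≤ (8⁻¹ : ℝ≥0∞) ^ n) :
    ∀ᶠ γ in modAE X, Filter.Tendsto (fun n => γ.lineIntegral (e n)) Filter.atTop (𝓝 0) := by
  have hm : ∀ n, Measurable fun x => (2 : ℝ≥0∞) ^ n * e n x := fun n => (he n).const_mul _
  -- The rate `8⁻ⁿ` leaves room for the weight `2ⁿ`: the weighted energies `4ⁿ · 8⁻ⁿ = 2⁻ⁿ` are
  -- summable. A finite line integral of the weighted supremum then forces geometric decay.
  have hfin : ∫⁻ x, (⨆ n, (2 : ℝ≥0∞) ^ n * e n x) ^ 2 ∂(hausdorff2 X) ≠ ∞ := by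
    have hb : ∀ n, ∫⁻ x, ((2 : ℝ≥0∞) ^ n * e n x) ^ 2 ∂(hausdorff2 X) ≤ (2⁻¹ : ℝ≥0∞) ^ n := by
      intro n
      simp only [mul_pow]
      rw [lintegral_const_mul _ ((he n).pow_const 2)]
      calc ((2 : ℝ≥0∞) ^ n) ^ 2 * ∫⁻ x, e n x ^ 2 ∂(hausdorff2 X)
          ≤ ((2 : ℝ≥0∞) ^ n) ^ 2 * (8⁻¹ : ℝ≥0∞) ^ n := by gcongr; exact h n
        _ = (2⁻¹ : ℝ≥0∞) ^ n := by
          rw [← pow_mul, mul_comm n 2, pow_mul, ← mul_pow]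
          congr 1
          rw [show (8 : ℝ≥0∞) = 2 ^ 2 * 2 by norm_num, ENNReal.mul_inv (by simp) (by simp),
            ← mul_assoc, ENNReal.mul_inv_cancel (by simp) (by simp), one_mul]
    refine ne_top_of_le_ne_top ?_ ((lintegral_iSup_sq_le _ hm).trans (ENNReal.tsum_le_tsum hb))
    rw [ENNReal.tsum_geometric, ENNReal.one_sub_inv_two, inv_inv]
    simp
  filter_upwards [eventually_lineIntegral_ne_top (.iSup hm) hfin] with γ hγ
  have hle : ∀ n, γ.lineIntegral (e n) ≤
      (2⁻¹ : ℝ≥0∞) ^ n * γ.lineIntegral (fun x => ⨆ n, (2 : ℝ≥0∞) ^ n * e n x) := by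
    intro n
    rw [← Curve.lineIntegral_const_mul (by finiteness)]
    refine γ.lineIntegral_mono fun x => ?_
    calc e n x = (2⁻¹ : ℝ≥0∞) ^ n * ((2 : ℝ≥0∞) ^ n * e n x) := by
          rw [← mul_assoc, ← mul_pow, ENNReal.inv_mul_cancel (by simp) (by simp), one_pow, one_mul]
      _ ≤ _ := by gcongr; exact le_iSup (fun n => (2 : ℝ≥0∞) ^ n * e n x) n
  refine tendsto_of_tendsto_of_tendsto_of_le_of_le tendsto_const_nhds ?_ (fun _ => zero_le) hle
  have := ENNReal.Tendsto.mul_const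
    (b := γ.lineIntegral (fun x => ⨆ n, (2 : ℝ≥0∞) ^ n * e n x))
    (ENNReal.tendsto_pow_atTop_nhds_zero_of_lt_one (r := 2⁻¹) (by simp)) (Or.inr hγ)
  simpa using this

end Modulus

/-! ### Behavior under isometric embeddings -/

section Isometry

variable {X Y : Type*} [MetricSpace X] [MeasurableSpace X] [BorelSpace X]
  [MetricSpace Y] [MeasurableSpace Y] [BorelSpace Y]

theorem eVariationOn_isometry_comp {α : Type*} [LinearOrder α] {ι : X → Y} (hι : Isometry ι)
    (f : α → X) (s : Set α) : eVariationOn (ι ∘ f) s = eVariationOn f s := by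
  simp only [eVariationOn, Function.comp, hι.edist_eq]

theorem Curve.length_comp_isometry {ι : C(X, Y)} (hι : Isometry ι) (γ : Curve X) :
    (γ.comp ι).length = γ.length := eVariationOn_isometry_comp hι γ.map univ

theorem Curve.lineIntegral_comp_isometry {ι : C(X, Y)} (hι : Isometry ι) (γ : Curve X)
    (ρ : Y → ℝ≥0∞) : (γ.comp ι).lineIntegral ρ = γ.lineIntegral (ρ ∘ ι) := by
  have : ∀ a b, variationOnFromTo (ι ∘ γ.map) univ a b = variationOnFromTo γ.map univ a b := by
    intro a b
    simp only [variationOnFromTo, eVariationOn_isometry_comp hι]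
  have h : ∀ t, (γ.comp ι).arcLength t = ι (γ.arcLength t) := by
    intro t
    have e : variationOnFromTo (ι ∘ γ.map) univ γ.left = variationOnFromTo γ.map univ γ.left :=
      funext fun b => this _ b
    change naturalParameterization (ι ∘ γ.map) univ γ.left t =
      ι (naturalParameterization γ.map univ γ.left t)
    simp only [naturalParameterization, e, Function.comp]
  simp only [Curve.lineIntegral, Curve.length_comp_isometry hι, h, Function.comp]

theorem lintegral_comp_isometry_le {ι : X → Y} (hι : Isometry ι) {f : Y → ℝ≥0∞}
    (hf : Measurable f) :
    ∫⁻ x, f (ι x) ∂(hausdorff2 X) ≤ ∫⁻ y, f y ∂(hausdorff2 Y) := by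
  have : (hausdorff2 X).map ι ≤ hausdorff2 Y := by
    unfold hausdorff2
    rw [Measure.map_smul, hι.map_hausdorffMeasure (Or.inl zero_le_two)]
    gcongr
    exact Measure.restrict_le_self
  rw [← lintegral_map hf hι.continuous.measurable]
  exact lintegral_mono' this le_rfl

theorem modulus_preimage_isometry_le {ι : C(X, Y)} (hι : Isometry ι) (Γ : Set (Curve Y)) :
    modulus {γ : Curve X | γ.comp ι ∈ Γ} ≤ modulus Γ := by
  refine le_iInf₂ fun ρ hρ => ?_
  have : Admissible {γ : Curve X | γ.comp ι ∈ Γ} (ρ ∘ ι) := by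
    refine ⟨hρ.1.comp ι.continuous.measurable, fun γ hγ hr => ?_⟩
    rw [← Curve.lineIntegral_comp_isometry hι]
    refine hρ.2 _ hγ ?_
    rwa [Curve.Rectifiable, Curve.length_comp_isometry hι]
  exact (modulus_le_of_admissible this).trans
    (lintegral_comp_isometry_le hι (hρ.1.pow_const 2))

end Isometry

/-! ### Gluing and minimizing densities -/

section Density

variable {α : Type*} [MeasurableSpace α]

theorem le_withDensity_piecewise {m μ : Measure α} {f₁ f₂ : α → ℝ≥0∞} {A : Set α}
    [DecidablePred (· ∈ A)] (hA : MeasurableSet A) (h₁ : m.restrict A ≤ μ.withDensity f₁)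
    (h₂ : m ≤ μ.withDensity f₂) : m ≤ μ.withDensity (A.piecewise f₁ f₂) := by
  refine Measure.le_iff.2 fun s hs => ?_
  rw [← measure_inter_add_sdiff s hA, withDensity_apply _ hs, ← lintegral_inter_add_sdiff _ s hA]
  refine add_le_add ?_ ?_
  · have := h₁ (s ∩ A)
    rw [Measure.restrict_apply (hs.inter hA), inter_assoc, inter_self,
      withDensity_apply _ (hs.inter hA)] at this
    refine this.trans_eq (setLIntegral_congr_fun (hs.inter hA) fun x hx => ?_)
    simp [hx.2]
  · have := h₂ (s \ A)
    rw [withDensity_apply _ (hs.diff hA)] at this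
    refine this.trans_eq (setLIntegral_congr_fun (hs.diff hA) fun x hx => ?_)
    simp [hx.2]

theorem le_withDensity_min {m μ : Measure α} {f₁ f₂ : α → ℝ≥0∞} (hf₁ : Measurable f₁)
    (hf₂ : Measurable f₂) (h₁ : m ≤ μ.withDensity f₁) (h₂ : m ≤ μ.withDensity f₂) :
    m ≤ μ.withDensity (fun x => min (f₁ x) (f₂ x)) := by
  classical
  have := le_withDensity_piecewise (measurableSet_le hf₁ hf₂)
    (Measure.restrict_le_self.trans h₁) h₂
  convert this using 2
  ext x
  by_cases hx : f₁ x ≤ f₂ x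
  · simp [hx]
  · simp [hx, (not_le.1 hx).le]

theorem le_withDensity_iInf {m μ : Measure α} {f : ℕ → α → ℝ≥0∞} (hf : ∀ n, Measurable (f n))
    (hanti : Antitone f) (h0 : ∫⁻ x, f 0 x ∂μ ≠ ∞) (h : ∀ n, m ≤ μ.withDensity (f n)) :
    m ≤ μ.withDensity (fun x => ⨅ n, f n x) := by
  refine Measure.le_iff.2 fun s hs => ?_
  rw [withDensity_apply _ hs, lintegral_iInf hf hanti
    (ne_top_of_le_ne_top h0 (setLIntegral_le_lintegral _ _))]
  refine le_iInf fun n => ?_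
  rw [← withDensity_apply _ hs]
  exact h n s

/-- The bounds on consecutive increments add up to the measure of a single interval. The supremum
over pairs in `s` serves both `univ` and compact intervals. -/
theorem eVariationOn_le_of_edist_le_measure {Z : Type*} [PseudoEMetricSpace Z] {f : ℝ → Z}
    {μ : Measure ℝ} (h : ∀ a b : ℝ, a ≤ b → edist (f a) (f b) ≤ μ (Ioc a b)) (s : Set ℝ) :
    eVariationOn f s ≤ ⨆ p : s × s, μ (Ioc (p.1 : ℝ) p.2) := by
  refine iSup_le ?_
  rintro ⟨n, u, hu, us⟩
  refine le_trans ?_ (le_iSup (fun p : s × s => μ (Ioc (p.1 : ℝ) p.2)) (⟨u 0, us 0⟩, ⟨u n, us n⟩))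
  simp only
  induction n with
  | zero => simp
  | succ n ih =>
    rw [Finset.sum_range_succ]
    have : Ioc (u 0) (u (n + 1)) = Ioc (u 0) (u n) ∪ Ioc (u n) (u (n + 1)) :=
      (Ioc_union_Ioc_eq_Ioc (hu (Nat.zero_le n)) (hu n.le_succ)).symm
    rw [this, measure_union (Set.disjoint_left.2 fun x hx hx' => not_lt.2 hx.2 hx'.1)
      measurableSet_Ioc]
    refine add_le_add ih ?_
    rw [edist_comm]
    exact h _ _ (hu n.le_succ)

end Density

/-! ### Weak upper gradients and the minimal one -/

section UpperGradient

variable {X Y : Type*} [MetricSpace X] [MeasurableSpace X] [BorelSpace X]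
  [MetricSpace Y] [MeasurableSpace Y] [BorelSpace Y]

/-- The image path `h ∘ γ` is rectifiable and its length is absolutely continuous along `γ`, with
density at most `g`. -/
def ControlsLength (h : C(X, Y)) (g : X → ℝ≥0∞) (γ : Curve X) : Prop :=
  (γ.comp h).Rectifiable ∧
    (γ.comp h).lengthMeasure ≤ γ.lengthMeasure.withDensity (fun u => g (γ.ext u))

theorem IsWeakUpperGradient.eventually_edist_le {h : X → Y} {g : X → ℝ≥0∞}
    (hg : IsWeakUpperGradient h g) : ∀ᶠ γ in modAE X,
      edist (h γ.source) (h γ.target) ≤ γ.lineIntegral g := by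
  obtain ⟨-, Γ₀, hΓ₀, H⟩ := hg
  have : ∀ᶠ γ in modAE X, γ ∉ Γ₀ := by
    rw [eventually_modAE]
    simpa using hΓ₀
  filter_upwards [this, eventually_rectifiable] with γ h1 h2 using H γ h1 h2

/-- Almost every path satisfies the upper gradient inequality on all its subpaths at once. The
finite measure `g ds` then dominates every increment of `h ∘ γ`, hence its variation on every
interval. -/
theorem IsWeakUpperGradient.eventually_controlsLength {h : C(X, Y)} {g : X → ℝ≥0∞}
    (hg : IsWeakUpperGradient h g) (hfin : ∀ᶠ γ in modAE X, γ.lineIntegral g ≠ ∞) :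
    ∀ᶠ γ in modAE X, ControlsLength h g γ := by
  filter_upwards [eventually_forall_sub hg.eventually_edist_le, hfin, eventually_rectifiable]
    with γ h1 h2 hr
  rw [Curve.lineIntegral_eq_lintegral hr hg.1] at h2
  have hμ : IsFiniteMeasure (γ.lengthMeasure.withDensity (fun u => g (γ.ext u))) :=
    isFiniteMeasure_withDensity h2
  have key : ∀ a b : ℝ, a ≤ b → edist (h (γ.ext a)) (h (γ.ext b)) ≤
      γ.lengthMeasure.withDensity (fun u => g (γ.ext u)) (Ioc a b) := by
    intro a b hab
    have := h1 a b hab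
    rwa [Curve.lineIntegral_sub hr hg.1, ← withDensity_apply _ measurableSet_Ioc] at this
  have hrect : (γ.comp h).Rectifiable := by
    rw [Curve.Rectifiable, ← Curve.eVariationOn_ext, Curve.ext_comp]
    refine ne_top_of_le_ne_top (measure_ne_top
      (γ.lengthMeasure.withDensity (fun u => g (γ.ext u))) univ)
      ((eVariationOn_le_of_edist_le_measure key univ).trans (iSup_le fun _ => ?_))
    exact measure_mono (subset_univ _)
  refine ⟨hrect, measure_le_of_Ioc_le fun a b hab => ?_⟩
  rw [Curve.lengthMeasure_Ioc_eq_eVariationOn hrect hab.le]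
  refine (eVariationOn_le_of_edist_le_measure key (Icc a b)).trans (iSup_le fun p => ?_)
  exact measure_mono (Ioc_subset_Ioc p.1.2.1 p.2.2.2)

theorem ControlsLength.edist_le {h : C(X, Y)} {g : X → ℝ≥0∞} {γ : Curve X}
    (H : ControlsLength h g γ) (hg : Measurable g) (hr : γ.Rectifiable) :
    edist (h γ.source) (h γ.target) ≤ γ.lineIntegral g := by
  have := Curve.edist_le_lengthMeasure H.1 γ.le
  rw [Curve.ext_comp, Function.comp, Function.comp, γ.ext_lo, γ.ext_hi] at this
  refine this.trans ((H.2 _).trans ((measure_mono (subset_univ _)).trans_eq ?_))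
  rw [withDensity_apply _ .univ, Measure.restrict_univ, Curve.lineIntegral_eq_lintegral hr hg]

theorem isWeakUpperGradient_of_controlsLength {h : C(X, Y)} {g : X → ℝ≥0∞} (hg : Measurable g)
    (H : ∀ᶠ γ in modAE X, ControlsLength h g γ) : IsWeakUpperGradient h g :=
  ⟨hg, {γ | ¬ ControlsLength h g γ}, H, fun _ hγ hr => (not_not.1 hγ).edist_le hg hr⟩

theorem LocallyL2.mono {g g' : X → ℝ≥0∞} (hg : LocallyL2 g) (h : g' ≤ g) : LocallyL2 g' := by
  intro x
  obtain ⟨U, hU, hfin⟩ := hg x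
  exact ⟨U, hU, (lintegral_mono fun z => pow_le_pow_left' (h z) 2).trans_lt hfin⟩

/-- If there is a locally square-integrable weak upper gradient, there is a minimal one. -/
theorem exists_isMinimalWeakUpperGradient [SecondCountableTopology X]
    [IsLocallyFiniteMeasure (hausdorff2 X)] (h : C(X, Y)) {g₀ : X → ℝ≥0∞}
    (hg₀ : IsWeakUpperGradient h g₀) (hg₀' : LocallyL2 g₀) :
    ∃ g, IsMinimalWeakUpperGradient h g := by
  let 𝒢 : Set (X → ℝ≥0∞) :=
    {g | Measurable g ∧ LocallyL2 g ∧ ∀ᶠ γ in modAE X, ControlsLength h g γ}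
  have mem : ∀ g, IsWeakUpperGradient h g → LocallyL2 g → g ∈ 𝒢 := fun g hg hg' =>
    ⟨hg.1, hg', hg.eventually_controlsLength
      (eventually_lineIntegral_ne_top_of_locallyL2 hg.1 hg')⟩
  have hmin : ∀ g ∈ 𝒢, ∀ g' ∈ 𝒢, (fun x => min (g x) (g' x)) ∈ 𝒢 := by
    rintro g ⟨hg1, hg2, hg3⟩ g' ⟨hg1', -, hg3'⟩
    refine ⟨hg1.min hg1', hg2.mono fun x => min_le_left _ _, ?_⟩
    filter_upwards [hg3, hg3'] with γ H H'
    exact ⟨H.1, le_withDensity_min (hg1.comp γ.continuous_ext.measurable)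
      (hg1'.comp γ.continuous_ext.measurable) H.2 H'.2⟩
  let P : Measure X := (hausdorff2 X).toFinite
  -- A bounded functional that reverses order: since `𝒢` is closed under minima and under the
  -- decreasing limits below, a maximizer of `Φ` exists and is minimal. The measure `P` is finite
  -- and has the null sets of `ℋ²`.
  let Φ : (X → ℝ≥0∞) → ℝ≥0∞ := fun g => ∫⁻ x, (1 + g x)⁻¹ ∂P
  have hΦanti : ∀ g g' : X → ℝ≥0∞, g ≤ g' → Φ g' ≤ Φ g := fun g g' hgg' =>
    lintegral_mono fun x => ENNReal.inv_le_inv.2 (add_le_add le_rfl (hgg' x))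
  have hΦtop : ∀ g, Φ g ≠ ∞ := fun g => by
    refine ne_top_of_le_ne_top (measure_ne_top P univ) ?_
    calc Φ g ≤ ∫⁻ _, 1 ∂P := lintegral_mono fun x => ENNReal.inv_le_one.2 le_self_add
      _ = P univ := by simp
  obtain ⟨s, -, hs, hs𝒢⟩ := exists_seq_tendsto_sSup (S := Φ '' 𝒢)
    ⟨_, mem_image_of_mem _ (mem g₀ hg₀ hg₀')⟩ (OrderTop.bddAbove _)
  choose f hf hfs using hs𝒢
  -- Running minima of the maximizing sequence; they decrease and still maximize.
  let G : ℕ → X → ℝ≥0∞ := fun n => n.rec (f 0) fun k r x => min (r x) (f (k + 1) x)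
  have hG0 : ∀ n, G n ∈ 𝒢 := fun n => by
    induction n with
    | zero => exact hf 0
    | succ n ih => exact hmin _ ih _ (hf (n + 1))
  have hGanti : Antitone G := antitone_nat_of_succ_le fun n x => min_le_left _ _
  have hGf : ∀ n, G n ≤ f n := fun n => by
    cases n with
    | zero => exact le_rfl
    | succ n => exact fun x => min_le_right _ _
  let g : X → ℝ≥0∞ := fun x => ⨅ n, G n x
  have hgG : ∀ n, g ≤ G n := fun n x => iInf_le _ n
  have hg𝒢 : g ∈ 𝒢 := by
    refine ⟨.iInf fun n => (hG0 n).1, (hG0 0).2.1.mono (hgG 0), ?_⟩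
    filter_upwards [eventually_countable_forall.2 fun n => (hG0 n).2.2, eventually_rectifiable,
      eventually_lineIntegral_ne_top_of_locallyL2 (hG0 0).1 (hG0 0).2.1] with γ H hr hfin
    refine ⟨(H 0).1, le_withDensity_iInf (f := fun n u => G n (γ.ext u))
      (fun n => (hG0 n).1.comp γ.continuous_ext.measurable) (fun n m hnm u => hGanti hnm _) ?_
      fun n => (H n).2⟩
    rwa [Curve.lineIntegral_eq_lintegral hr (hG0 0).1] at hfin
  have hsup : sSup (Φ '' 𝒢) ≤ Φ g := by
    refine le_of_tendsto' hs fun n => ?_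
    rw [← hfs n]
    exact hΦanti _ _ ((hgG n).trans (hGf n))
  refine ⟨g, isWeakUpperGradient_of_controlsLength hg𝒢.1 hg𝒢.2.2, hg𝒢.2.1, fun g' hg' hg'2 => ?_⟩
  have hm := hmin g hg𝒢 g' (mem g' hg' hg'2)
  have hle : Φ (fun x => min (g x) (g' x)) ≤ Φ g :=
    (le_sSup (mem_image_of_mem _ hm)).trans hsup
  -- Replacing `g` by the minimum cannot increase `Φ` beyond its supremum, so the two ordered
  -- integrands have equal finite integrals.
  have hae : (fun x => (1 + g x)⁻¹) =ᵐ[P] fun x => (1 + min (g x) (g' x))⁻¹ := by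
    refine ae_eq_of_ae_le_of_lintegral_le (Filter.Eventually.of_forall fun x => ?_) (hΦtop g)
      ((hm.1.const_add 1).inv.aemeasurable) hle
    exact ENNReal.inv_le_inv.2 (add_le_add le_rfl (min_le_left _ _))
  have hae' := (absolutelyContinuous_toFinite (hausdorff2 X)).ae_le hae
  filter_upwards [hae'] with x hx
  have hx' := (ENNReal.add_right_inj ENNReal.one_ne_top).1 (inv_injective hx)
  rw [hx']
  exact min_le_right _ _

end UpperGradient

/-! ### From the pointwise bound to the modulus inequality -/

section ModulusInequality

variable {X Y : Type*} [MetricSpace X] [MeasurableSpace X] [BorelSpace X]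
  [MetricSpace Y] [MeasurableSpace Y] [BorelSpace Y]

theorem ControlsLength.lineIntegral_comp_le {h : C(X, Y)} {g : X → ℝ≥0∞} {γ : Curve X}
    (H : ControlsLength h g γ) (hg : Measurable g) (hr : γ.Rectifiable) {ρ : Y → ℝ≥0∞}
    (hρ : Measurable ρ) :
    (γ.comp h).lineIntegral ρ ≤ γ.lineIntegral (fun x => g x * ρ (h x)) := by
  have hρh : Measurable fun x => ρ (h x) := hρ.comp h.continuous.measurable
  rw [Curve.lineIntegral_eq_lintegral H.1 hρ,
    Curve.lineIntegral_eq_lintegral hr (ρ := fun x => g x * ρ (h x))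
    (hg.mul hρh)]
  refine (lintegral_mono' H.2 le_rfl).trans_eq ?_
  exact lintegral_withDensity_eq_lintegral_mul _ (hg.comp γ.continuous_ext.measurable)
    (hρh.comp γ.continuous_ext.measurable)

theorem IsImageMeasure.map_eq {h : X → Y} {ν : Measure X} (hν : IsImageMeasure h ν)
    (hc : Continuous h) (hs : Function.Surjective h) : ν.map h = hausdorff2 Y := by
  ext E hE
  rw [Measure.map_apply hc.measurable hE, hν _ (hc.measurable hE), image_preimage_eq _ hs]

/-- Admissible functions `ρ` for `h(Γ)` are pulled back to `g · (ρ ∘ h)`. The condition `K ≠ 0`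
allows `K` to pass through an infimum that may be infinite. -/
theorem modulus_le_of_sq_le_rnDeriv [SecondCountableTopology X] {K : ℝ≥0} (hK0 : K ≠ 0)
    {h : C(X, Y)} (hs : Function.Surjective h) {g : X → ℝ≥0∞} (hg : IsWeakUpperGradient h g)
    (hg2 : LocallyL2 g) {ν : Measure X} (hν : IsImageMeasure h ν)
    (hK : ∀ᵐ x ∂(hausdorff2 X), g x ^ 2 ≤ K * ν.rnDeriv (hausdorff2 X) x) (Γ : Set (Curve X)) :
    modulus Γ ≤ K * modulus (Curve.comp h '' Γ) := by
  have hK0' : (K : ℝ≥0∞) ≠ 0 := by simpa using hK0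
  rw [modulus.eq_def (Curve.comp h '' Γ)]
  simp only [ENNReal.mul_iInf_of_ne hK0' ENNReal.coe_ne_top]
  refine le_iInf₂ fun ρ hρ => ?_
  have hρh : Measurable fun x => ρ (h x) := hρ.1.comp h.continuous.measurable
  have hcontrol := hg.eventually_controlsLength
    (eventually_lineIntegral_ne_top_of_locallyL2 hg.1 hg2)
  have hadm : Admissible (Γ ∩ {γ | ControlsLength h g γ}) (fun x => g x * ρ (h x)) :=
    ⟨hg.1.mul hρh, fun γ hγ hr => (hρ.2 _ (mem_image_of_mem _ hγ.1) hγ.2.1).trans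
      (hγ.2.lineIntegral_comp_le hg.1 hr hρ.1)⟩
  calc modulus Γ
      ≤ modulus (Γ ∩ {γ | ControlsLength h g γ} ∪ {γ | ¬ ControlsLength h g γ}) :=
        modulus_mono fun γ hγ => by
          by_cases hc : ControlsLength h g γ
          · exact Or.inl ⟨hγ, hc⟩
          · exact Or.inr hc
    _ ≤ modulus (Γ ∩ {γ | ControlsLength h g γ}) + 0 :=
        (modulus_union_le _ _).trans (add_le_add le_rfl (eventually_modAE.1 hcontrol).le)
    _ ≤ ∫⁻ x, (g x * ρ (h x)) ^ 2 ∂(hausdorff2 X) := by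
        rw [add_zero]
        exact modulus_le_of_admissible hadm
    _ ≤ ∫⁻ x, K * (ν.rnDeriv (hausdorff2 X) x * ρ (h x) ^ 2) ∂(hausdorff2 X) := by
        refine lintegral_mono_ae ?_
        filter_upwards [hK] with x hx
        rw [mul_pow, ← mul_assoc]
        gcongr
    _ = K * ∫⁻ x, ρ (h x) ^ 2 ∂((hausdorff2 X).withDensity (ν.rnDeriv (hausdorff2 X))) := by
        rw [lintegral_const_mul' _ _ ENNReal.coe_ne_top,
          lintegral_withDensity_eq_lintegral_mul _ (Measure.measurable_rnDeriv _ _)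
            (hρh.pow_const 2)]
        rfl
    _ ≤ K * ∫⁻ x, ρ (h x) ^ 2 ∂ν := by
        gcongr
        -- Only the absolutely continuous part of `ν` enters the pointwise bound; it is at most `ν`.
        exact Measure.withDensity_rnDeriv_le _ _
    _ = K * ∫⁻ y, ρ y ^ 2 ∂(hausdorff2 Y) := by
        rw [← hν.map_eq h.continuous hs, lintegral_map (hρ.1.pow_const 2) h.continuous.measurable]

end ModulusInequality

/-! ### Nested convex sets in a Hilbert space, and `L²` -/

section Hilbert

variable {H : Type*} [NormedAddCommGroup H] [InnerProductSpace ℝ H] [CompleteSpace H]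

/-- A decreasing sequence of convex sets with bounded distance from the origin in a Hilbert space
has a common adherent point, with the same bound for its norm. -/
theorem exists_mem_closure_of_antitone_convex {C : ℕ → Set H} (hconv : ∀ n, Convex ℝ (C n))
    (hanti : Antitone C) {M : ℝ} (hM : ∀ n, ∀ ε > 0, ∃ x ∈ C n, ‖x‖ ^ 2 ≤ M + ε) :
    ∃ v, ‖v‖ ^ 2 ≤ M ∧ ∀ n, v ∈ closure (C n) := by
  -- The point of the closure nearest to the origin; its variational inequality gives this
  -- Pythagorean inequality.
  have hmin : ∀ n, ∃ a ∈ closure (C n), ∀ x ∈ closure (C n), ‖a‖ ^ 2 + ‖x - a‖ ^ 2 ≤ ‖x‖ ^ 2 := by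
    intro n
    obtain ⟨x, hx, -⟩ := hM n 1 one_pos
    obtain ⟨a, ha, hinf⟩ := exists_norm_eq_iInf_of_complete_convex (K := closure (C n))
      ⟨x, subset_closure hx⟩ isClosed_closure.isComplete (hconv n).closure 0
    rw [norm_eq_iInf_iff_real_inner_le_zero (hconv n).closure ha] at hinf
    refine ⟨a, ha, fun y hy => ?_⟩
    have h1 := hinf y hy
    rw [zero_sub, inner_neg_left] at h1
    have h2 := norm_add_sq_real a (y - a)
    rw [add_sub_cancel] at h2
    linarith
  choose a ha hmina using hmin
  have hcl : Antitone fun n => closure (C n) := fun m n hmn => closure_mono (hanti hmn)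
  have hle : ∀ n, ‖a n‖ ^ 2 ≤ M := fun n => by
    refine le_of_forall_pos_le_add fun ε hε => ?_
    obtain ⟨x, hx, hxM⟩ := hM n ε hε
    nlinarith [hmina n x (subset_closure hx), sq_nonneg ‖x - a n‖]
  have hmono : Monotone fun n => ‖a n‖ ^ 2 := fun m n hmn => by
    nlinarith [hmina m (a n) (hcl hmn (ha n)), sq_nonneg ‖a n - a m‖]
  have htend := tendsto_atTop_ciSup hmono ⟨M, by rintro _ ⟨n, rfl⟩; exact hle n⟩
  -- For `n ≥ N` the Pythagorean inequality gives `‖a n - a N‖² ≤ ‖a n‖² - ‖a N‖²`, and the squared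
  -- norms converge.
  have hcau : CauchySeq a := by
    rw [Metric.cauchySeq_iff']
    intro ε hε
    have := Metric.cauchySeq_iff'.1 htend.cauchySeq (ε ^ 2) (by positivity)
    obtain ⟨N, hN⟩ := this
    refine ⟨N, fun n hn => ?_⟩
    have h1 := hN n hn
    rw [Real.dist_eq] at h1
    have h2 := hmina N (a n) (hcl hn (ha n))
    rw [dist_eq_norm]
    refine lt_of_pow_lt_pow_left₀ 2 hε.le ?_
    linarith [le_abs_self (‖a n‖ ^ 2 - ‖a N‖ ^ 2)]
  obtain ⟨v, hv⟩ := cauchySeq_tendsto_of_complete hcau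
  refine ⟨v, le_of_tendsto' (hv.norm.pow 2) hle, fun n => ?_⟩
  refine isClosed_closure.mem_of_tendsto hv ?_
  filter_upwards [Filter.eventually_ge_atTop n] with m hm using hcl hm (ha m)

end Hilbert

section LTwo

variable {α : Type*} [MeasurableSpace α] {μ : Measure α}

theorem Lp_enorm_sq (f : Lp ℝ 2 μ) : ‖f‖ₑ ^ 2 = ∫⁻ x, ‖f x‖ₑ ^ 2 ∂μ := by
  have := eLpNorm_nnreal_pow_eq_lintegral (f := f) (μ := μ) (p := 2) (by simp)
  rw [Lp.enorm_def]
  simpa using this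

theorem Lp_norm_sq (f : Lp ℝ 2 μ) : ENNReal.ofReal (‖f‖ ^ 2) = ∫⁻ x, ‖f x‖ₑ ^ 2 ∂μ := by
  rw [← Lp_enorm_sq, ENNReal.ofReal_pow (norm_nonneg _), ofReal_norm]

theorem exists_Lp_eq_toReal {g : α → ℝ≥0∞} (hg : Measurable g) (hfin : ∫⁻ x, g x ^ 2 ∂μ ≠ ∞) :
    ∃ f : Lp ℝ 2 μ, (∀ᵐ x ∂μ, 0 ≤ f x ∧ ENNReal.ofReal (f x) = g x) ∧
      ENNReal.ofReal (‖f‖ ^ 2) = ∫⁻ x, g x ^ 2 ∂μ := by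
  have hlt : ∀ᵐ x ∂μ, g x < ∞ := by
    filter_upwards [ae_lt_top (hg.pow_const 2) hfin] with x hx
    by_contra h
    rw [not_lt, top_le_iff] at h
    simp [h] at hx
  have hnorm : ∫⁻ x, ‖(g x).toReal‖ₑ ^ 2 ∂μ = ∫⁻ x, g x ^ 2 ∂μ := by
    refine lintegral_congr_ae ?_
    filter_upwards [hlt] with x hx
    rw [Real.enorm_of_nonneg ENNReal.toReal_nonneg, ENNReal.ofReal_toReal hx.ne]
  have hmem : MemLp (fun x => (g x).toReal) 2 μ := by
    refine ⟨hg.ennreal_toReal.aestronglyMeasurable, ?_⟩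
    have := eLpNorm_nnreal_pow_eq_lintegral (f := fun x => (g x).toReal) (μ := μ) (p := 2) (by simp)
    have h2 : eLpNorm (fun x => (g x).toReal) 2 μ ^ 2 = ∫⁻ x, g x ^ 2 ∂μ := by
      rw [← hnorm]
      simpa using this
    by_contra h
    rw [not_lt, top_le_iff] at h
    rw [h] at h2
    exact hfin (by rw [← h2]; simp)
  refine ⟨hmem.toLp, ?_, ?_⟩
  · filter_upwards [hmem.coeFn_toLp, hlt] with x hx hx'
    rw [hx]
    exact ⟨ENNReal.toReal_nonneg, ENNReal.ofReal_toReal hx'.ne⟩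
  · rw [Lp_norm_sq, ← hnorm]
    refine lintegral_congr_ae ?_
    filter_upwards [hmem.coeFn_toLp] with x hx
    rw [hx]

end LTwo

section LengthMeasureAtoms

variable {X : Type*} [MetricSpace X]

theorem Curve.lengthMeasure_singleton {γ : Curve X} (hγ : γ.Rectifiable) (u : ℝ) :
    γ.lengthMeasure {u} = 0 := by
  have h1 : ∀ s < u, γ.lengthMeasure {u} ≤ ENNReal.ofReal (γ.lengthUpTo u - γ.lengthUpTo s) :=
    fun s hs => by
      rw [← Curve.lengthMeasure_Ioc hγ]
      exact measure_mono (singleton_subset_iff.2 ⟨hs, le_rfl⟩)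
  have h2 : Filter.Tendsto (fun s => ENNReal.ofReal (γ.lengthUpTo u - γ.lengthUpTo s)) (𝓝[<] u)
      (𝓝 (ENNReal.ofReal (γ.lengthUpTo u - γ.lengthUpTo u))) :=
    (ENNReal.continuous_ofReal.comp (continuous_const.sub hγ.continuous_lengthUpTo)).continuousAt
      |>.tendsto.mono_left inf_le_left
  rw [sub_self, ENNReal.ofReal_zero] at h2
  exact le_antisymm (ge_of_tendsto h2 (eventually_mem_nhdsWithin.mono h1)) zero_le

theorem Curve.sub_lo_hi (γ : Curve X) : γ.sub γ.lo γ.hi γ.le = γ := by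
  obtain ⟨lo, hi, le, map⟩ := γ
  simp only [Curve.sub]
  congr 1
  ext u
  exact Curve.ext_coe ⟨lo, hi, le, map⟩ u

end LengthMeasureAtoms

/-! ### Transporting functions from `Y` to `X` -/

section QuasiconformalGradient

variable {X Y : Type*} [MetricSpace X] [MeasurableSpace X] [BorelSpace X]
  [MetricSpace Y] [MeasurableSpace Y] [BorelSpace Y]

theorem eventually_comp_of_modulus_le {K : ℝ≥0} {h : C(X, Y)}
    (hmod : ∀ Γ : Set (Curve X), modulus Γ ≤ K * modulus (Curve.comp h '' Γ))
    {P : Curve Y → Prop} (hP : ∀ᶠ σ in modAE Y, P σ) : ∀ᶠ γ in modAE X, P (γ.comp h) := by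
  rw [eventually_modAE] at *
  refine le_antisymm ((hmod _).trans ?_) zero_le
  have : modulus (Curve.comp h '' {γ | ¬ P (γ.comp h)}) ≤ modulus {σ | ¬ P σ} :=
    modulus_mono (by rintro _ ⟨γ, hγ, rfl⟩; exact hγ)
  rw [hP] at this
  simp [le_antisymm this zero_le]

/-- Since `μ` has no atoms, pieces of `μ`-mass exactly `δ` can be cut off; each has `μ'`-mass at
least `δ`. The leftover costs at most one more `δ`. -/
theorem mul_le_setLIntegral_of_subdivision {μ μ' : Measure ℝ} [IsFiniteMeasure μ]
    (hμ : ∀ u, μ {u} = 0) {δ : ℝ} (hδ : 0 < δ)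
    (H : ∀ a b : ℝ, a ≤ b → ENNReal.ofReal δ ≤ μ (Ioc a b) → ENNReal.ofReal δ ≤ μ' (Ioc a b))
    {c b : ℝ} (hcb : c ≤ b) : μ (Ioc c b) ≤ μ' (Ioc c b) + ENNReal.ofReal δ := by
  have : NullSingletonClass μ := ⟨hμ⟩
  have hcont : Continuous fun u => ∫ _ in c..u, (1 : ℝ) ∂μ :=
    intervalIntegral.continuous_primitive (fun _ _ => intervalIntegrable_const) c
  have hval : ∀ u, c ≤ u → ∫ _ in c..u, (1 : ℝ) ∂μ = (μ (Ioc c u)).toReal := fun u hu => by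
    rw [intervalIntegral.integral_of_le hu]
    simp [Measure.real]
  have key : ∀ N : ℕ, ∀ b, c ≤ b → ENNReal.ofReal (N * δ) ≤ μ (Ioc c b) →
      ENNReal.ofReal (N * δ) ≤ μ' (Ioc c b) := by
    intro N
    induction N with
    | zero => simp
    | succ N ih =>
      intro b hb hN
      have hN' : ((N + 1 : ℕ) : ℝ) * δ ≤ (μ (Ioc c b)).toReal :=
        (ENNReal.ofReal_le_iff_le_toReal (measure_ne_top _ _)).1 hN
      push_cast at hN'
      obtain ⟨a, ha, hav⟩ : (N : ℝ) * δ ∈ (fun u => ∫ _ in c..u, (1 : ℝ) ∂μ) '' Icc c b := by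
        refine intermediate_value_Icc hb hcont.continuousOn ?_
        rw [hval b hb, intervalIntegral.integral_same]
        exact ⟨by positivity, by nlinarith⟩
      simp only [hval a ha.1] at hav
      have hea : μ (Ioc c a) = ENNReal.ofReal (N * δ) := by
        rw [← hav, ENNReal.ofReal_toReal (measure_ne_top _ _)]
      have hsplit : ∀ m : Measure ℝ, m (Ioc c b) = m (Ioc c a) + m (Ioc a b) := fun m => by
        rw [← Ioc_union_Ioc_eq_Ioc ha.1 ha.2, measure_union
          (Set.disjoint_left.2 fun x hx hx' => not_lt.2 hx.2 hx'.1) measurableSet_Ioc]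
      have hadd : ENNReal.ofReal ((N + 1 : ℕ) * δ) =
          ENNReal.ofReal (N * δ) + ENNReal.ofReal δ := by
        rw [← ENNReal.ofReal_add (by positivity) hδ.le]
        congr 1
        push_cast
        ring
      rw [hadd, hsplit μ, hea] at hN
      rw [hadd, hsplit μ']
      exact add_le_add (ih a ha.1 hea.ge)
        (H a b ha.2 ((ENNReal.add_le_add_iff_left ENNReal.ofReal_ne_top).1 hN))
  set W := (μ (Ioc c b)).toReal with hW
  have hWe : μ (Ioc c b) = ENNReal.ofReal W := (ENNReal.ofReal_toReal (measure_ne_top _ _)).symm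
  have h1 : (⌊W / δ⌋₊ : ℝ) * δ ≤ W := by
    rw [← le_div_iff₀ hδ]
    exact Nat.floor_le (by positivity)
  have h2 : W ≤ (⌊W / δ⌋₊ : ℝ) * δ + δ := by
    have := (Nat.lt_floor_add_one (W / δ)).le
    rw [div_le_iff₀ hδ] at this
    linarith
  calc μ (Ioc c b) ≤ ENNReal.ofReal ((⌊W / δ⌋₊ : ℝ) * δ + δ) := by
        rw [hWe]
        exact ENNReal.ofReal_le_ofReal h2
    _ = ENNReal.ofReal ((⌊W / δ⌋₊ : ℝ) * δ) + ENNReal.ofReal δ :=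
        ENNReal.ofReal_add (by positivity) hδ.le
    _ ≤ _ := by
        gcongr
        exact key _ b hcb (by rw [hWe]; exact ENNReal.ofReal_le_ofReal h1)

/-- Chebyshev's inequality in `Y` and the modulus inequality bound the modulus of the paths whose
image has `w`-length at least `δ`. Scaling an almost optimal admissible function by `δ` cancels the
factor `δ⁻²`; subdivision then covers all longer paths, with error `δ`. -/
theorem exists_approximate_gradient {K : ℝ≥0} {h : C(X, Y)}
    (hmod : ∀ Γ : Set (Curve X), modulus Γ ≤ K * modulus (Curve.comp h '' Γ))
    {w : Y → ℝ≥0∞} (hw : Measurable w) (hw2 : ∫⁻ y, w y ^ 2 ∂(hausdorff2 Y) ≠ ∞)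
    {δ : ℝ} (hδ : 0 < δ) {ε : ℝ≥0∞} (hε : ε ≠ 0) :
    ∃ g : X → ℝ≥0∞, Measurable g ∧
      ∫⁻ x, g x ^ 2 ∂(hausdorff2 X) ≤ K * ∫⁻ y, w y ^ 2 ∂(hausdorff2 Y) + ε ∧
      ∀ᶠ γ in modAE X, (γ.comp h).lineIntegral w ≤ γ.lineIntegral g + ENNReal.ofReal δ := by
  have hδ0 : ENNReal.ofReal δ ≠ 0 := by simpa using hδ
  have hδt : ENNReal.ofReal δ ≠ ∞ := ENNReal.ofReal_ne_top
  set d := ENNReal.ofReal δ with hd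
  set Γ : Set (Curve X) := {γ | d ≤ (γ.comp h).lineIntegral w} with hΓ
  have hΓle : modulus Γ ≤ K * ((d⁻¹) ^ 2 * ∫⁻ y, w y ^ 2 ∂(hausdorff2 Y)) := by
    refine (hmod Γ).trans ?_
    gcongr
    refine (modulus_mono ?_).trans (modulus_lineIntegral_ge_le hw hδ0 hδt)
    rintro _ ⟨γ, hγ, rfl⟩
    exact hγ
  have hdi : d⁻¹ ≠ ∞ := ENNReal.inv_ne_top.2 hδ0
  have hdi0 : d⁻¹ ≠ 0 := ENNReal.inv_ne_zero.2 hδt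
  have hlt : modulus Γ < K * ((d⁻¹) ^ 2 * ∫⁻ y, w y ^ 2 ∂(hausdorff2 Y)) + (d⁻¹) ^ 2 * ε :=
    hΓle.trans_lt (ENNReal.lt_add_right
      (ENNReal.mul_ne_top ENNReal.coe_ne_top (ENNReal.mul_ne_top (ENNReal.pow_ne_top hdi) hw2))
      (mul_ne_zero (pow_ne_zero _ hdi0) hε))
  obtain ⟨ρ, hρ, hρ2⟩ := exists_admissible_lt hlt
  refine ⟨fun x => d * ρ x, hρ.1.const_mul _, ?_, ?_⟩
  · simp only [mul_pow]
    rw [lintegral_const_mul _ (hρ.1.pow_const 2)]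
    calc d ^ 2 * ∫⁻ x, ρ x ^ 2 ∂(hausdorff2 X)
        ≤ d ^ 2 * (K * ((d⁻¹) ^ 2 * ∫⁻ y, w y ^ 2 ∂(hausdorff2 Y)) + (d⁻¹) ^ 2 * ε) := by
          gcongr
      _ = (d * d⁻¹) ^ 2 * (K * ∫⁻ y, w y ^ 2 ∂(hausdorff2 Y) + ε) := by ring
      _ = _ := by rw [ENNReal.mul_inv_cancel hδ0 hδt, one_pow, one_mul]
  · filter_upwards [eventually_rectifiable,
      eventually_comp_of_modulus_le hmod (eventually_rectifiable (X := Y)),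
      eventually_comp_of_modulus_le hmod (eventually_lineIntegral_ne_top hw hw2)] with γ hr hr' hfin
    have hgm : Measurable fun x => d * ρ x := hρ.1.const_mul _
    rw [Curve.lineIntegral_eq_lintegral hr' hw] at hfin
    have hμfin : IsFiniteMeasure
        ((γ.comp h).lengthMeasure.withDensity fun u => w ((γ.comp h).ext u)) :=
      isFiniteMeasure_withDensity hfin
    have hsub := mul_le_setLIntegral_of_subdivision
      (μ := (γ.comp h).lengthMeasure.withDensity fun u => w ((γ.comp h).ext u))
      (μ' := γ.lengthMeasure.withDensity fun u => d * ρ (γ.ext u))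
      (fun u => withDensity_absolutelyContinuous _ _ (Curve.lengthMeasure_singleton hr' u)) hδ
      (fun a b hab hab' => ?_) γ.le
    · rw [withDensity_apply _ measurableSet_Ioc, withDensity_apply _ measurableSet_Ioc,
        ← Curve.lineIntegral_sub hr' hw γ.le] at hsub
      rw [← Curve.lineIntegral_sub hr hgm γ.le] at hsub
      rw [← γ.comp_sub h, γ.sub_lo_hi] at hsub
      exact hsub
    · rw [withDensity_apply _ measurableSet_Ioc] at hab' ⊢
      rw [← Curve.lineIntegral_sub hr' hw hab, ← γ.comp_sub h] at hab'
      rw [← Curve.lineIntegral_sub hr hgm hab, Curve.lineIntegral_const_mul hδt]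
      have := hρ.2 (γ.sub a b hab) hab' (hr.sub hab)
      calc d = d * 1 := (mul_one _).symm
        _ ≤ _ := by gcongr

/-- Removes the error `δ`. The functions that are good up to error `η n` form decreasing convex sets
in `L²`; a common adherent point `v` keeps the energy bound, and Fuglede's lemma passes the line
integral inequality to `v`. -/
theorem exists_gradient_of_modulus_le {K : ℝ≥0} {h : C(X, Y)}
    (hmod : ∀ Γ : Set (Curve X), modulus Γ ≤ K * modulus (Curve.comp h '' Γ))
    {w : Y → ℝ≥0∞} (hw : Measurable w) (hw2 : ∫⁻ y, w y ^ 2 ∂(hausdorff2 Y) ≠ ∞) :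
    ∃ g : X → ℝ≥0∞, Measurable g ∧
      ∫⁻ x, g x ^ 2 ∂(hausdorff2 X) ≤ K * ∫⁻ y, w y ^ 2 ∂(hausdorff2 Y) ∧
      ∀ᶠ γ in modAE X, (γ.comp h).lineIntegral w ≤ γ.lineIntegral g := by
  set M : ℝ≥0∞ := K * ∫⁻ y, w y ^ 2 ∂(hausdorff2 Y) with hM
  have hMt : M ≠ ∞ := ENNReal.mul_ne_top ENNReal.coe_ne_top hw2
  have hmeas : ∀ f : Lp ℝ 2 (hausdorff2 X), Measurable fun x => ENNReal.ofReal (f x) := fun f =>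
    (Lp.stronglyMeasurable f).measurable.ennreal_ofReal
  let η : ℕ → ℝ := fun n => 1 / ((n : ℝ) + 1)
  have hη : ∀ n, 0 < η n := fun n => Nat.one_div_pos_of_nat
  let C : ℕ → Set (Lp ℝ 2 (hausdorff2 X)) := fun n =>
    {f | (∀ᵐ x ∂(hausdorff2 X), 0 ≤ f x) ∧ ∀ᶠ γ in modAE X, (γ.comp h).lineIntegral w ≤
      γ.lineIntegral (fun x => ENNReal.ofReal (f x)) + ENNReal.ofReal (η n)}
  have hanti : Antitone C := by
    rintro m n hmn f ⟨hf0, hf⟩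
    refine ⟨hf0, hf.mono fun γ hγ => hγ.trans ?_⟩
    gcongr
    exact Nat.one_div_le_one_div hmn
  have hconv : ∀ n, Convex ℝ (C n) := by
    rintro n f ⟨hf0, hf⟩ g ⟨hg0, hg⟩ a b ha hb hab
    have hae : ∀ᵐ x ∂(hausdorff2 X), (a • f + b • g : Lp ℝ 2 (hausdorff2 X)) x =
        a * f x + b * g x ∧ 0 ≤ f x ∧ 0 ≤ g x := by
      filter_upwards [Lp.coeFn_add (a • f) (b • g), Lp.coeFn_smul a f, Lp.coeFn_smul b g, hf0, hg0]
        with x h1 h2 h3 h4 h5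
      rw [h1, Pi.add_apply, h2, h3]
      exact ⟨rfl, h4, h5⟩
    refine ⟨hae.mono fun x hx => ?_, ?_⟩
    · rw [hx.1]
      exact add_nonneg (mul_nonneg ha hx.2.1) (mul_nonneg hb hx.2.2)
    · filter_upwards [hf, hg, eventually_ae_lengthMeasure hae, eventually_rectifiable]
        with γ h1 h2 h3 hr
      rw [Curve.lineIntegral_eq_lintegral hr (hmeas _)] at h1 h2 ⊢
      have e : ∫⁻ u, ENNReal.ofReal ((a • f + b • g : Lp ℝ 2 (hausdorff2 X)) (γ.ext u))
          ∂γ.lengthMeasure =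
          ENNReal.ofReal a * ∫⁻ u, ENNReal.ofReal (f (γ.ext u)) ∂γ.lengthMeasure +
          ENNReal.ofReal b * ∫⁻ u, ENNReal.ofReal (g (γ.ext u)) ∂γ.lengthMeasure := by
        rw [← lintegral_const_mul' _ _ ENNReal.ofReal_ne_top,
          ← lintegral_const_mul' _ _ ENNReal.ofReal_ne_top, ← lintegral_add_left
            (f := fun u => ENNReal.ofReal a * ENNReal.ofReal (f (γ.ext u)))
            (((hmeas f).comp γ.continuous_ext.measurable).const_mul _)]
        refine lintegral_congr_ae (h3.mono fun u hu => ?_)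
        simp only
        rw [hu.1, ENNReal.ofReal_add (mul_nonneg ha hu.2.1) (mul_nonneg hb hu.2.2),
          ENNReal.ofReal_mul ha, ENNReal.ofReal_mul hb]
      rw [e]
      have hab' : ENNReal.ofReal a + ENNReal.ofReal b = 1 := by
        rw [← ENNReal.ofReal_add ha hb, hab, ENNReal.ofReal_one]
      calc (γ.comp h).lineIntegral w
          = ENNReal.ofReal a * (γ.comp h).lineIntegral w +
            ENNReal.ofReal b * (γ.comp h).lineIntegral w := by rw [← add_mul, hab', one_mul]
        _ ≤ _ := add_le_add (mul_le_mul_right h1 _) (mul_le_mul_right h2 _)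
        _ = _ := by
          rw [mul_add, mul_add, add_add_add_comm, ← add_mul, hab', one_mul]
  have hbd : ∀ n, ∀ ε > 0, ∃ f ∈ C n, ‖f‖ ^ 2 ≤ M.toReal + ε := by
    intro n ε hε
    have hε0 : ENNReal.ofReal ε ≠ 0 := by simpa using hε
    obtain ⟨g, hgm, hg2, hg⟩ := exists_approximate_gradient hmod hw hw2 (hη n) hε0
    have hgt : ∫⁻ x, g x ^ 2 ∂(hausdorff2 X) ≠ ∞ :=
      ne_top_of_le_ne_top (ENNReal.add_ne_top.2 ⟨hMt, ENNReal.ofReal_ne_top⟩) hg2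
    obtain ⟨f, hf, hfn⟩ := exists_Lp_eq_toReal hgm hgt
    refine ⟨f, ⟨hf.mono fun x hx => hx.1, ?_⟩, ?_⟩
    · filter_upwards [hg, eventually_ae_lengthMeasure hf, eventually_rectifiable] with γ h1 h2 hr
      rw [Curve.lineIntegral_eq_lintegral hr (hmeas _)]
      rw [Curve.lineIntegral_eq_lintegral hr hgm] at h1
      rwa [lintegral_congr_ae (h2.mono fun u hu => hu.2)]
    · have : ENNReal.ofReal (‖f‖ ^ 2) ≤ ENNReal.ofReal (M.toReal + ε) := by
        rw [hfn, ENNReal.ofReal_add ENNReal.toReal_nonneg hε.le, ENNReal.ofReal_toReal hMt]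
        exact hg2
      rwa [ENNReal.ofReal_le_ofReal_iff (by positivity)] at this
  obtain ⟨v, hvM, hv⟩ := exists_mem_closure_of_antitone_convex hconv hanti hbd
  have hex : ∀ n, ∃ f ∈ C n, ∫⁻ x, ‖f x - v x‖ₑ ^ 2 ∂(hausdorff2 X) ≤ (8⁻¹ : ℝ≥0∞) ^ n := by
    intro n
    -- Distance `3⁻ⁿ` means energy at most `9⁻ⁿ ≤ 8⁻ⁿ`, the rate required by
    -- `eventually_tendsto_lineIntegral`.
    have hpos : (0 : ℝ≥0∞) < (3⁻¹ : ℝ≥0∞) ^ n := ENNReal.pow_pos (by simp) n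
    obtain ⟨f, hf, hfv⟩ := EMetric.mem_closure_iff.1 (hv n) _ hpos
    refine ⟨f, hf, ?_⟩
    have e : ∫⁻ x, ‖f x - v x‖ₑ ^ 2 ∂(hausdorff2 X) = ‖f - v‖ₑ ^ 2 := by
      rw [Lp_enorm_sq]
      refine lintegral_congr_ae ?_
      filter_upwards [Lp.coeFn_sub f v] with x hx
      rw [hx, Pi.sub_apply]
    rw [e, ← edist_eq_enorm_sub, edist_comm]
    calc edist v f ^ 2 ≤ ((3⁻¹ : ℝ≥0∞) ^ n) ^ 2 := pow_le_pow_left' hfv.le 2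
      _ = (9⁻¹ : ℝ≥0∞) ^ n := by
        rw [← pow_mul, mul_comm, pow_mul, ← ENNReal.inv_pow]
        norm_num
      _ ≤ _ := pow_le_pow_left' (ENNReal.inv_le_inv.2 (by norm_num)) n
  choose f hfC hfv using hex
  refine ⟨fun x => ENNReal.ofReal (v x), hmeas v, ?_, ?_⟩
  · calc ∫⁻ x, ENNReal.ofReal (v x) ^ 2 ∂(hausdorff2 X)
        ≤ ∫⁻ x, ‖v x‖ₑ ^ 2 ∂(hausdorff2 X) :=
          lintegral_mono fun x => pow_le_pow_left' (Real.ofReal_le_enorm _) 2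
      _ = ENNReal.ofReal (‖v‖ ^ 2) := (Lp_norm_sq v).symm
      _ ≤ ENNReal.ofReal M.toReal := ENNReal.ofReal_le_ofReal hvM
      _ = M := ENNReal.ofReal_toReal hMt
  · have hem : ∀ n, Measurable fun x => ‖f n x - v x‖ₑ := fun n =>
      ((Lp.stronglyMeasurable (f n)).measurable.sub (Lp.stronglyMeasurable v).measurable).enorm
    filter_upwards [eventually_countable_forall.2 fun n => (hfC n).2,
      eventually_tendsto_lineIntegral hem hfv, eventually_rectifiable] with γ h1 h2 hr
    have hlim : Filter.Tendsto (fun n => γ.lineIntegral (fun x => ENNReal.ofReal (v x)) +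
        γ.lineIntegral (fun x => ‖f n x - v x‖ₑ) + ENNReal.ofReal (η n)) Filter.atTop
        (𝓝 (γ.lineIntegral (fun x => ENNReal.ofReal (v x)) + 0 + ENNReal.ofReal 0)) :=
      (h2.const_add _).add (ENNReal.tendsto_ofReal tendsto_one_div_add_atTop_nhds_zero_nat)
    rw [add_zero, ENNReal.ofReal_zero, add_zero] at hlim
    refine ge_of_tendsto' hlim fun n => (h1 n).trans ?_
    gcongr
    rw [Curve.lineIntegral_eq_lintegral hr (hmeas _), Curve.lineIntegral_eq_lintegral hr (hmeas _),
      Curve.lineIntegral_eq_lintegral hr (hem n), ← lintegral_add_left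
        (f := fun u => ENNReal.ofReal (v (γ.ext u))) ((hmeas v).comp γ.continuous_ext.measurable)]
    refine lintegral_mono fun u => ?_
    calc ENNReal.ofReal (f n (γ.ext u))
        = ENNReal.ofReal (v (γ.ext u) + (f n (γ.ext u) - v (γ.ext u))) := by congr 1; ring
      _ ≤ ENNReal.ofReal (v (γ.ext u)) + ENNReal.ofReal (f n (γ.ext u) - v (γ.ext u)) :=
        ENNReal.ofReal_add_le
      _ ≤ _ := by
        gcongr
        exact Real.ofReal_le_enorm _

end QuasiconformalGradient

/-! ### From the modulus inequality to the pointwise bound -/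

section Necessity

variable {X Y : Type*} [MetricSpace X] [MeasurableSpace X] [BorelSpace X]
  [MetricSpace Y] [MeasurableSpace Y] [BorelSpace Y]

/-- Replaces the constant `1`, which need not be square-integrable when the measure is only locally
finite. -/
theorem exists_locally_bounded_below_weight {Z : Type*} [TopologicalSpace Z]
    [SecondCountableTopology Z] [MeasurableSpace Z] [OpensMeasurableSpace Z] (μ : Measure Z)
    [IsLocallyFiniteMeasure μ] :
    ∃ w : Z → ℝ≥0∞, Measurable w ∧ ∫⁻ z, w z ^ 2 ∂μ ≠ ∞ ∧ (∀ z, w z ≠ ∞) ∧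
      ∀ z, ∃ V ∈ 𝓝 z, ∃ c ≠ 0, ∀ z' ∈ V, c ≤ w z' := by
  choose U hzU hU hfin using μ.exists_isOpen_measure_lt_top
  obtain ⟨t, htc, ht⟩ := TopologicalSpace.countable_cover_nhds fun z => (hU z).mem_nhds (hzU z)
  have := htc.to_subtype
  obtain ⟨ε, hε, hsum⟩ := ENNReal.exists_pos_sum_of_countable (ε := 1) one_ne_zero t
  -- Chosen so that `c i ² μ(U i) ≤ c i (1 + μ(U i)) ≤ ε i`, which is summable.
  let c : t → ℝ≥0∞ := fun i => min 1 (ε i / (1 + μ (U i)))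
  have hne : ∀ i : t, 1 + μ (U i) ≠ ∞ := fun i =>
    ENNReal.add_ne_top.2 ⟨ENNReal.one_ne_top, (hfin i).ne⟩
  have hc0 : ∀ i, c i ≠ 0 := fun i => by
    have : (0 : ℝ≥0∞) < ε i / (1 + μ (U i)) :=
      ENNReal.div_pos (ENNReal.coe_pos.2 (hε i)).ne' (hne i)
    exact (lt_min one_pos this).ne'
  have hmeas : ∀ i : t, Measurable ((U i).indicator fun _ => c i) := fun i =>
    measurable_const.indicator (hU i).measurableSet
  have hcb : ∀ i : t, ∫⁻ z, ((U i).indicator (fun _ => c i) z) ^ 2 ∂μ ≤ ε i := fun i => by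
    have e : (fun z => ((U i).indicator (fun _ => c i) z) ^ 2) =
        (U i).indicator fun _ => c i ^ 2 := by
      ext z
      by_cases hz : z ∈ U i <;> simp [hz]
    rw [e, lintegral_indicator (hU i).measurableSet, setLIntegral_const]
    calc c i ^ 2 * μ (U i) ≤ c i * (1 + μ (U i)) := by
          gcongr
          · exact pow_le_of_le_one zero_le (min_le_left _ _) two_ne_zero
          · exact le_add_self
      _ ≤ ε i / (1 + μ (U i)) * (1 + μ (U i)) := by gcongr; exact min_le_right _ _
      _ = ε i := ENNReal.div_mul_cancel (by simp) (hne i)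
  refine ⟨fun z => ⨆ i : t, (U i).indicator (fun _ => c i) z, .iSup hmeas, ?_, fun z => ?_,
    fun z => ?_⟩
  · refine ne_top_of_le_ne_top ENNReal.one_ne_top ((lintegral_iSup_sq_le μ hmeas).trans ?_)
    exact (ENNReal.tsum_le_tsum hcb).trans hsum.le
  · refine ne_top_of_le_ne_top ENNReal.one_ne_top (iSup_le fun i => ?_)
    exact indicator_apply_le' (fun _ => min_le_left _ _) fun _ => zero_le
  · have hz : z ∈ ⋃ x ∈ t, U x := by rw [ht]; exact mem_univ z
    obtain ⟨i, hi, hzi⟩ := mem_iUnion₂.1 hz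
    refine ⟨U i, (hU i).mem_nhds hzi, c ⟨i, hi⟩, hc0 _, fun z' hz' => ?_⟩
    refine le_trans ?_ (le_iSup _ (⟨i, hi⟩ : t))
    rw [indicator_of_mem hz']

theorem eventually_withDensity_le {h : C(X, Y)} {w : Y → ℝ≥0∞} {g : X → ℝ≥0∞}
    (hrect : ∀ᶠ γ in modAE X, (γ.comp h).Rectifiable)
    (hw : Measurable w) (hg : Measurable g) (hg2 : ∫⁻ x, g x ^ 2 ∂(hausdorff2 X) ≠ ∞)
    (H : ∀ᶠ γ in modAE X, (γ.comp h).lineIntegral w ≤ γ.lineIntegral g) :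
    ∀ᶠ γ in modAE X, (γ.comp h).lengthMeasure.withDensity (fun u => w (h (γ.ext u))) ≤
      γ.lengthMeasure.withDensity (fun u => g (γ.ext u)) := by
  filter_upwards [hrect, H, eventually_forall_sub H, eventually_lineIntegral_ne_top hg hg2,
    eventually_rectifiable] with γ hr' h1 h2 hfin hr
  have hfin' := ne_top_of_le_ne_top hfin h1
  rw [Curve.lineIntegral_eq_lintegral hr hg] at hfin
  rw [Curve.lineIntegral_eq_lintegral hr' hw] at hfin'
  have hf1 : IsFiniteMeasure (γ.lengthMeasure.withDensity (fun u => g (γ.ext u))) :=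
    isFiniteMeasure_withDensity hfin
  have hf2 : IsFiniteMeasure
      ((γ.comp h).lengthMeasure.withDensity (fun u => w (h (γ.ext u)))) :=
    isFiniteMeasure_withDensity hfin'
  refine measure_le_of_Ioc_le fun a b hab => ?_
  have := h2 a b hab.le
  rw [Curve.comp_sub, Curve.lineIntegral_sub hr hg, Curve.lineIntegral_sub hr' hw] at this
  rw [withDensity_apply _ measurableSet_Ioc, withDensity_apply _ measurableSet_Ioc]
  exact this

theorem withDensity_mono_measure {α : Type*} [MeasurableSpace α] {μ ν : Measure α} (h : μ ≤ ν)
    (f : α → ℝ≥0∞) : μ.withDensity f ≤ ν.withDensity f :=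
  Measure.le_iff.2 fun s hs => by
    rw [withDensity_apply _ hs, withDensity_apply _ hs]
    exact lintegral_mono' (Measure.restrict_mono le_rfl h) le_rfl

/-- A map that does not increase the modulus too much has a locally square-integrable weak upper
gradient. -/
theorem exists_weakUpperGradient_of_modulus_le [SecondCountableTopology Y]
    [IsLocallyFiniteMeasure (hausdorff2 Y)] {K : ℝ≥0} {h : C(X, Y)}
    (hmod : ∀ Γ : Set (Curve X), modulus Γ ≤ K * modulus (Curve.comp h '' Γ)) :
    ∃ g, IsWeakUpperGradient h g ∧ LocallyL2 g := by
  obtain ⟨w, hw, hw2, hwt, hwlb⟩ := exists_locally_bounded_below_weight (hausdorff2 Y)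
  have hw0 : ∀ y, w y ≠ 0 := fun y => by
    obtain ⟨V, hV, c, hc, hcV⟩ := hwlb y
    exact ((pos_iff_ne_zero.2 hc).trans_le (hcV y (mem_of_mem_nhds hV))).ne'
  obtain ⟨g, hg, hg2, hgw⟩ := exists_gradient_of_modulus_le hmod hw hw2
  have hgt : ∫⁻ x, g x ^ 2 ∂(hausdorff2 X) ≠ ∞ :=
    ne_top_of_le_ne_top (ENNReal.mul_ne_top ENNReal.coe_ne_top hw2) hg2
  have hrect := eventually_comp_of_modulus_le hmod (eventually_rectifiable (X := Y))
  have hwh : Measurable fun x => w (h x) := hw.comp h.continuous.measurable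
  have hm : Measurable fun x => g x * (w (h x))⁻¹ := hg.mul hwh.inv
  refine ⟨fun x => g x * (w (h x))⁻¹, isWeakUpperGradient_of_controlsLength hm ?_, fun x => ?_⟩
  · filter_upwards [hrect, eventually_withDensity_le hrect hw hg hgt hgw] with γ hr hle
    refine ⟨hr, ?_⟩
    have hwm : Measurable fun u => w (h (γ.ext u)) := hwh.comp γ.continuous_ext.measurable
    -- Dividing both measures by the weight recovers the length of `h ∘ γ` on the left and the
    -- density `g / (w ∘ h)` on the right.
    have := withDensity_mono_measure hle fun u => (w (h (γ.ext u)))⁻¹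
    rw [withDensity_inv_same hwm (Filter.Eventually.of_forall fun u => hw0 _)
      (Filter.Eventually.of_forall fun u => hwt _)] at this
    refine this.trans_eq ?_
    exact (withDensity_mul _ (f := fun u => g (γ.ext u)) (g := fun u => (w (h (γ.ext u)))⁻¹)
      (hg.comp γ.continuous_ext.measurable) hwm.inv).symm
  · obtain ⟨V, hV, c, hc, hcV⟩ := hwlb (h x)
    refine ⟨h ⁻¹' V, h.continuous.continuousAt.preimage_mem_nhds hV, ?_⟩
    have hb : ∫⁻ z in h ⁻¹' V, (g z * (w (h z))⁻¹) ^ 2 ∂(hausdorff2 X) ≤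
        ∫⁻ z in h ⁻¹' V, (c⁻¹) ^ 2 * g z ^ 2 ∂(hausdorff2 X) := by
      refine setLIntegral_mono ((hg.pow_const 2).const_mul _) fun z hz => ?_
      rw [mul_pow, mul_comm]
      gcongr
      exact hcV _ hz
    refine hb.trans_lt ?_
    rw [lintegral_const_mul _ (hg.pow_const 2)]
    refine ENNReal.mul_lt_top (ENNReal.pow_lt_top (ENNReal.inv_lt_top.2 (pos_iff_ne_zero.2 hc)))
      ((setLIntegral_le_lintegral _ _).trans_lt hgt.lt_top)

/-- Transporting `1_A` gives `f` of energy at most `K ℋ²(A)` that controls the length of `h ∘ γ`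
inside `A`. Gluing `f` on `h⁻¹(A)` to `g` elsewhere is again a weak upper gradient, so minimality
gives `g ≤ f` a.e. on `h⁻¹(A)`. -/
theorem IsMinimalWeakUpperGradient.setLIntegral_sq_le [SecondCountableTopology X] {K : ℝ≥0}
    (hK : K ≠ 0) {h : C(X, Y)}
    (hmod : ∀ Γ : Set (Curve X), modulus Γ ≤ K * modulus (Curve.comp h '' Γ))
    {g : X → ℝ≥0∞} (hg : IsMinimalWeakUpperGradient h g) {A : Set Y} (hA : MeasurableSet A) :
    ∫⁻ x in h ⁻¹' A, g x ^ 2 ∂(hausdorff2 X) ≤ K * hausdorff2 Y A := by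
  classical
  by_cases htop : hausdorff2 Y A = ∞
  · rw [htop, ENNReal.mul_top (by simpa using hK)]
    exact le_top
  have hw : Measurable (A.indicator (1 : Y → ℝ≥0∞)) := measurable_one.indicator hA
  have hw2 : ∫⁻ y, (A.indicator (1 : Y → ℝ≥0∞) y) ^ 2 ∂(hausdorff2 Y) = hausdorff2 Y A := by
    rw [← lintegral_indicator_one hA]
    refine lintegral_congr fun y => ?_
    by_cases hy : y ∈ A <;> simp [hy]
  obtain ⟨f, hf, hf2, hfw⟩ := exists_gradient_of_modulus_le hmod hw (hw2 ▸ htop)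
  rw [hw2] at hf2
  have hft : ∫⁻ x, f x ^ 2 ∂(hausdorff2 X) ≠ ∞ :=
    ne_top_of_le_ne_top (ENNReal.mul_ne_top ENNReal.coe_ne_top htop) hf2
  have hrect := eventually_comp_of_modulus_le hmod (eventually_rectifiable (X := Y))
  have hAm : MeasurableSet (h ⁻¹' A) := h.continuous.measurable hA
  have hm : Measurable ((h ⁻¹' A).piecewise f g) := hf.piecewise hAm hg.1.1
  have hcontrol : ∀ᶠ γ in modAE X, ControlsLength h ((h ⁻¹' A).piecewise f g) γ := by
    filter_upwards [hg.1.eventually_controlsLength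
      (eventually_lineIntegral_ne_top_of_locallyL2 hg.1.1 hg.2.1),
      eventually_withDensity_le hrect hw hf hft hfw] with γ H hle
    refine ⟨H.1, ?_⟩
    have hB : MeasurableSet (γ.ext ⁻¹' (h ⁻¹' A)) := γ.continuous_ext.measurable hAm
    have e : (fun u => A.indicator (1 : Y → ℝ≥0∞) (h (γ.ext u))) =
        (γ.ext ⁻¹' (h ⁻¹' A)).indicator 1 := by
      ext u
      by_cases hu : h (γ.ext u) ∈ A <;> simp [indicator, hu]
    rw [e, withDensity_indicator_one hB] at hle
    exact (le_withDensity_piecewise hB hle H.2).trans_eq rfl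
  have hloc : LocallyL2 ((h ⁻¹' A).piecewise f g) := by
    intro x
    obtain ⟨U, hU, hUg⟩ := hg.2.1 x
    refine ⟨U, hU, ?_⟩
    calc ∫⁻ z in U, (h ⁻¹' A).piecewise f g z ^ 2 ∂(hausdorff2 X)
        ≤ ∫⁻ z in U, (f z ^ 2 + g z ^ 2) ∂(hausdorff2 X) := lintegral_mono fun z => by
          by_cases hz : z ∈ h ⁻¹' A
          · simp only [piecewise_eq_of_mem _ _ _ hz]
            exact le_self_add
          · simp only [piecewise_eq_of_notMem _ _ _ hz]
            exact le_add_self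
      _ < ∞ := by
        rw [lintegral_add_left (hf.pow_const 2)]
        exact ENNReal.add_lt_top.2 ⟨(setLIntegral_le_lintegral _ _).trans_lt hft.lt_top, hUg⟩
  have hle := hg.2.2 _ (isWeakUpperGradient_of_controlsLength hm hcontrol) hloc
  calc ∫⁻ x in h ⁻¹' A, g x ^ 2 ∂(hausdorff2 X)
      ≤ ∫⁻ x in h ⁻¹' A, f x ^ 2 ∂(hausdorff2 X) := by
        refine setLIntegral_mono_ae (hf.pow_const 2).aemeasurable ?_
        filter_upwards [hle] with x hx hxA
        rw [piecewise_eq_of_mem _ _ _ hxA] at hx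
        gcongr
    _ ≤ _ := (setLIntegral_le_lintegral _ _).trans hf2

theorem memN12loc_of_weakUpperGradient [IsLocallyFiniteMeasure (hausdorff2 X)] (h : C(X, Y))
    {g : X → ℝ≥0∞} (hg : IsWeakUpperGradient h g) (hg2 : LocallyL2 g) : MemN12loc h := by
  intro x
  obtain ⟨V, hV, hgV⟩ := hg2 x
  obtain ⟨W, hxW, hW, hWfin⟩ := (hausdorff2 X).exists_isOpen_measure_lt_top x
  let U : Set X := interior V ∩ W ∩ h ⁻¹' Metric.eball (h x) 1
  have hU : IsOpen U := (isOpen_interior.inter hW).inter (Metric.isOpen_eball.preimage h.continuous)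
  have hxU : x ∈ U := ⟨⟨mem_interior_iff_mem_nhds.2 hV, hxW⟩, by simp⟩
  let ι : C(U, X) := ⟨Subtype.val, continuous_subtype_val⟩
  have hι : Isometry ι := isometry_subtype_coe
  have hint : ∀ f : X → ℝ≥0∞, Measurable f →
      ∫⁻ u : U, f u ∂(hausdorff2 U) ≤ ∫⁻ z in U, f z ∂(hausdorff2 X) := fun f hf => by
    rw [← lintegral_indicator hU.measurableSet]
    refine le_trans (lintegral_mono fun u => ?_)
      (lintegral_comp_isometry_le hι (hf.indicator hU.measurableSet))
    exact (indicator_of_mem u.2 f).ge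
  have hcont : Continuous fun u : U => h u := h.continuous.comp continuous_subtype_val
  refine ⟨U, hU, hxU, hcont.measurable, ⟨fun u => g u, ⟨hg.1.comp measurable_subtype_coe, ?_⟩, ?_⟩,
    h x, ?_⟩
  · obtain ⟨-, Γ₀, hΓ₀, H⟩ := hg
    refine ⟨{γ | γ.comp ι ∈ Γ₀}, le_antisymm ((modulus_preimage_isometry_le hι Γ₀).trans hΓ₀.le)
      zero_le, fun γ hγ hr => ?_⟩
    have := H (γ.comp ι) hγ (by rwa [Curve.Rectifiable, Curve.length_comp_isometry hι])
    rw [Curve.lineIntegral_comp_isometry hι] at this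
    exact this
  · refine (hint _ (hg.1.pow_const 2)).trans_lt ((lintegral_mono_set ?_).trans_lt hgV)
    exact fun z hz => interior_subset hz.1.1
  · have hm : Measurable fun z => edist (h x) (h z) ^ 2 :=
      (continuous_const.edist h.continuous).measurable.pow_const 2
    refine (hint _ hm).trans_lt ?_
    calc ∫⁻ z in U, edist (h x) (h z) ^ 2 ∂(hausdorff2 X) ≤ ∫⁻ z in U, 1 ∂(hausdorff2 X) := by
          refine setLIntegral_mono measurable_const fun z hz => pow_le_one' ?_ 2
          rw [edist_comm]
          exact (Metric.mem_eball.1 hz.2).le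
      _ ≤ hausdorff2 X W := by
          rw [setLIntegral_one]
          exact measure_mono fun z hz => hz.1.2
      _ < ∞ := hWfin

/-- The singular part of `ν` lives on a `μ`-null set; off that set `ν` is its density times `μ`. -/
theorem ae_le_rnDeriv_of_withDensity_le {α : Type*} [MeasurableSpace α] {μ ν : Measure α}
    [SigmaFinite μ] [SigmaFinite ν] {f : α → ℝ≥0∞} (hf : Measurable f) {K : ℝ≥0}
    (H : ∀ E, MeasurableSet E → ∫⁻ x in E, f x ∂μ ≤ K * ν E) :
    ∀ᵐ x ∂μ, f x ≤ K * ν.rnDeriv μ x := by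
  obtain ⟨S, hS, hS1, hS2⟩ := Measure.mutuallySingular_singularPart ν μ
  refine ae_le_of_forall_setLIntegral_le_of_sigmaFinite hf fun E hE _ => ?_
  have hES : ∫⁻ x in E, f x ∂μ = ∫⁻ x in E ∩ S, f x ∂μ := by
    rw [← lintegral_inter_add_sdiff _ E hS, setLIntegral_measure_zero (E \ S), add_zero]
    exact measure_mono_null (fun x hx => hx.2) hS2
  rw [hES, lintegral_const_mul _ (Measure.measurable_rnDeriv _ _)]
  refine (H _ (hE.inter hS)).trans ?_
  gcongr
  have hdec := congrArg (fun m : Measure α => m (E ∩ S)) (ν.haveLebesgueDecomposition_add μ)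
  simp only [Measure.add_apply] at hdec
  rw [hdec, measure_mono_null inter_subset_right hS1, zero_add,
    withDensity_apply _ (hE.inter hS)]
  exact lintegral_mono_set inter_subset_left

/-- Images of closed sets are countable unions of compact sets, and injectivity off `h⁻¹(M)` makes
images commute with complements there; Borel induction does the rest. -/
theorem measurableSet_image_inter_preimage_compl [SigmaCompactSpace X] {h : X → Y}
    (hc : Continuous h) (hs : Function.Surjective h) {M : Set Y} (hM : MeasurableSet M)
    (hinj : ∀ x x', h x = h x' → h x ∉ M → x = x') {E : Set X} (hE : MeasurableSet E) :
    MeasurableSet (h '' (E ∩ h ⁻¹' Mᶜ)) := by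
  have hbor : ‹MeasurableSpace X› = MeasurableSpace.generateFrom {s | IsClosed s} := by
    rw [BorelSpace.measurable_eq (α := X), borel_eq_generateFrom_isClosed]
  induction E, hE using MeasurableSpace.induction_on_inter hbor isPiSystem_isClosed with
  | empty => simp
  | basic E hE =>
    rw [image_inter_preimage]
    refine MeasurableSet.inter ?_ hM.compl
    have : E = ⋃ n, E ∩ compactCovering X n := by
      rw [← inter_iUnion, iUnion_compactCovering, inter_univ]
    rw [this, image_iUnion]
    refine .iUnion fun n => ?_
    exact (((isCompact_compactCovering X n).inter_left hE).image hc).measurableSet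
  | compl E _ ih =>
    have : h '' (Eᶜ ∩ h ⁻¹' Mᶜ) = Mᶜ \ h '' (E ∩ h ⁻¹' Mᶜ) := by
      ext y
      constructor
      · rintro ⟨x, ⟨hxE, hxM⟩, rfl⟩
        refine ⟨hxM, ?_⟩
        rintro ⟨x', ⟨hx'E, hx'M⟩, hxx'⟩
        rw [hinj _ _ hxx' hx'M] at hx'E
        exact hxE hx'E
      · rintro ⟨hyM, hy⟩
        obtain ⟨x, rfl⟩ := hs y
        exact ⟨x, ⟨fun hx => hy ⟨x, ⟨hx, hyM⟩, rfl⟩, hyM⟩, rfl⟩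
    rw [this]
    exact hM.compl.diff ih
  | iUnion f _ _ ih =>
    rw [iUnion_inter, image_iUnion]
    exact .iUnion ih

/-- If almost all fibers are singletons, then the set function `E ↦ ℋ²(h(E))` is a measure. -/
theorem exists_isImageMeasure [SigmaCompactSpace X] {h : X → Y} (hc : Continuous h)
    (hs : Function.Surjective h) (hfib : ∀ᵐ y ∂(hausdorff2 Y), (h ⁻¹' {y}).Subsingleton) :
    ∃ ν, IsImageMeasure h ν := by
  obtain ⟨M, hM, hMm, hM0⟩ := exists_measurable_superset_of_null (ae_iff.1 hfib)
  have hinj : ∀ x x', h x = h x' → h x ∉ M → x = x' := by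
    intro x x' hxx' hx
    by_contra hne
    exact hx (hM fun hsub => hne (hsub rfl hxx'.symm))
  have hmeas : ∀ E, MeasurableSet E → MeasurableSet (h '' (E ∩ h ⁻¹' Mᶜ)) := fun E hE =>
    measurableSet_image_inter_preimage_compl hc hs hMm hinj hE
  refine ⟨Measure.ofMeasurable (fun E _ => hausdorff2 Y (h '' (E ∩ h ⁻¹' Mᶜ))) (by simp) ?_,
    fun E hE => ?_⟩
  · intro f hf hdisj
    rw [iUnion_inter, image_iUnion, measure_iUnion _ fun n => hmeas _ (hf n)]
    intro i j hij
    refine Set.disjoint_left.2 ?_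
    rintro _ ⟨x, ⟨hx, hxM⟩, rfl⟩ ⟨x', ⟨hx', hxM'⟩, hxx'⟩
    rw [hinj _ _ hxx' hxM'] at hx'
    exact Set.disjoint_left.1 (hdisj hij) hx hx'
  · rw [Measure.ofMeasurable_apply E hE, image_inter_preimage, ← sdiff_eq]
    exact measure_sdiff_null hM0

theorem exists_gradient_and_imageMeasure [SecondCountableTopology X] [SigmaCompactSpace X]
    [SecondCountableTopology Y] [IsLocallyFiniteMeasure (hausdorff2 X)]
    [IsLocallyFiniteMeasure (hausdorff2 Y)] {K : ℝ≥0} (hK : K ≠ 0) {h : C(X, Y)}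
    (hs : Function.Surjective h)
    (hmod : ∀ Γ : Set (Curve X), modulus Γ ≤ K * modulus (Curve.comp h '' Γ))
    (hfib : ∀ᵐ y ∂(hausdorff2 Y), (h ⁻¹' {y}).Subsingleton) :
    MemN12loc h ∧ ∃ (g : X → ℝ≥0∞) (ν : Measure X),
      IsMinimalWeakUpperGradient h g ∧ IsImageMeasure h ν ∧
        ∀ᵐ x ∂(hausdorff2 X), g x ^ 2 ≤ K * ν.rnDeriv (hausdorff2 X) x := by
  obtain ⟨g₀, hg₀, hg₀'⟩ := exists_weakUpperGradient_of_modulus_le hmod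
  obtain ⟨g, hg⟩ := exists_isMinimalWeakUpperGradient h hg₀ hg₀'
  obtain ⟨ν, hν⟩ := exists_isImageMeasure h.continuous hs hfib
  refine ⟨memN12loc_of_weakUpperGradient h hg.1 hg.2.1, g, ν, hg, hν, ?_⟩
  have := hν.isLocallyFiniteMeasure h.continuous ‹_›
  refine ae_le_rnDeriv_of_withDensity_le (hg.1.1.pow_const 2) fun E hE => ?_
  -- A measurable hull of `h '' E` has the same measure and is a legitimate choice of `A`.
  rw [hν E hE, ← measure_toMeasurable (h '' E)]
  refine (lintegral_mono_set ?_).trans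
    (hg.setLIntegral_sq_le hK hmod (measurableSet_toMeasurable (hausdorff2 Y) (h '' E)))
  exact (subset_preimage_image h E).trans (preimage_mono (subset_toMeasurable _ _))

end Necessity

/-! ### Separation and connectedness -/

section Separation

/-- In a compact Hausdorff space, two closed sets that no connected component joins are separated by
a clopen set. -/
theorem exists_isClopen_separating {S : Type*} [TopologicalSpace S] [CompactSpace S] [T2Space S]
    {A B : Set S} (hA : IsClosed A) (hB : IsClosed B)
    (h : ∀ a ∈ A, Disjoint (connectedComponent a) B) :
    ∃ Q, IsClopen Q ∧ A ⊆ Q ∧ Disjoint Q B := by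
  -- In a compact Hausdorff space components are intersections of clopen sets, so points can be
  -- separated; compactness of `B`, then of `A`, makes finitely many choices suffice.
  have hpt : ∀ a ∈ A, ∃ Q, IsClopen Q ∧ a ∈ Q ∧ Disjoint Q B := by
    intro a ha
    refine hB.isCompact.induction_on (p := fun T => ∃ Q, IsClopen Q ∧ a ∈ Q ∧ Disjoint Q T)
      ⟨univ, isClopen_univ, mem_univ _, disjoint_empty _⟩ ?_ ?_ ?_
    · rintro T T' hT ⟨Q, h1, h2, h3⟩
      exact ⟨Q, h1, h2, h3.mono_right hT⟩
    · rintro T T' ⟨Q, h1, h2, h3⟩ ⟨Q', h1', h2', h3'⟩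
      exact ⟨Q ∩ Q', h1.inter h1', ⟨h2, h2'⟩, disjoint_union_right.2
        ⟨h3.mono_left inter_subset_left, h3'.mono_left inter_subset_right⟩⟩
    · intro b hb
      have hb' : b ∉ connectedComponent a := fun hb' => Set.disjoint_left.1 (h a ha) hb' hb
      rw [connectedComponent_eq_iInter_isClopen] at hb'
      simp only [mem_iInter, not_forall] at hb'
      obtain ⟨⟨Q, hQ, haQ⟩, hbQ⟩ := hb'
      exact ⟨Qᶜ, mem_nhdsWithin_of_mem_nhds (hQ.compl.isOpen.mem_nhds hbQ), Q, hQ, haQ,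
        disjoint_compl_right⟩
  refine hA.isCompact.induction_on (p := fun T => ∃ Q, IsClopen Q ∧ T ⊆ Q ∧ Disjoint Q B)
    ⟨∅, isClopen_empty, empty_subset _, empty_disjoint _⟩ ?_ ?_ ?_
  · rintro T T' hT ⟨Q, h1, h2, h3⟩
    exact ⟨Q, h1, hT.trans h2, h3⟩
  · rintro T T' ⟨Q, h1, h2, h3⟩ ⟨Q', h1', h2', h3'⟩
    exact ⟨Q ∪ Q', h1.union h1', union_subset_union h2 h2', disjoint_union_left.2 ⟨h3, h3'⟩⟩
  · intro a ha
    obtain ⟨Q, h1, h2, h3⟩ := hpt a ha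
    exact ⟨Q, mem_nhdsWithin_of_mem_nhds (h1.isOpen.mem_nhds h2), Q, h1, subset_rfl, h3⟩

/-- Maps from a convex set to the circle lift to the line. -/
theorem exists_lift_addCircle {E : Type*} [AddCommGroup E] [Module ℝ E] [TopologicalSpace E]
    [IsTopologicalAddGroup E] [ContinuousSMul ℝ E] {D : Set E} (hD : Convex ℝ D)
    (g : C(D, AddCircle (1 : ℝ))) : ∃ G : C(D, ℝ), ∀ z, (G z : AddCircle (1 : ℝ)) = g z := by
  rcases isEmpty_or_nonempty D with hDe | ⟨⟨z₀⟩⟩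
  · exact ⟨⟨fun z => (hDe.false z).elim, continuous_of_const fun z => (hDe.false z).elim⟩,
      fun z => (hDe.false z).elim⟩
  -- The straight-line contraction to `z₀`; the lift starts from a constant.
  let F : C(unitInterval × D, D) :=
    ⟨fun p => ⟨(1 - (p.1 : ℝ)) • (z₀ : E) + (p.1 : ℝ) • (p.2 : E),
      hD z₀.2 p.2.2 (by linarith [p.1.2.2]) p.1.2.1 (by ring)⟩, by fun_prop⟩
  obtain ⟨r, hr⟩ := QuotientAddGroup.mk_surjective (g z₀)
  have hcov : IsCoveringMap ((↑) : ℝ → AddCircle (1 : ℝ)) := AddCircle.isCoveringMap_coe 1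
  have h0 : ∀ a : D, (g.comp F) (0, a) = ((ContinuousMap.const D r) a : AddCircle (1 : ℝ)) := by
    intro a
    have : F (0, a) = z₀ := by
      ext
      simp [F]
    simp only [ContinuousMap.comp_apply, this, ContinuousMap.const_apply]
    exact hr.symm
  let L := hcov.liftHomotopy (g.comp F) (ContinuousMap.const D r) h0
  have hL : ((↑) : ℝ → AddCircle (1 : ℝ)) ∘ L = g.comp F := hcov.liftHomotopy_lifts _ _ _
  refine ⟨L.comp ⟨fun z => (1, z), by fun_prop⟩, fun z => ?_⟩
  have h1 : F (1, z) = z := by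
    ext
    simp [F]
  have := congrFun hL (1, z)
  simp only [Function.comp, ContinuousMap.comp_apply, h1] at this
  exact this

/-- In a space with no nontrivial maps to the circle: if a level set of a function misses two
connected sets `A`, `B` on different sides, and `A ∪ P ∪ B` and `A ∪ P' ∪ B` are connected,
then some component of the level set joins `P` and `P'`. -/
theorem exists_connected_level_subset {Z : Type*} [TopologicalSpace Z] [CompactSpace Z] [T2Space Z]
    (hlift : ∀ g : C(Z, AddCircle (1 : ℝ)), ∃ G : C(Z, ℝ), ∀ z, (G z : AddCircle (1 : ℝ)) = g z)
    {f : Z → ℝ} (hf : Continuous f) {t : ℝ} {A B P P' : Set Z} {a b : Z} (ha : a ∈ A) (hb : b ∈ B)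
    (hA : ∀ z ∈ A, f z ≠ t) (hB : ∀ z ∈ B, f z ≠ t) (hat : f a < t) (hbt : t < f b)
    (hP : IsClosed P) (hP' : IsClosed P') (hAB : IsPreconnected (A ∪ P ∪ B))
    (hAB' : IsPreconnected (A ∪ P' ∪ B)) :
    ∃ T : Set Z, IsConnected T ∧ IsCompact T ∧ (∀ z ∈ T, f z = t) ∧ (T ∩ P).Nonempty ∧
      (T ∩ P').Nonempty := by
  by_contra hcon
  have hS : IsClosed {z | f z = t} := isClosed_eq hf continuous_const
  have := isCompact_iff_compactSpace.1 hS.isCompact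
  obtain ⟨Q, hQ, hPQ, hQP'⟩ := exists_isClopen_separating (S := {z | f z = t})
    (A := (↑) ⁻¹' P) (B := (↑) ⁻¹' P') (hP.preimage continuous_subtype_val)
    (hP'.preimage continuous_subtype_val) (fun s hs => by
      rw [Set.disjoint_left]
      intro s' hs' hs'P'
      refine hcon ⟨(↑) '' connectedComponent s, isConnected_connectedComponent.image _
        continuous_subtype_val.continuousOn, isClosed_connectedComponent.isCompact.image
        continuous_subtype_val, ?_, ⟨s, ⟨s, mem_connectedComponent, rfl⟩, hs⟩,
        ⟨s', ⟨s', hs', rfl⟩, hs'P'⟩⟩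
      rintro _ ⟨z, -, rfl⟩
      exact z.2)
  have hcl : ∀ R : Set {z | f z = t}, IsClosed R → IsClosed ((↑) '' R : Set Z) := fun R hR =>
    hS.isClosedMap_subtype_val _ hR
  -- If no component joins `P` to `P'`, the level set splits into two closed parts on which `l` is
  -- `0` and `1`. As `l` is an integer on the level set, it can be cut off there modulo `1`, giving
  -- the circle-valued map `g` below.
  obtain ⟨l, hl0, hl1, -⟩ := exists_continuous_zero_one_of_isClosed (hcl Q hQ.isClosed)
    (hcl Qᶜ hQ.compl.isClosed) (by
      rw [Set.disjoint_left]
      rintro _ ⟨s, hs, rfl⟩ ⟨s', hs', hss'⟩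
      exact hs' (Subtype.ext hss' ▸ hs))
  have hl : ∀ z, f z = t → l z = 0 ∨ l z = 1 := fun z hz => by
    by_cases hzQ : (⟨z, hz⟩ : {z | f z = t}) ∈ Q
    · exact Or.inl (hl0 ⟨_, hzQ, rfl⟩)
    · exact Or.inr (hl1 ⟨⟨z, hz⟩, hzQ, rfl⟩)
  have hfr : ∀ z ∈ frontier {z | t < f z}, f z = t := fun z hz =>
    (frontier_lt_subset_eq continuous_const hf hz).symm
  have h1 : ((1 : ℝ) : AddCircle (1 : ℝ)) = 0 := AddCircle.coe_period 1
  classical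
  let g : C(Z, AddCircle (1 : ℝ)) :=
    ⟨fun z => if t < f z then ((l z : ℝ) : AddCircle (1 : ℝ)) else 0,
    by
      refine continuous_if (fun z hz => ?_) ?_ continuousOn_const
      · rcases hl z (hfr z hz) with h | h <;> simp [h, h1]
      · exact ((AddCircle.continuous_mk' 1).comp l.continuous).continuousOn⟩
  obtain ⟨G, hG⟩ := hlift g
  have hdisc : DiscreteTopology (range ((↑) : ℤ → ℝ)) :=
    Int.isClosedEmbedding_coe_real.isEmbedding.toHomeomorph.symm.isEmbedding.discreteTopology
  -- On a connected `R` meeting the level set only where `l = c`, the lift minus its expected value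
  -- is continuous and integer-valued, hence constant. The routes through `P` (`c = 0`) and `P'` (`c
  -- = 1`) give different values of `G a - G b`.
  have key : ∀ (c : ℝ) (R : Set Z), (c : AddCircle (1 : ℝ)) = 0 → IsPreconnected R → a ∈ R →
      b ∈ R → (∀ z ∈ R, f z = t → l z = c) → G a = G b - (l b - c) := by
    intro c R hc hR haR hbR hRl
    let k : Z → ℝ := fun z => G z - if t < f z then l z - c else 0
    have hk : ContinuousOn k R := by
      refine G.continuous.continuousOn.sub (ContinuousOn.if (fun z hz => ?_) ?_ continuousOn_const)
      · rw [hRl z hz.1 (hfr z hz.2), sub_self]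
      · exact (l.continuous.sub continuous_const).continuousOn
    have hkint : MapsTo k R (range ((↑) : ℤ → ℝ)) := by
      intro z _
      have : (k z : AddCircle (1 : ℝ)) = 0 := by
        have hz := hG z
        simp only [k, AddCircle.coe_sub, hz, g, ContinuousMap.coe_mk]
        split_ifs <;> simp [hc]
      obtain ⟨n, hn⟩ := (AddCircle.coe_eq_zero_iff 1).1 this
      exact ⟨n, by simpa using hn⟩
    have := hR.constant_of_mapsTo ⟨hdisc⟩ hk hkint haR hbR
    simpa [k, hat.le.not_gt, hbt] using this
  have e0 := key 0 (A ∪ P ∪ B) (by simp) hAB (Or.inl (Or.inl ha)) (Or.inr hb) (by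
    rintro z ((hz | hz) | hz) hzt
    · exact absurd hzt (hA z hz)
    · exact hl0 ⟨⟨z, hzt⟩, hPQ hz, rfl⟩
    · exact absurd hzt (hB z hz))
  have e1 := key 1 (A ∪ P' ∪ B) h1 hAB' (Or.inl (Or.inl ha)) (Or.inr hb) (by
    rintro z ((hz | hz) | hz) hzt
    · exact absurd hzt (hA z hz)
    · exact hl1 ⟨⟨z, hzt⟩, fun hzQ => Set.disjoint_left.1 hQP' hzQ hz, rfl⟩
    · exact absurd hzt (hB z hz))
  linarith

/-- A connected closed set that is not contained in a compact set `D` but meets its interior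
at `p` contains a nondegenerate connected subset of `D` through `p`. -/
theorem exists_connected_subset_inter {X : Type*} [TopologicalSpace X] [T2Space X] {E D : Set X}
    (hE : IsPreconnected E) (hEc : IsClosed E) (hD : IsCompact D) {p : X} (hp : p ∈ E)
    (hpD : p ∈ interior D) (hED : ¬ E ⊆ D) :
    ∃ T ⊆ E ∩ D, IsConnected T ∧ IsCompact T ∧ p ∈ T ∧ ∃ q ∈ T, q ≠ p := by
  have hC : IsCompact (E ∩ D) := hD.inter_left hEc
  have := isCompact_iff_compactSpace.1 hC
  let p' : ↥(E ∩ D) := ⟨p, hp, interior_subset hpD⟩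
  refine ⟨(↑) '' connectedComponent p', ?_, isConnected_connectedComponent.image _
    continuous_subtype_val.continuousOn, isClosed_connectedComponent.isCompact.image
    continuous_subtype_val, ⟨p', mem_connectedComponent, rfl⟩, ?_⟩
  · rintro _ ⟨z, -, rfl⟩
    exact z.2
  by_contra! hcon
  -- If the component of `p` were a point, a clopen piece of `E ∩ D` around `p` would lie in the
  -- interior of `D` and would be clopen in `E`, disconnecting it.
  obtain ⟨Q, hQ, hpQ, hQd⟩ := exists_isClopen_separating (S := ↥(E ∩ D)) (A := {p'})
    (B := (↑) ⁻¹' (interior D)ᶜ) isClosed_singleton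
    (isOpen_interior.isClosed_compl.preimage continuous_subtype_val) (by
      rintro a rfl
      rw [Set.disjoint_left]
      intro s hs hs'
      rw [mem_preimage, hcon _ ⟨s, hs, rfl⟩] at hs'
      exact hs' hpD)
  obtain ⟨V, hV, hVQ⟩ := isOpen_induced_iff.1 hQ.isOpen
  have hQcl : IsClosed ((↑) '' Q : Set X) := hC.isClosed.isClosedMap_subtype_val _ hQ.isClosed
  have hmem : ∀ x ∈ E, x ∈ interior D → x ∈ V → x ∈ ((↑) '' Q : Set X) := fun x hx hxD hxV => by
    refine ⟨⟨x, hx, interior_subset hxD⟩, ?_, rfl⟩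
    rw [← hVQ]
    exact hxV
  have hmem' : ∀ x ∈ ((↑) '' Q : Set X), x ∈ interior D ∩ V := by
    rintro _ ⟨s, hs, rfl⟩
    refine ⟨?_, ?_⟩
    · by_contra h
      exact Set.disjoint_left.1 hQd hs h
    · rw [← hVQ] at hs
      exact hs
  obtain ⟨y, hyE, hyD⟩ := not_subset.1 hED
  obtain ⟨z, hzE, hz, hz'⟩ := hE (interior D ∩ V) ((↑) '' Q)ᶜ (isOpen_interior.inter hV)
    hQcl.isOpen_compl (fun x _ => by
      by_cases hx' : x ∈ ((↑) '' Q : Set X)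
      · exact Or.inl (hmem' x hx')
      · exact Or.inr hx')
    ⟨p, hp, hmem' p ⟨p', hpQ rfl, rfl⟩⟩
    ⟨y, hyE, fun hy => hyD (interior_subset (hmem' y hy).1)⟩
  exact hz' (hmem z hzE hz.1 hz.2)

end Separation

/-! ### Continua in level sets on a surface -/

section PlanarConfiguration

variable {V : Type*} [NormedAddCommGroup V] [NormedSpace ℝ V] {X : Type*} [MetricSpace X]

theorem isPreconnected_preimage_val {D s : Set V} (hs : IsPreconnected s) (hsD : s ⊆ D) :
    IsPreconnected ((↑) ⁻¹' s : Set D) := by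
  rw [← IsInducing.subtypeVal.isPreconnected_image, Subtype.image_preimage_coe,
    inter_eq_right.2 hsD]
  exact hs

/-- A planar configuration in which many level sets of a Lipschitz function contain a continuum
that joins a closed set to its complement. -/
theorem exists_joining_level_sets_of_embedding {D : Set V} (hD : Convex ℝ D) (hDc : IsCompact D)
    {ψ : D → X} (hψ : Continuous ψ) (hψi : Function.Injective ψ) {E T : Set X} (hE : IsClosed E)
    (hTE : T ⊆ E) (hT : IsPreconnected T) (hTc : IsClosed T) (hTr : T ⊆ range ψ)
    {P Q c : V} (hP : P ∈ D) (hQ : Q ∈ D) (hc : c ∈ D) (hPT : ψ ⟨P, hP⟩ ∈ T) (hQT : ψ ⟨Q, hQ⟩ ∈ T)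
    (hcE : ψ ⟨c, hc⟩ ∉ E) (hPQ : P ≠ Q) (L : V →ₗ[ℝ] ℝ) (hL : L P = L Q) (hLc : L c ≠ L P) :
    ∃ (f : X → ℝ) (r : ℝ), LipschitzWith 1 f ∧ 0 < r ∧ ∀ t ∈ Ioo 0 r,
      ∃ K ⊆ range ψ, IsConnected K ∧ IsCompact K ∧ (∀ x ∈ K, f x = t) ∧ (K ∩ E).Nonempty ∧
        (K \ E).Nonempty := by
  have := isCompact_iff_compactSpace.1 hDc
  have hemb : IsClosedEmbedding ψ := hψ.isClosedEmbedding hψi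
  obtain ⟨δ, hδ, hball⟩ : ∃ δ > 0, ∀ z : D, dist z ⟨c, hc⟩ < δ → ψ z ∉ E :=
    Metric.isOpen_iff.1 (hE.isOpen_compl.preimage hψ) ⟨c, hc⟩ hcE
  set N : ℝ := ‖P - c‖ + ‖Q - c‖ + 1 with hN
  have hN1 : 0 < N := by positivity
  obtain ⟨ε, hε0, hε1, hεδ⟩ : ∃ ε : ℝ, 0 < ε ∧ ε < 1 ∧ ε * N < δ := by
    refine ⟨min (1 / 2) (δ / (2 * N)), by positivity, (min_le_left _ _).trans_lt (by norm_num), ?_⟩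
    calc min (1 / 2) (δ / (2 * N)) * N ≤ δ / (2 * N) * N := by gcongr; exact min_le_right _ _
      _ = δ / 2 := by field_simp
      _ < δ := by linarith
  -- The segments `A` from `P` to `cA` and `B` from `Q` to `cB` are linked in two ways: through `T ⊆
  -- E`, and through the segment `F` from `cA` to `cB`, so close to `c` that its image misses `E`.
  -- Level sets of the distance to `ψ(A)` below its minimum on `ψ(B)` miss both, so they contain a
  -- continuum joining `T` to `F`.
  set cA : V := (1 - ε) • c + ε • P with hcA
  set cB : V := (1 - ε) • c + ε • Q with hcB
  have hcAD : cA ∈ D := hD hc hP (by linarith) hε0.le (by ring)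
  have hcBD : cB ∈ D := hD hc hQ (by linarith) hε0.le (by ring)
  have hsA : segment ℝ P cA ⊆ D := hD.segment_subset hP hcAD
  have hsB : segment ℝ Q cB ⊆ D := hD.segment_subset hQ hcBD
  have hsF : segment ℝ cA cB ⊆ D := hD.segment_subset hcAD hcBD
  have hFball : segment ℝ cA cB ⊆ Metric.ball c δ := by
    refine (convex_ball c δ).segment_subset ?_ ?_
    · rw [Metric.mem_ball, dist_eq_norm, show cA - c = ε • (P - c) by rw [hcA]; module, norm_smul,
        Real.norm_of_nonneg hε0.le]
      refine lt_of_le_of_lt ?_ hεδ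
      gcongr
      rw [hN]
      linarith [norm_nonneg (Q - c)]
    · rw [Metric.mem_ball, dist_eq_norm, show cB - c = ε • (Q - c) by rw [hcB]; module, norm_smul,
        Real.norm_of_nonneg hε0.le]
      refine lt_of_le_of_lt ?_ hεδ
      gcongr
      rw [hN]
      linarith [norm_nonneg (P - c)]
  have hdisj : Disjoint (segment ℝ P cA) (segment ℝ Q cB) := by
    rw [Set.disjoint_left, segment_eq_image, segment_eq_image]
    rintro z ⟨s, hs, rfl⟩ ⟨s', hs', hss'⟩
    simp only at hss'
    -- Since `L` is equal at `P` and `Q` but not at `c`, it forces equal parameters on the two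
    -- segments; the points then differ by a positive multiple of `P - Q`.
    have h1 := congrArg L hss'
    simp only [hcA, hcB, map_add, map_smul, smul_eq_mul, ← hL] at h1
    have h2 : (s' - s) * ((1 - ε) * (L c - L P)) = 0 := by linear_combination h1
    have h3 : s' = s := by
      rcases mul_eq_zero.1 h2 with h | h
      · linarith
      · rcases mul_eq_zero.1 h with h | h
        · linarith
        · exact absurd (sub_eq_zero.1 h) hLc
    subst h3
    have h4 : (1 - s' + s' * ε) • (P - Q) = 0 := by
      rw [← sub_eq_zero] at hss'
      rw [← neg_eq_zero, ← hss', hcA, hcB]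
      module
    rcases smul_eq_zero.1 h4 with h | h
    · nlinarith [hs.1, hs.2]
    · exact hPQ (sub_eq_zero.1 h)
  set A : Set D := (↑) ⁻¹' segment ℝ P cA with hA
  set B : Set D := (↑) ⁻¹' segment ℝ Q cB with hB
  set F : Set D := (↑) ⁻¹' segment ℝ cA cB with hF
  have hclosed : ∀ x y : V, IsClosed (segment ℝ x y) := fun x y => by
    rw [segment_eq_image]
    exact (isCompact_Icc.image (by fun_prop)).isClosed
  have hAc : IsClosed A := (hclosed _ _).preimage continuous_subtype_val
  have hBc : IsClosed B := (hclosed _ _).preimage continuous_subtype_val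
  have hFc : IsClosed F := (hclosed _ _).preimage continuous_subtype_val
  have hApre : IsPreconnected A :=
    isPreconnected_preimage_val (convex_segment _ _).isPreconnected hsA
  have hBpre : IsPreconnected B :=
    isPreconnected_preimage_val (convex_segment _ _).isPreconnected hsB
  have hFpre : IsPreconnected F :=
    isPreconnected_preimage_val (convex_segment _ _).isPreconnected hsF
  have hTpre : IsPreconnected (ψ ⁻¹' T) := by
    rw [← hemb.isInducing.isPreconnected_image, image_preimage_eq_of_subset hTr]
    exact hT
  have hPA : (⟨P, hP⟩ : D) ∈ A := left_mem_segment ℝ P cA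
  have hQB : (⟨Q, hQ⟩ : D) ∈ B := left_mem_segment ℝ Q cB
  have hAne : (ψ '' A).Nonempty := ⟨_, mem_image_of_mem _ hPA⟩
  have hψA : IsClosed (ψ '' A) := hemb.isClosedMap _ hAc
  obtain ⟨x₀, hx₀B, hmin⟩ := (hBc.isCompact.image hψ).exists_isMinOn ⟨_, mem_image_of_mem _ hQB⟩
    (f := fun x => Metric.infDist x (ψ '' A)) (Metric.continuous_infDist_pt _).continuousOn
  have hx₀A : x₀ ∉ ψ '' A := by
    rintro ⟨z, hz, rfl⟩
    obtain ⟨z', hz', hzz'⟩ := hx₀B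
    rw [hψi hzz'] at hz'
    exact Set.disjoint_left.1 hdisj hz hz'
  refine ⟨fun x => Metric.infDist x (ψ '' A), Metric.infDist x₀ (ψ '' A),
    Metric.lipschitz_infDist_pt _, (hψA.notMem_iff_infDist_pos hAne).1 hx₀A, fun t ht => ?_⟩
  have hzero : ∀ z ∈ A, Metric.infDist (ψ z) (ψ '' A) = 0 := fun z hz =>
    Metric.infDist_zero_of_mem (mem_image_of_mem _ hz)
  have hBt : ∀ z ∈ B, t < Metric.infDist (ψ z) (ψ '' A) := fun z hz =>
    ht.2.trans_le (hmin (mem_image_of_mem _ hz))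
  obtain ⟨S, hS1, hS2, hS3, ⟨x, hxS, hxT⟩, ⟨y, hyS, hyF⟩⟩ := exists_connected_level_subset
    (exists_lift_addCircle hD) (f := fun z => Metric.infDist (ψ z) (ψ '' A))
    ((Metric.continuous_infDist_pt _).comp hψ) (t := t) hPA hQB
    (fun z hz => by rw [hzero z hz]; exact ht.1.ne) (fun z hz => (hBt z hz).ne')
    (by rw [hzero _ hPA]; exact ht.1) (hBt _ hQB) (hTc.preimage hψ) hFc
    ((hApre.union _ hPA hPT hTpre).union _ (Or.inr hQT) hQB hBpre)
    ((hApre.union ⟨cA, hcAD⟩ (right_mem_segment ℝ P cA) (left_mem_segment ℝ cA cB) hFpre).union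
      ⟨cB, hcBD⟩ (Or.inr (right_mem_segment ℝ cA cB)) (right_mem_segment ℝ Q cB) hBpre)
  refine ⟨ψ '' S, image_subset_range _ _, hS1.image _ hψ.continuousOn, hS2.image hψ, ?_,
    ⟨_, mem_image_of_mem _ hxS, hTE hxT⟩, ⟨_, mem_image_of_mem _ hyS, hball y (hFball hyF)⟩⟩
  rintro _ ⟨z, hz, rfl⟩
  exact hS3 z hz

end PlanarConfiguration

section Surface

variable {X : Type*} [MetricSpace X]

/-- In a half-disk chart at `p` too small to contain `q`, the set `E` has a nondegenerate
subcontinuum through `p`; as `E` has empty interior, the chart also has a point outside `E` off the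
line through `P` and `Q`. -/
theorem exists_joining_level_sets [ChartedSpace (EuclideanHalfSpace 2) X] {E : Set X}
    (hE : IsClosed E) (hEc : IsPreconnected E) (hEi : interior E = ∅) (hEn : E.Nontrivial) :
    ∃ (D : Set X) (f : X → ℝ) (r : ℝ), IsCompact D ∧ LipschitzWith 1 f ∧ 0 < r ∧ ∀ t ∈ Ioo 0 r,
      ∃ K ⊆ D, IsConnected K ∧ IsCompact K ∧ (∀ x ∈ K, f x = t) ∧ (K ∩ E).Nonempty ∧
        (K \ E).Nonempty := by
  obtain ⟨p, hp, q, hq, hpq⟩ := hEn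
  let e := chartAt (EuclideanHalfSpace 2) p
  let P : EuclideanSpace ℝ (Fin 2) := (e p).1
  have hps : p ∈ e.source := mem_chart_source _ p
  obtain ⟨O, hO, hOt⟩ := isOpen_induced_iff.1 e.open_target
  have hPO : P ∈ O := by
    have : e p ∈ Subtype.val ⁻¹' O := by
      rw [hOt]
      exact e.map_source hps
    exact this
  obtain ⟨r₁, hr₁, hr₁O⟩ := Metric.nhds_basis_closedBall.mem_iff.1 (hO.mem_nhds hPO)
  obtain ⟨r, hr, hrr₁, hrq⟩ : ∃ r > 0, r ≤ r₁ ∧ (q ∈ e.source → r < dist (e q).1 P) := by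
    by_cases hqs : q ∈ e.source
    · have : 0 < dist (e q).1 P := dist_pos.2 fun h => hpq (e.injOn hps hqs (Subtype.ext h).symm)
      exact ⟨min r₁ (dist (e q).1 P / 2), by positivity, min_le_left _ _, fun _ =>
        (min_le_right _ _).trans_lt (by linarith)⟩
    · exact ⟨r₁, hr₁, le_rfl, fun h => absurd h hqs⟩
  let D : Set (EuclideanSpace ℝ (Fin 2)) := Metric.closedBall P r ∩ {z | 0 ≤ z 0}
  have hDconv : Convex ℝ D := (convex_closedBall P r).inter EuclideanHalfSpace.convex
  have hDcomp : IsCompact D := (isCompact_closedBall P r).inter_right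
    (isClosed_le continuous_const (by fun_prop))
  let j : D → EuclideanHalfSpace 2 := fun z => ⟨z, z.2.2⟩
  have hj : Continuous j := Continuous.subtype_mk continuous_subtype_val _
  have hjt : ∀ z, j z ∈ e.target := fun z => by
    rw [← hOt]
    exact hr₁O (Metric.closedBall_subset_closedBall hrr₁ z.2.1)
  let ψ : D → X := fun z => e.symm (j z)
  have hψ : Continuous ψ := e.continuousOn_symm.comp_continuous hj hjt
  have heψ : ∀ z, (e (ψ z)).1 = z := fun z => by
    simp only [ψ]
    rw [e.right_inv (hjt z)]
  have hψs : ∀ z, ψ z ∈ e.source := fun z => e.map_target (hjt z)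
  have hψi : Function.Injective ψ := fun z z' h => Subtype.ext (by rw [← heψ z, ← heψ z', h])
  have hψe : ∀ x ∈ e.source, ∀ hx : (e x).1 ∈ D, ψ ⟨(e x).1, hx⟩ = x := fun x hx _ =>
    e.left_inv hx
  have hopen : ∀ O' : Set (EuclideanSpace ℝ (Fin 2)), IsOpen O' →
      IsOpen (e.source ∩ e ⁻¹' (Subtype.val ⁻¹' O')) := fun O' hO' =>
    e.isOpen_inter_preimage (hO'.preimage continuous_subtype_val)
  have hpD : p ∈ interior (range ψ) := by
    refine mem_interior.2 ⟨_, ?_, hopen (Metric.ball P r) Metric.isOpen_ball, hps,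
      Metric.mem_ball_self hr⟩
    rintro x ⟨hxs, hx⟩
    exact ⟨⟨(e x).1, Metric.ball_subset_closedBall hx, (e x).2⟩, e.left_inv hxs⟩
  have hqD : q ∉ range ψ := by
    rintro ⟨z, rfl⟩
    have := hrq (hψs z)
    rw [heψ] at this
    exact absurd z.2.1 (not_le.2 this)
  have := isCompact_iff_compactSpace.1 hDcomp
  obtain ⟨T, hTs, hT, hTc, hpT, q', hq'T, hq'p⟩ := exists_connected_subset_inter hEc hE
    (isCompact_range hψ) hp hpD (fun h => hqD (h hq))
  obtain ⟨⟨Q, hQ⟩, hQq'⟩ := (hTs hq'T).2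
  have hPD : P ∈ D := ⟨Metric.mem_closedBall_self hr.le, (e p).2⟩
  have hPQ : P ≠ Q := by
    rintro rfl
    exact hq'p (hQq'.symm.trans (hψe p hps hPD))
  let v := Q - P
  let L : EuclideanSpace ℝ (Fin 2) →L[ℝ] ℝ :=
    v 1 • EuclideanSpace.proj (0 : Fin 2) - v 0 • EuclideanSpace.proj (1 : Fin 2)
  have hLz : ∀ z, L z = v 1 * z 0 - v 0 * z 1 := fun z => by simp [L]
  have hLPQ : L P = L Q := by
    simp only [hLz, v, PiLp.sub_apply]
    ring
  -- A point off the line in the half-disk shows that the open set searched below is nonempty even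
  -- if `P` is on the boundary; the directions `(1, 1)` and `(1, 0)` point into the half-plane.
  obtain ⟨c₀, hc₀D, hc₀r, hc₀L⟩ : ∃ c₀ : EuclideanSpace ℝ (Fin 2), 0 ≤ c₀ 0 ∧
      c₀ ∈ Metric.ball P r ∧ L c₀ ≠ L P := by
    have hP0 : 0 ≤ P 0 := (e p).2
    have aux : ∀ d : EuclideanSpace ℝ (Fin 2), 0 ≤ d 0 → L d ≠ 0 →
        ∃ c₀ : EuclideanSpace ℝ (Fin 2), 0 ≤ c₀ 0 ∧ c₀ ∈ Metric.ball P r ∧ L c₀ ≠ L P := by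
      intro d hd hLd
      have hτ : 0 < r / (2 * (‖d‖ + 1)) := by positivity
      refine ⟨P + (r / (2 * (‖d‖ + 1))) • d, ?_, ?_, ?_⟩
      · simp only [PiLp.add_apply, PiLp.smul_apply, smul_eq_mul]
        positivity
      · rw [Metric.mem_ball, dist_eq_norm, add_sub_cancel_left, norm_smul,
          Real.norm_of_nonneg hτ.le, div_mul_eq_mul_div, div_lt_iff₀ (by positivity)]
        nlinarith [norm_nonneg d]
      · rw [map_add, map_smul, smul_eq_mul]
        intro h
        rcases mul_eq_zero.1 (add_eq_left.1 h) with h | h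
        · exact hτ.ne' h
        · exact hLd h
    by_cases hv : v 1 = 0
    · refine aux !₂[1, 1] (by simp) ?_
      rw [hLz, hv]
      simp only [zero_mul, zero_sub, Matrix.cons_val_one, Matrix.cons_val_fin_one,
        mul_one, ne_eq, neg_eq_zero]
      intro hv0
      refine hPQ (sub_eq_zero.1 ?_).symm
      ext i
      fin_cases i
      · exact hv0
      · exact hv
    · refine aux !₂[1, 0] (by simp) ?_
      rw [hLz]
      simpa using hv
  obtain ⟨x, ⟨hxs, hx⟩, hxE⟩ : ∃ x ∈ e.source ∩ e ⁻¹' (Subtype.val ⁻¹'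
      (Metric.ball P r ∩ {z | L z ≠ L P})), x ∉ E := by
    by_contra! hcon
    have hsub := interior_maximal (s := E) hcon (hopen _ (Metric.isOpen_ball.inter
      (isOpen_ne_fun L.continuous continuous_const)))
    rw [hEi] at hsub
    have hc₀D' : c₀ ∈ D := ⟨Metric.ball_subset_closedBall hc₀r, hc₀D⟩
    refine hsub (a := ψ ⟨c₀, hc₀D'⟩) ⟨hψs _, ?_⟩
    change (e (ψ ⟨c₀, hc₀D'⟩)).1 ∈ Metric.ball P r ∩ {z | L z ≠ L P}
    rw [heψ]
    exact ⟨hc₀r, hc₀L⟩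
  have hxD : (e x).1 ∈ D := ⟨Metric.ball_subset_closedBall hx.1, (e x).2⟩
  obtain ⟨f, t, hf, ht, H⟩ := exists_joining_level_sets_of_embedding hDconv hDcomp hψ hψi hE
    (hTs.trans inter_subset_left) hT.isPreconnected hTc.isClosed (hTs.trans inter_subset_right)
    hPD hQ hxD (by rw [hψe p hps hPD]; exact hpT) (by rw [hQq']; exact hq'T)
    (by rw [hψe x hxs hxD]; exact hxE) hPQ L.toLinearMap hLPQ hx.2
  exact ⟨range ψ, f, t, isCompact_range hψ, hf, ht, H⟩

end Surface

open Filter Measure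

/-! ### Eilenberg's inequality -/

section Coarea

variable {X : Type*} [MetricSpace X] [MeasurableSpace X] [BorelSpace X]

/-- Slicing an almost optimal cover and integrating in `t` costs `diam · |f(A)| ≤ diam²` for each
set; Fatou's lemma gives the limit. The measurable majorant `G` avoids the question whether the
slice measure is measurable in `t`. -/
theorem exists_coarea_bound_set {f : X → ℝ} (hf : LipschitzWith 1 f) (S : Set X) :
    ∃ G : ℝ → ℝ≥0∞, Measurable G ∧ ∫⁻ t, G t ≤ μH[2] S ∧ ∀ t, μH[1] (S ∩ f ⁻¹' {t}) ≤ G t := by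
  rcases eq_or_ne (μH[2] S) ∞ with hS | hS
  · exact ⟨fun _ => ∞, measurable_const, by simp [hS], fun t => le_top⟩
  have hcov : ∀ n : ℕ, ∃ A : ℕ → Set X, S ⊆ ⋃ i, A i ∧
      (∀ i, Metric.ediam (A i) ≤ (n + 1 : ℝ≥0∞)⁻¹) ∧
      ∑' i, Metric.ediam (A i) ^ (2 : ℝ) ≤ μH[2] S + (n + 1 : ℝ≥0∞)⁻¹ := by
    intro n
    have hn : (0 : ℝ≥0∞) < (n + 1 : ℝ≥0∞)⁻¹ := by simp
    have h1 := hausdorffMeasure_apply (X := X) 2 S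
    have h2 : (⨅ (A : ℕ → Set X) (_ : S ⊆ ⋃ i, A i)
        (_ : ∀ i, Metric.ediam (A i) ≤ (n + 1 : ℝ≥0∞)⁻¹),
        ∑' i, ⨆ _ : (A i).Nonempty, Metric.ediam (A i) ^ (2 : ℝ)) <
          μH[2] S + (n + 1 : ℝ≥0∞)⁻¹ := by
      refine lt_of_le_of_lt ?_ (ENNReal.lt_add_right hS hn.ne')
      rw [h1]
      exact le_iSup₂ (α := ℝ≥0∞) (f := fun r (_ : 0 < r) => ⨅ (A : ℕ → Set X) (_ : S ⊆ ⋃ i, A i)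
        (_ : ∀ i, Metric.ediam (A i) ≤ r),
        ∑' i, ⨆ _ : (A i).Nonempty, Metric.ediam (A i) ^ (2 : ℝ)) _ hn
    simp only [iInf_lt_iff] at h2
    obtain ⟨A, hA, hd, hlt⟩ := h2
    refine ⟨A, hA, hd, le_trans (ENNReal.tsum_le_tsum fun i => ?_) hlt.le⟩
    rcases (A i).eq_empty_or_nonempty with h | h
    · simp [h]
    · simp [h]
  choose A hA hd hsum using hcov
  let I : ℕ → ℕ → Set ℝ := fun n i => closure (f '' A n i)
  have hI : ∀ n i, volume (I n i) ≤ Metric.ediam (A n i) := fun n i => by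
    refine (Real.volume_le_diam _).trans ?_
    rw [Metric.ediam_closure]
    simpa using hf.ediam_image_le (A n i)
  have hIm : ∀ n i, MeasurableSet (I n i) := fun n i => isClosed_closure.measurableSet
  let g : ℕ → ℝ → ℝ≥0∞ := fun n t =>
    ∑' i, (I n i).indicator (fun _ => Metric.ediam (A n i)) t
  have hg : ∀ n, Measurable (g n) := fun n =>
    Measurable.tsum fun i => measurable_const.indicator (hIm n i)
  have htend : Tendsto (fun n : ℕ => (n + 1 : ℝ≥0∞)⁻¹) atTop (𝓝 0) := by
    have := ENNReal.tendsto_inv_nat_nhds_zero.comp (tendsto_add_atTop_nat 1)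
    simpa [Function.comp_def] using this
  refine ⟨fun t => liminf (fun n => g n t) atTop, .liminf hg, ?_, fun t => ?_⟩
  · refine (lintegral_liminf_le hg).trans ?_
    have hgn : ∀ n, ∫⁻ t, g n t ≤ μH[2] S + (n + 1 : ℝ≥0∞)⁻¹ := by
      intro n
      rw [lintegral_tsum fun i => (measurable_const.indicator (hIm n i)).aemeasurable]
      refine le_trans (ENNReal.tsum_le_tsum fun i => ?_) (hsum n)
      rw [lintegral_indicator_const (hIm n i)]
      calc Metric.ediam (A n i) * volume (I n i)
          ≤ Metric.ediam (A n i) * Metric.ediam (A n i) := by gcongr; exact hI n i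
        _ = Metric.ediam (A n i) ^ (2 : ℝ) := by norm_num [sq]
    refine (liminf_le_liminf (Eventually.of_forall hgn)).trans (le_of_eq ?_)
    have := (tendsto_const_nhds (x := μH[2] S)).add htend
    rw [add_zero] at this
    exact this.liminf_eq
  · refine le_trans (hausdorffMeasure_le_liminf_tsum 1 _ (l := atTop) _ htend
      (fun n i => A n i ∩ f ⁻¹' {t}) ?_ ?_) (liminf_le_liminf (Eventually.of_forall fun n => ?_))
    · exact Eventually.of_forall fun n i => (Metric.ediam_mono inter_subset_left).trans (hd n i)
    · refine Eventually.of_forall fun n => ?_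
      rw [← iUnion_inter]
      exact inter_subset_inter_left _ (hA n)
    · refine ENNReal.tsum_le_tsum fun i => ?_
      rw [ENNReal.rpow_one]
      rcases (A n i ∩ f ⁻¹' {t}).eq_empty_or_nonempty with h | ⟨x, hx, hxt⟩
      · simp [h]
      · rw [indicator_of_mem (show t ∈ I n i from subset_closure ⟨x, hx, hxt⟩)]
        exact Metric.ediam_mono inter_subset_left

/-- Eilenberg's inequality. -/
theorem exists_coarea_bound {f : X → ℝ} (hf : LipschitzWith 1 f) {ρ : X → ℝ≥0∞}
    (hρ : Measurable ρ) :
    ∃ G : ℝ → ℝ≥0∞, Measurable G ∧ ∫⁻ t, G t ≤ ∫⁻ x, ρ x ∂μH[2] ∧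
      ∀ t, ∫⁻ x in f ⁻¹' {t}, ρ x ∂μH[1] ≤ G t := by
  refine Measurable.ennreal_induction (motive := fun ρ => ∃ G : ℝ → ℝ≥0∞, Measurable G ∧
    ∫⁻ t, G t ≤ ∫⁻ x, ρ x ∂μH[2] ∧ ∀ t, ∫⁻ x in f ⁻¹' {t}, ρ x ∂μH[1] ≤ G t) ?_ ?_ ?_ hρ
  · intro c S hS
    obtain ⟨G, hG, h1, h2⟩ := exists_coarea_bound_set hf S
    refine ⟨fun t => c * G t, hG.const_mul c, ?_, fun t => ?_⟩
    · rw [lintegral_const_mul _ hG, lintegral_indicator_const hS]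
      exact mul_le_mul' le_rfl h1
    · rw [lintegral_indicator_const hS, restrict_apply hS]
      exact mul_le_mul' le_rfl (h2 t)
  · rintro u v - hu hv ⟨F, hFm, h1, h2⟩ ⟨G, hGm, h3, h4⟩
    refine ⟨F + G, hFm.add hGm, ?_, fun t => ?_⟩
    · simp only [Pi.add_apply]
      rw [lintegral_add_left hFm, lintegral_add_left hu]
      gcongr
    · simp only [Pi.add_apply]
      rw [lintegral_add_left hu]
      exact add_le_add (h2 t) (h4 t)
  · intro F hFm hF ih
    choose G hGm h1 h2 using ih
    refine ⟨fun t => liminf (fun n => G n t) atTop, .liminf hGm, ?_, fun t => ?_⟩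
    · refine (lintegral_liminf_le hGm).trans ?_
      refine (liminf_le_liminf (Eventually.of_forall h1)).trans ?_
      refine (liminf_le_liminf (Eventually.of_forall fun n =>
        lintegral_mono (le_iSup F n))).trans ?_
      simp [liminf_const]
    · rw [lintegral_iSup hFm hF]
      refine iSup_le fun n => le_liminf_of_le (by isBoundedDefault) ?_
      filter_upwards [eventually_ge_atTop n] with m hm
      exact (lintegral_mono (hF hm)).trans (h2 m t)

end Coarea

/-! ### Chains of small steps -/

section ChainDistance

/-- `ChainTo ε x y L` means that there is a finite chain from `x` to `y` of total length `L` all of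
whose steps are shorter than `ε`. -/
inductive ChainTo {Z : Type*} [MetricSpace Z] (ε : ℝ) (x : Z) : Z → ℝ≥0 → Prop
  | nil : ChainTo ε x x 0
  | snoc {y z : Z} {L : ℝ≥0} : ChainTo ε x y L → dist y z < ε → ChainTo ε x z (L + nndist y z)

variable {Z : Type*} [MetricSpace Z] {ε ε' : ℝ} {x y z : Z} {L L' : ℝ≥0}

theorem ChainTo.trans (h : ChainTo ε x y L) (h' : ChainTo ε y z L') : ChainTo ε x z (L + L') := by
  induction h' with
  | nil => simpa using h
  | snoc _ hd ih => rw [← add_assoc]; exact ih.snoc hd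

/-- The infimum of the lengths of the chains from `x` to `y` with steps shorter than `ε`. -/
def chainDist (ε : ℝ) (x y : Z) : ℝ≥0∞ := ⨅ (L : ℝ≥0) (_ : ChainTo ε x y L), (L : ℝ≥0∞)

theorem ChainTo.chainDist_le (h : ChainTo ε x y L) : chainDist ε x y ≤ L := iInf₂_le L h

theorem chainDist_self : chainDist ε x x = 0 := by
  simpa using (ChainTo.nil (ε := ε) (x := x)).chainDist_le

theorem chainDist_triangle : chainDist ε x z ≤ chainDist ε x y + chainDist ε y z := by
  simp only [chainDist, ENNReal.iInf_add, ENNReal.add_iInf]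
  refine le_iInf₂ fun L' h' => le_iInf₂ fun L h => ?_
  exact_mod_cast (h.trans h').chainDist_le

theorem chainDist_le_add_edist (h : dist y z < ε) :
    chainDist ε x z ≤ chainDist ε x y + edist y z := by
  simp only [chainDist, ENNReal.iInf_add]
  refine le_iInf₂ fun L h' => ?_
  rw [edist_nndist]
  exact_mod_cast (h'.snoc h).chainDist_le

theorem chainDist_ne_top [PreconnectedSpace Z] (hε : 0 < ε) : chainDist ε x y ≠ ∞ := by
  have key : ∀ p q : Z, dist p q < ε → chainDist ε x p ≠ ∞ → chainDist ε x q ≠ ∞ := fun p q h hp =>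
    ((chainDist_le_add_edist h).trans_lt
      (ENNReal.add_lt_top.2 ⟨hp.lt_top, edist_lt_top _ _⟩)).ne
  have hcl : IsClopen {q | chainDist ε x q ≠ ∞} := by
    refine ⟨⟨?_⟩, ?_⟩
    · rw [Metric.isOpen_iff]
      refine fun p hp => ⟨ε, hε, fun q hq hq' => hp (key q p hq hq')⟩
    · rw [Metric.isOpen_iff]
      exact fun p hp => ⟨ε, hε, fun q hq => key p q (by rwa [dist_comm]) hp⟩
  have := hcl.eq_univ ⟨x, by simp [chainDist_self]⟩
  exact this.ge (mem_univ y)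

/-- The chain as a step function of accumulated length; a jump costs at most `ε`. -/
theorem ChainTo.exists_map (h : ChainTo ε x y L) (hε : 0 < ε) : ∃ c : ℝ → Z,
    (∀ s ≤ 0, c s = x) ∧ (∀ t, (L : ℝ) ≤ t → c t = y) ∧ (∀ s ≤ (L : ℝ), dist (c s) y ≤ L - s) ∧
    ∀ s t, s ≤ t → dist (c s) (c t) ≤ t - s + ε := by
  induction h with
  | nil =>
    refine ⟨fun _ => x, fun _ _ => rfl, fun _ _ => rfl, fun s hs => ?_, fun s t hst => ?_⟩
    · simpa using hs
    · rw [dist_self]; linarith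
  | @snoc y z L _ hd ih =>
    obtain ⟨c, h0, h1, h2, h3⟩ := ih
    have hyz : c L = y := h1 L le_rfl
    have hL : (0 : ℝ) ≤ L := L.2
    have hd0 : 0 ≤ dist y z := dist_nonneg
    refine ⟨fun t => if t ≤ L then c t else z, fun s hs => ?_, fun t ht => ?_, fun s hs => ?_,
      fun s t hst => ?_⟩
    · simp only [hs.trans hL, if_true, h0 s hs]
    · rw [NNReal.coe_add, coe_nndist] at ht
      dsimp only
      split_ifs with htL
      · have h4 : dist y z = 0 := by linarith
        rw [h1 t (by linarith), dist_eq_zero.1 h4]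
      · rfl
    · rw [NNReal.coe_add, coe_nndist] at hs ⊢
      dsimp only
      split_ifs with hsL
      · linarith [dist_triangle (c s) y z, h2 s hsL]
      · rw [dist_self]; linarith
    · dsimp only
      split_ifs with hsL htL htL
      · exact h3 s t hst
      · push Not at htL
        linarith [dist_triangle (c s) y z, h2 s hsL]
      · exact absurd (hst.trans htL) hsL
      · rw [dist_self]; linarith

variable [MeasurableSpace Z] [BorelSpace Z]

theorem hausdorffMeasure_image_le_of_locally [SecondCountableTopology Z] {u : Z → ℝ} (hε : 0 < ε)
    (hu : ∀ p q, dist p q < ε → dist (u p) (u q) ≤ dist p q) (C : Set Z) :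
    μH[1] (u '' C) ≤ μH[1] C := by
  rcases isEmpty_or_nonempty Z with hZ | hZ
  · simp [eq_empty_of_isEmpty C]
  let B : ℕ → Set Z := disjointed fun n => Metric.ball (TopologicalSpace.denseSeq Z n) (ε / 2)
  have hBm : ∀ n, MeasurableSet (B n) := .disjointed fun n => measurableSet_ball
  have hBU : ⋃ n, B n = univ := by
    rw [iUnion_disjointed]
    refine eq_univ_of_forall fun p => ?_
    obtain ⟨n, hn⟩ := (TopologicalSpace.denseRange_denseSeq Z).exists_dist_lt p (half_pos hε)
    exact mem_iUnion.2 ⟨n, hn⟩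
  have hlip : ∀ n, LipschitzOnWith 1 u (C ∩ B n) := fun n => by
    refine LipschitzOnWith.of_dist_le_mul fun p hp q hq => ?_
    rw [NNReal.coe_one, one_mul]
    refine hu p q ?_
    have hBn : B n ⊆ Metric.ball (TopologicalSpace.denseSeq Z n) (ε / 2) := disjointed_subset _ n
    have h1 := Metric.mem_ball.1 (hBn hp.2)
    have h2 := Metric.mem_ball.1 (hBn hq.2)
    have := dist_triangle_right p q (TopologicalSpace.denseSeq Z n)
    linarith
  have hC : C = ⋃ n, C ∩ B n := by rw [← inter_iUnion, hBU, inter_univ]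
  calc μH[1] (u '' C) = μH[1] (⋃ n, u '' (C ∩ B n)) := by rw [← image_iUnion, ← hC]
    _ ≤ ∑' n, μH[1] (u '' (C ∩ B n)) := measure_iUnion_le _
    _ ≤ ∑' n, μH[1] (C ∩ B n) := ENNReal.tsum_le_tsum fun n => by
        simpa using (hlip n).hausdorffMeasure_image_le (d := 1) zero_le_one
    _ = ∑' n, (μH[1] : Measure Z).restrict C (B n) := by
        congr 1 with n
        rw [restrict_apply (hBm n), inter_comm]
    _ = μH[1] C := by
        rw [← measure_iUnion (disjoint_disjointed _) hBm, hBU, restrict_apply_univ]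

/-- The chain distance from `p` is `1`-Lipschitz at scale `ε`, so it does not increase `ℋ¹`, and it
maps the connected set `C` onto a set containing `[0, chainDist ε p q]`. -/
theorem chainDist_le_hausdorffMeasure [PreconnectedSpace Z] [SecondCountableTopology Z]
    (hε : 0 < ε) {C : Set Z} (hC : IsPreconnected C) {p q : Z} (hp : p ∈ C) (hq : q ∈ C) :
    chainDist ε p q ≤ μH[1] C := by
  let u : Z → ℝ := fun z => (chainDist ε p z).toReal
  have hu1 : ∀ a b, dist a b < ε → u b ≤ u a + dist a b := fun a b hab => by
    have := ENNReal.toReal_mono (by simp [chainDist_ne_top hε, edist_ne_top])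
      (chainDist_le_add_edist (x := p) hab)
    rwa [ENNReal.toReal_add (chainDist_ne_top hε) (edist_ne_top _ _), ← dist_edist] at this
  have hu : ∀ a b, dist a b < ε → dist (u a) (u b) ≤ dist a b := fun a b hab => by
    rw [Real.dist_eq, abs_sub_le_iff]
    have h1 := hu1 a b hab
    have h2 := hu1 b a (by rwa [dist_comm])
    rw [dist_comm b a] at h2
    constructor <;> linarith
  have huc : Continuous u := by
    refine Metric.continuous_iff.2 fun a δ hδ => ⟨min ε δ, lt_min hε hδ, fun b hb => ?_⟩
    exact (hu b a (hb.trans_le (min_le_left _ _))).trans_lt (hb.trans_le (min_le_right _ _))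
  have hup : u p = 0 := by simp [u, chainDist_self]
  have hsub : Icc 0 (u q) ⊆ u '' C := by
    rw [← hup]
    exact (hC.image u huc.continuousOn).Icc_subset (mem_image_of_mem _ hp) (mem_image_of_mem _ hq)
  calc chainDist ε p q = ENNReal.ofReal (u q) := (ENNReal.ofReal_toReal (chainDist_ne_top hε)).symm
    _ = volume (Icc 0 (u q)) := by simp
    _ ≤ volume (u '' C) := measure_mono hsub
    _ = μH[1] (u '' C) := by rw [hausdorffMeasure_real]
    _ ≤ μH[1] C := hausdorffMeasure_image_le_of_locally hε hu C

end ChainDistance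

/-! ### Shortest curves in continua of finite length -/

section Geodesic

variable {Z : Type*} [MetricSpace Z]

/-- The restriction of a continuous map on the real line to `[0, l]`. -/
def Curve.ofReal {γ : ℝ → Z} (hγ : Continuous γ) {l : ℝ} (hl : 0 ≤ l) : Curve Z :=
  ⟨0, l, hl, ⟨fun u => γ u, hγ.comp continuous_subtype_val⟩⟩

theorem Curve.ofReal_eVariationOn_le {γ : ℝ → Z} (hγ : LipschitzWith 1 γ) {l : ℝ} (hl : 0 ≤ l)
    {a b : ℝ} (hab : a ≤ b) :
    eVariationOn (Curve.ofReal hγ.continuous hl).ext (Icc a b) ≤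
      volume.restrict (Icc 0 l) (Ioc a b) := by
  let P : ℝ → ℝ := fun u => projIcc 0 l hl u
  have hP : Monotone P := fun u v huv => monotone_projIcc hl huv
  have h1 : (Curve.ofReal hγ.continuous hl).ext = γ ∘ P := rfl
  rw [h1]
  have h2 := (hγ.lipschitzOnWith (s := univ)).comp_eVariationOn_le (f := γ) (g := P)
    (s := Icc a b) (fun _ _ => mem_univ _)
  refine h2.trans ?_
  rw [ENNReal.coe_one, one_mul]
  have h3 := (hP.monotoneOn (Icc a b)).eVariationOn_eq (left_mem_Icc.2 hab) (right_mem_Icc.2 hab)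
  rw [inter_self] at h3
  rw [h3]
  rw [Measure.restrict_apply measurableSet_Ioc, ← Real.volume_Ioc]
  refine measure_mono fun u hu => ?_
  simp only [P, coe_projIcc, mem_Ioc, max_lt_iff, le_max_iff, le_min_iff,
    min_lt_iff] at hu
  simp only [mem_inter_iff, mem_Ioc, mem_Icc]
  rcases hu with ⟨⟨h3, h4⟩, h5⟩
  rcases h5 with h5 | ⟨h5, h6⟩
  · exact absurd h3 (not_lt.2 h5)
  · refine ⟨⟨?_, h6⟩, h3.le, h5⟩
    rcases h4 with h4 | h4
    · exact absurd h5 (not_le.2 h4)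
    · exact h4

theorem Curve.ofReal_rectifiable {γ : ℝ → Z} (hγ : LipschitzWith 1 γ) {l : ℝ} (hl : 0 ≤ l) :
    (Curve.ofReal hγ.continuous hl).Rectifiable := by
  rw [Curve.Rectifiable, ← Curve.eVariationOn_ext]
  let P : ℝ → ℝ := fun u => projIcc 0 l hl u
  have hP : Monotone P := fun u v huv => monotone_projIcc hl huv
  have h1 : BoundedVariationOn P univ := (hP.monotoneOn univ).boundedVariationOn (C := l)
    fun u _ => by
      rw [abs_of_nonneg (projIcc 0 l hl u).2.1]
      exact (projIcc 0 l hl u).2.2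
  exact hγ.comp_boundedVariationOn h1

theorem Curve.lineIntegral_ofReal_le [MeasurableSpace Z] [BorelSpace Z] {γ : ℝ → Z}
    (hγ : LipschitzWith 1 γ) {l : ℝ} (hl : 0 ≤ l)
    {ρ : Z → ℝ≥0∞} (hρ : Measurable ρ) :
    (Curve.ofReal hγ.continuous hl).lineIntegral ρ ≤ ∫⁻ u in Icc 0 l, ρ (γ u) := by
  have hr := Curve.ofReal_rectifiable hγ hl
  rw [Curve.lineIntegral_eq_lintegral hr hρ]
  have hle : (Curve.ofReal hγ.continuous hl).lengthMeasure ≤ volume.restrict (Icc 0 l) := by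
    refine measure_le_of_Ioc_le fun a b hab => ?_
    rw [Curve.lengthMeasure_Ioc_eq_eVariationOn hr hab.le]
    exact Curve.ofReal_eVariationOn_le hγ hl hab.le
  refine (lintegral_mono' hle le_rfl).trans (le_of_eq ?_)
  refine setLIntegral_congr_fun measurableSet_Icc fun u hu => ?_
  change ρ (γ (projIcc 0 l hl u)) = _
  rw [projIcc_of_mem hl hu]

/-- Ultralimit of almost shortest chains with steps tending to zero: compactness gives a limit at
every parameter, and the jumps disappear. -/
theorem exists_lipschitz_of_chainDist [CompactSpace Z] {x y : Z} {l : ℝ≥0}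
    (hl : ∀ ε > 0, chainDist ε x y ≤ l) :
    ∃ γ : ℝ → Z, LipschitzWith 1 γ ∧ γ 0 = x ∧ γ l = y := by
  have hε : ∀ n : ℕ, (0 : ℝ) < 1 / (n + 1) := fun n => by positivity
  have hch : ∀ n : ℕ, ∃ L : ℝ≥0, ChainTo (1 / (n + 1)) x y L ∧ (L : ℝ) ≤ l + 1 / (n + 1) := by
    intro n
    have h1 : chainDist (1 / (n + 1) : ℝ) x y < (l + Real.toNNReal (1 / (n + 1)) : ℝ≥0) := by
      refine (hl _ (hε n)).trans_lt ?_
      rw [ENNReal.coe_lt_coe]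
      exact lt_add_of_pos_right _ (Real.toNNReal_pos.2 (hε n))
    simp only [chainDist, iInf_lt_iff] at h1
    obtain ⟨L, hL, hlt⟩ := h1
    refine ⟨L, hL, ?_⟩
    rw [ENNReal.coe_lt_coe, ← NNReal.coe_lt_coe, NNReal.coe_add,
      Real.coe_toNNReal _ (hε n).le] at hlt
    exact hlt.le
  choose L hL hLl using hch
  choose c h0 h1 h2 h3 using fun n => (hL n).exists_map (hε n)
  let U : Ultrafilter ℕ := hyperfilter ℕ
  have hU : (U : Filter ℕ) ≤ atTop := Nat.hyperfilter_le_atTop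
  have hz : Tendsto (fun n : ℕ => (1 : ℝ) / (n + 1)) U (𝓝 0) :=
    tendsto_one_div_add_atTop_nhds_zero_nat.mono_left hU
  have hlim : ∀ t : ℝ, ∃ z, Tendsto (fun n => c n t) U (𝓝 z) := fun t =>
    ⟨_, (U.map fun n => c n t).le_nhds_lim⟩
  choose γ hγ using hlim
  refine ⟨γ, LipschitzWith.of_dist_le_mul fun s t => ?_, ?_, ?_⟩
  · rw [NNReal.coe_one, one_mul]
    wlog hst : s ≤ t generalizing s t
    · rw [dist_comm, dist_comm s]
      exact this t s (le_of_not_ge hst)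
    have h4 : Tendsto (fun n : ℕ => t - s + 1 / ((n : ℝ) + 1)) U (𝓝 (t - s + 0)) :=
      tendsto_const_nhds.add hz
    refine (le_of_tendsto_of_tendsto ((hγ s).dist (hγ t)) h4
      (Eventually.of_forall fun n => h3 n s t hst)).trans ?_
    rw [add_zero, dist_comm, Real.dist_eq]
    exact le_abs_self _
  · refine tendsto_nhds_unique (hγ 0) ?_
    simp only [h0 _ 0 le_rfl]
    exact tendsto_const_nhds
  · refine tendsto_nhds_unique (hγ l) ?_
    refine tendsto_iff_dist_tendsto_zero.2 (squeeze_zero (fun _ => dist_nonneg) (fun n => ?_) hz)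
    rcases le_total (l : ℝ) (L n) with h | h
    · linarith [h2 n l h, hLl n]
    · rw [h1 n l h, dist_self]
      exact (hε n).le

/-- The curve realizes the limit `l` of the chain distances as `ε → 0`. Being shortest, it is
injective and each arc has `ℋ¹` at least its parameter length, so integrals along it are bounded by
integrals against `ℋ¹`. -/
theorem exists_curve_lineIntegral_le_lintegral_hausdorffMeasure [CompactSpace Z]
    [PreconnectedSpace Z] [MeasurableSpace Z] [BorelSpace Z] (hZ : μH[1] (univ : Set Z) ≠ ∞)
    (x y : Z) :
    ∃ γ : Curve Z, γ.source = x ∧ γ.target = y ∧ γ.Rectifiable ∧ ∀ ρ : Z → ℝ≥0∞, Measurable ρ →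
      γ.lineIntegral ρ ≤ ∫⁻ z, ρ z ∂μH[1] := by
  let l : ℝ≥0 := (⨆ (ε : ℝ) (_ : 0 < ε), chainDist ε x y).toNNReal
  have hl : (l : ℝ≥0∞) = ⨆ (ε : ℝ) (_ : 0 < ε), chainDist ε x y :=
    ENNReal.coe_toNNReal (ne_top_of_le_ne_top hZ (iSup₂_le fun ε hε =>
      chainDist_le_hausdorffMeasure hε isPreconnected_univ (mem_univ _) (mem_univ _)))
  obtain ⟨γ, hγ, hγ0, hγl⟩ := exists_lipschitz_of_chainDist (x := x) (y := y) (l := l)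
    fun ε hε => hl ▸ le_iSup₂ (f := fun (ε : ℝ) (_ : 0 < ε) => chainDist ε x y) ε hε
  have hcd : ∀ ε > 0, ∀ a b, a ≤ b → chainDist ε (γ a) (γ b) ≤ ENNReal.ofReal (b - a) := by
    intro ε hε a b hab
    refine (chainDist_le_hausdorffMeasure hε (isPreconnected_Icc.image γ hγ.continuous.continuousOn)
      (mem_image_of_mem _ (left_mem_Icc.2 hab)) (mem_image_of_mem _ (right_mem_Icc.2 hab))).trans ?_
    have := hγ.hausdorffMeasure_image_le (d := 1) zero_le_one (Icc a b)
    simpa [hausdorffMeasure_real] using this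
  -- A shortcut between `γ a` and `γ b` would bring the chain distance from `x` to `y` below `l`.
  have hgeo : ∀ (a b : ℝ) (c : ℝ≥0∞), 0 ≤ a → a ≤ b → b ≤ l →
      (∀ ε > 0, chainDist ε (γ a) (γ b) ≤ c) → ENNReal.ofReal (b - a) ≤ c := by
    intro a b c ha hab hb hc
    have h1 : (l : ℝ≥0∞) ≤ ENNReal.ofReal a + c + ENNReal.ofReal (l - b) := by
      rw [hl]
      refine iSup₂_le fun ε hε => ?_
      calc chainDist ε x y ≤ chainDist ε x (γ a) + chainDist ε (γ a) (γ b) + chainDist ε (γ b) y :=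
            chainDist_triangle.trans (by gcongr; exact chainDist_triangle)
        _ ≤ _ := by
          gcongr
          · simpa [hγ0] using hcd ε hε 0 a ha
          · exact hc ε hε
          · rw [← hγl]
            exact hcd ε hε b l hb
    rcases eq_or_ne c ∞ with rfl | hc'
    · exact le_top
    lift c to ℝ≥0 using hc'
    rw [ENNReal.ofReal, ENNReal.ofReal, ← ENNReal.coe_add, ← ENNReal.coe_add, ENNReal.coe_le_coe,
      ← NNReal.coe_le_coe, NNReal.coe_add, NNReal.coe_add, Real.coe_toNNReal _ ha,
      Real.coe_toNNReal _ (sub_nonneg.2 hb)] at h1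
    rw [ENNReal.ofReal, ENNReal.coe_le_coe, ← NNReal.coe_le_coe, Real.coe_toNNReal _ (by linarith)]
    linarith
  refine ⟨Curve.ofReal hγ.continuous l.2, hγ0, hγl, Curve.ofReal_rectifiable hγ l.2,
    fun ρ hρ => (Curve.lineIntegral_ofReal_le hγ l.2 hρ).trans ?_⟩
  let e : Icc (0 : ℝ) l → Z := fun u => γ u
  have hec : Continuous e := hγ.continuous.comp continuous_subtype_val
  have hinj : Function.Injective e := by
    intro u v huv
    wlog h : u ≤ v generalizing u v
    · exact (this huv.symm (le_of_not_ge h)).symm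
    have := hgeo u v 0 u.2.1 h v.2.2 fun ε hε => by
      rw [show γ u = γ v from huv, chainDist_self]
    rw [nonpos_iff_eq_zero, ENNReal.ofReal_eq_zero, sub_nonpos] at this
    exact le_antisymm h this
  have hemb : MeasurableEmbedding e := (hec.isClosedEmbedding hinj).measurableEmbedding
  let ν : Measure ℝ := ((μH[1] : Measure Z).comap e).map Subtype.val
  have hν : ∀ S : Set ℝ, MeasurableSet S → ν S = μH[1] (e '' (Subtype.val ⁻¹' S)) := fun S hS => by
    rw [Measure.map_apply measurable_subtype_coe hS, hemb.comap_apply]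
  have : IsFiniteMeasure ν := ⟨by
    rw [hν _ MeasurableSet.univ]
    exact (measure_mono (subset_univ _)).trans_lt hZ.lt_top⟩
  have hle : volume.restrict (Icc (0 : ℝ) l) ≤ ν := by
    refine measure_le_of_Ioc_le fun a b hab => ?_
    have h0 : ν {a} = 0 := by
      rw [hν _ (measurableSet_singleton a)]
      have := nullSingletonClass_hausdorff Z one_pos
      refine Set.Subsingleton.measure_zero (Set.Subsingleton.image ?_ _) _
      exact fun u hu v hv => Subtype.ext (hu.trans hv.symm)
    have h1 : ν (Icc a b) ≤ ν (Ioc a b) := by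
      rw [← Ioc_union_left hab.le]
      exact (measure_union_le _ _).trans (by rw [h0, add_zero])
    refine le_trans ?_ h1
    rw [Measure.restrict_apply measurableSet_Ioc]
    have hsub : Ioc a b ∩ Icc 0 (l : ℝ) ⊆ Icc (max a 0) (min b l) := fun u hu =>
      ⟨max_le hu.1.1.le hu.2.1, le_min hu.1.2 hu.2.2⟩
    refine (measure_mono hsub).trans ?_
    rw [Real.volume_Icc]
    rcases le_or_gt (max a 0) (min b l) with h | h
    · refine (hgeo _ _ (μH[1] (γ '' Icc (max a 0) (min b l))) (le_max_right _ _) h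
        (min_le_right _ _) fun ε hε => chainDist_le_hausdorffMeasure hε
          (isPreconnected_Icc.image γ hγ.continuous.continuousOn)
          (mem_image_of_mem _ (left_mem_Icc.2 h)) (mem_image_of_mem _ (right_mem_Icc.2 h))).trans ?_
      rw [hν _ measurableSet_Icc]
      refine measure_mono ?_
      rintro _ ⟨u, hu, rfl⟩
      exact ⟨⟨u, (le_max_right _ _).trans hu.1, hu.2.trans (min_le_right _ _)⟩,
        ⟨(le_max_left _ _).trans hu.1, hu.2.trans (min_le_left _ _)⟩, rfl⟩
    · rw [ENNReal.ofReal_of_nonpos (by linarith)]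
      exact zero_le
  calc ∫⁻ u in Icc (0 : ℝ) l, ρ (γ u) ≤ ∫⁻ u, ρ (γ u) ∂ν := lintegral_mono' hle le_rfl
    _ = ∫⁻ u, ρ (e u) ∂((μH[1] : Measure Z).comap e) :=
      lintegral_map (hρ.comp hγ.continuous.measurable) measurable_subtype_coe
    _ = ∫⁻ z in range e, ρ z ∂μH[1] := by
      rw [← hemb.map_comap, lintegral_map hρ hec.measurable]
    _ ≤ ∫⁻ z, ρ z ∂μH[1] := setLIntegral_le_lintegral _ _

end Geodesic

/-! ### Finite upper density almost everywhere -/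

section Density

variable {Y : Type*} [MetricSpace Y] [MeasurableSpace Y] [BorelSpace Y]

/-- The upper density of a locally finite measure is finite `ℋ²`-almost everywhere. -/
theorem ae_exists_measure_closedBall_le [SecondCountableTopology Y] (μ : Measure Y)
    [IsLocallyFiniteMeasure μ] :
    ∀ᵐ y ∂(μH[2] : Measure Y), ∃ (n : ℕ) (r₀ : ℝ), 0 < r₀ ∧ ∀ r, 0 < r → r ≤ r₀ →
      μ (Metric.closedBall y r) ≤ (n + 1) * ENNReal.ofReal r ^ 2 := by
  rw [ae_iff]
  set N := {y | ¬ ∃ (n : ℕ) (r₀ : ℝ), 0 < r₀ ∧ ∀ r, 0 < r → r ≤ r₀ →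
      μ (Metric.closedBall y r) ≤ (n + 1) * ENNReal.ofReal r ^ 2} with hN
  refine measure_null_of_locally_null N fun x hx => ?_
  obtain ⟨U, hxU, hU, hfin⟩ := μ.exists_isOpen_measure_lt_top x
  refine ⟨N ∩ U, inter_mem_nhdsWithin _ (hU.mem_nhds hxU), ?_⟩
  -- Bad points are centers of small balls with `(n + 1) r² < μ(ball)`. A disjoint Vitali subfamily,
  -- enlarged five times, covers with diameters at most `10 r`, so the squared diameters sum to at
  -- most `100 μ(U) / (n + 1)`.
  have hsel : ∀ n : ℕ, ∀ y : (N ∩ U : Set Y), ∃ r : ℝ, 0 < r ∧ r ≤ 1 / (n + 1) ∧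
      Metric.closedBall (y : Y) r ⊆ U ∧ (n + 1) * ENNReal.ofReal r ^ 2 <
        μ (Metric.closedBall (y : Y) r) := by
    rintro n ⟨y, hyN, hyU⟩
    obtain ⟨s, hs, hsU⟩ := Metric.nhds_basis_closedBall.mem_iff.1 (hU.mem_nhds hyU)
    simp only [hN, mem_ofPred_eq, not_exists, not_and, not_forall, not_le] at hyN
    obtain ⟨r, hr, hrs, hlt⟩ := hyN n (min s (1 / (n + 1))) (lt_min hs (by positivity))
    exact ⟨r, hr, hrs.trans (min_le_right _ _),
      (Metric.closedBall_subset_closedBall (hrs.trans (min_le_left _ _))).trans hsU, hlt⟩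
  choose r hr0 hrn hrU hrμ using hsel
  choose u _ hdisj hcov using fun n =>
    Vitali.exists_disjoint_subfamily_covering_enlargement_closedBall
    (univ : Set (N ∩ U : Set Y)) (fun y => (y : Y)) (r n) (1 / (n + 1)) (fun y _ => hrn n y) 5
    (by norm_num)
  have hcount : ∀ n, (u n).Countable := fun n =>
    (hdisj n).countable_of_nonempty_interior fun y _ =>
      ⟨y, Metric.ball_subset_interior_closedBall (Metric.mem_ball_self (hr0 n y))⟩
  have := fun n => (hcount n).to_subtype
  have hdiam : ∀ n (y : u n), Metric.ediam (Metric.closedBall (y : Y) (5 * r n y)) ≤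
      10 * ENNReal.ofReal (r n y) := fun n y => by
    rw [← Metric.closedEBall_ofReal (by linarith [hr0 n y])]
    refine Metric.ediam_closedEBall_le.trans (le_of_eq ?_)
    rw [ENNReal.ofReal_mul (by norm_num), ← mul_assoc]
    norm_num
  have hz : Tendsto (fun n : ℕ => ((n + 1 : ℕ) : ℝ≥0∞)⁻¹) atTop (𝓝 0) :=
    ENNReal.tendsto_inv_nat_nhds_zero.comp (tendsto_add_atTop_nat 1)
  have hzc : ∀ c : ℝ≥0∞, c ≠ ∞ →
      Tendsto (fun n : ℕ => c * ((n + 1 : ℕ) : ℝ≥0∞)⁻¹) atTop (𝓝 0) := fun c hc => by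
    simpa using ENNReal.Tendsto.const_mul hz (Or.inr hc)
  have hr1 : ∀ n y, ENNReal.ofReal (r n y) ≤ ((n + 1 : ℕ) : ℝ≥0∞)⁻¹ := fun n y => by
    refine (ENNReal.ofReal_le_ofReal (hrn n y)).trans (le_of_eq ?_)
    rw [one_div, ENNReal.ofReal_inv_of_pos (by positivity)]
    norm_cast
  have hmain := hausdorffMeasure_le_liminf_tsum 2 (N ∩ U) (l := atTop) (ι := fun n => u n) _
    (hzc 10 (by norm_num)) (fun n y => Metric.closedBall (y : Y) (5 * r n y))
    (Eventually.of_forall fun n y => (hdiam n y).trans (by gcongr; exact hr1 n y))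
    (Eventually.of_forall fun n y hy => by
      obtain ⟨b, hb, hsub⟩ := hcov n ⟨y, hy⟩ (mem_univ _)
      exact mem_iUnion.2 ⟨⟨b, hb⟩, hsub (Metric.mem_closedBall_self (hr0 n _).le)⟩)
  have hsum : ∀ n, ∑' y : u n, Metric.ediam (Metric.closedBall (y : Y) (5 * r n y)) ^ (2 : ℝ) ≤
      (100 * μ U) * ((n + 1 : ℕ) : ℝ≥0∞)⁻¹ := by
    intro n
    calc ∑' y : u n, Metric.ediam (Metric.closedBall (y : Y) (5 * r n y)) ^ (2 : ℝ)
        ≤ ∑' y : u n, (100 * ((n + 1 : ℕ) : ℝ≥0∞)⁻¹) * μ (Metric.closedBall (y : Y) (r n y)) := by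
          refine ENNReal.tsum_le_tsum fun y => ?_
          rw [ENNReal.rpow_two]
          calc _ ≤ (10 * ENNReal.ofReal (r n y)) ^ 2 := by gcongr; exact hdiam n y
            _ = 100 * (((n + 1 : ℕ) : ℝ≥0∞)⁻¹ *
                (((n + 1 : ℕ) : ℝ≥0∞) * ENNReal.ofReal (r n y) ^ 2)) := by
              rw [← mul_assoc (_⁻¹), ENNReal.inv_mul_cancel (by simp) (ENNReal.natCast_ne_top _),
                one_mul, mul_pow]
              norm_num
            _ ≤ _ := by
              rw [mul_assoc]
              gcongr
              push_cast
              exact (hrμ n y).le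
      _ = (100 * ((n + 1 : ℕ) : ℝ≥0∞)⁻¹) * μ (⋃ y : u n, Metric.closedBall (y : Y) (r n y)) := by
          rw [ENNReal.tsum_mul_left, measure_iUnion]
          · exact fun a b hab => hdisj n a.2 b.2 fun h => hab (Subtype.ext h)
          · exact fun y => Metric.isClosed_closedBall.measurableSet
      _ ≤ (100 * ((n + 1 : ℕ) : ℝ≥0∞)⁻¹) * μ U := by
          gcongr
          exact iUnion_subset fun y => hrU n y
      _ = _ := by ring
  refine le_antisymm (hmain.trans ?_) zero_le
  refine (liminf_le_liminf (Eventually.of_forall hsum)).trans (le_of_eq ?_)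
  exact (hzc _ (ENNReal.mul_ne_top (by norm_num) hfin.ne)).liminf_eq

end Density

/-! ### Points have zero capacity -/

section PointCapacity

variable {Y : Type*} [MetricSpace Y] [MeasurableSpace Y] [BorelSpace Y]

/-- Between the last visit to distance at most `s` before the first arrival at distance `t`, and
that arrival, the path stays in the ring and travels at least `t - s`. -/
theorem Curve.ofReal_le_lengthMeasure_ring {γ : Curve Y} (hγ : γ.Rectifiable) {s t : ℝ}
    (hs : 0 ≤ s) (hst : s < t) (ht : t ≤ dist γ.target γ.source) :
    ENNReal.ofReal (t - s) ≤
      γ.lengthMeasure {u | s < dist (γ.ext u) γ.source ∧ dist (γ.ext u) γ.source ≤ t} := by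
  let φ : ℝ → ℝ := fun u => dist (γ.ext u) γ.source
  have hφ : Continuous φ := γ.continuous_ext.dist continuous_const
  have hφlo : φ γ.lo = 0 := by simp [φ, γ.ext_lo]
  have hφhi : t ≤ φ γ.hi := by simpa [φ, γ.ext_hi] using ht
  obtain ⟨b, ⟨⟨hb1, hb2⟩, hbt⟩, hbmin⟩ :=
    (isCompact_Icc.inter_right (isClosed_le continuous_const hφ)).exists_isLeast
      (s := Icc γ.lo γ.hi ∩ {u | t ≤ φ u}) ⟨γ.hi, right_mem_Icc.2 γ.le, hφhi⟩
  have hbt' : φ b ≤ t := by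
    obtain ⟨c, hc, hct⟩ := intermediate_value_Icc hb1 hφ.continuousOn
      (show t ∈ Icc (φ γ.lo) (φ b) from ⟨by linarith, hbt⟩)
    have := hbmin ⟨⟨hc.1, hc.2.trans hb2⟩, hct.ge⟩
    rw [← le_antisymm this hc.2] at hct
    exact hct.le
  obtain ⟨a, ⟨⟨ha1, ha2⟩, has⟩, hamax⟩ :=
    (isCompact_Icc.inter_right (isClosed_le hφ continuous_const)).exists_isGreatest
      (s := Icc γ.lo b ∩ {u | φ u ≤ s}) ⟨γ.lo, left_mem_Icc.2 hb1, hφlo.le.trans hs⟩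
  calc ENNReal.ofReal (t - s) ≤ ENNReal.ofReal (dist (γ.ext a) (γ.ext b)) := by
        refine ENNReal.ofReal_le_ofReal ?_
        have h1 : φ b ≤ dist (γ.ext b) (γ.ext a) + φ a := dist_triangle _ _ _
        have h2 : φ a ≤ s := has
        have h3 : t ≤ φ b := hbt
        rw [dist_comm]
        linarith
    _ = edist (γ.ext a) (γ.ext b) := (edist_dist _ _).symm
    _ ≤ γ.lengthMeasure (Ioc a b) := Curve.edist_le_lengthMeasure hγ ha2
    _ ≤ _ := by
        refine measure_mono fun u hu => ⟨?_, ?_⟩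
        · by_contra! h
          exact absurd (hamax ⟨⟨ha1.trans hu.1.le, hu.2⟩, h⟩) (not_le.2 hu.1)
        · rcases hu.2.eq_or_lt with rfl | h
          · exact hbt'
          · by_contra! h'
            exact absurd (hbmin ⟨⟨ha1.trans hu.1.le, hu.2.trans hb2⟩, h'.le⟩) (not_le.2 h)

end PointCapacity

section PointCapacity

variable {Y : Type*} [MetricSpace Y] [MeasurableSpace Y] [BorelSpace Y]

/-- A test function of size about `1 / (j r_j)` on the dyadic ring of radius `r_j` has energy
comparable to `∑ 1 / j²`, while a path from `y` to another point crosses all small rings and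
collects a tail of `∑ 1 / j`. -/
theorem eventually_target_eq_of_source_eq {y : Y} {n : ℕ} {r₀ : ℝ} (hr₀ : 0 < r₀)
    (hy : ∀ r, 0 < r → r ≤ r₀ →
      hausdorff2 Y (Metric.closedBall y r) ≤ (n + 1) * ENNReal.ofReal r ^ 2) :
    ∀ᶠ γ in modAE Y, γ.source = y → γ.target = y := by
  let r : ℕ → ℝ := fun j => r₀ / 2 ^ j
  have hr : ∀ j, 0 < r j := fun j => by positivity
  have hrs : ∀ j, r j = 2 * r (j + 1) := fun j => by
    simp only [r, pow_succ]
    field_simp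
  have hranti : Antitone r := antitone_nat_of_succ_le fun j => by linarith [hrs j, hr (j + 1)]
  let R : ℕ → Set Y := fun j => {z | r (j + 1) < dist z y ∧ dist z y ≤ r j}
  have hRm : ∀ j, MeasurableSet (R j) := fun j =>
    have hd : Measurable fun z => dist z y := (continuous_id.dist continuous_const).measurable
    (measurableSet_lt measurable_const hd).inter (measurableSet_le hd measurable_const)
  have hRd : Pairwise fun i j => Disjoint (R i) (R j) := by
    intro i j hij
    wlog h : i < j generalizing i j
    · exact (this hij.symm (lt_of_le_of_ne (not_lt.1 h) hij.symm)).symm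
    exact disjoint_left.2 fun z hi hj =>
      absurd (hj.2.trans (hranti (Nat.succ_le_of_lt h))) (not_le.2 hi.1)
  let c : ℕ → ℝ≥0∞ := fun j => ENNReal.ofReal (1 / ((j + 1) * r (j + 1)))
  let f : ℕ → Y → ℝ≥0∞ := fun j => (R j).indicator fun _ => c j
  have hf : ∀ j, Measurable (f j) := fun j => measurable_const.indicator (hRm j)
  have hρ : Measurable fun z => ⨆ j, f j z := .iSup hf
  have hfin : ∫⁻ z, (⨆ j, f j z) ^ 2 ∂(hausdorff2 Y) ≠ ∞ := by
    have hsum : Summable fun j : ℕ => (1 : ℝ) / ((j + 1 : ℕ) : ℝ) ^ 2 :=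
      (summable_nat_add_iff 1).2 (Real.summable_one_div_nat_pow.2 one_lt_two)
    refine ne_top_of_le_ne_top (b := ∑' j : ℕ, (4 * (n + 1)) *
      ENNReal.ofReal ((1 : ℝ) / ((j + 1 : ℕ) : ℝ) ^ 2)) ?_
      ((lintegral_iSup_sq_le _ hf).trans (ENNReal.tsum_le_tsum fun j => ?_))
    · rw [ENNReal.tsum_mul_left]
      exact ENNReal.mul_ne_top (by finiteness) hsum.tsum_ofReal_ne_top
    · have h1 : (fun z => f j z ^ 2) = (R j).indicator fun _ => c j ^ 2 := by
        ext z
        by_cases hz : z ∈ R j <;> simp [f, hz]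
      rw [h1, lintegral_indicator_const (hRm j)]
      calc c j ^ 2 * hausdorff2 Y (R j)
          ≤ c j ^ 2 * ((n + 1) * ENNReal.ofReal (r j) ^ 2) := by
            gcongr
            refine (measure_mono fun z hz => ?_).trans (hy (r j) (hr j)
              (by simpa [r] using hranti (Nat.zero_le j)))
            exact hz.2
        _ = (n + 1) * (c j * ENNReal.ofReal (r j)) ^ 2 := by ring
        _ = (n + 1) * ENNReal.ofReal (4 * (1 / ((j + 1 : ℕ) : ℝ) ^ 2)) := by
            have := hr (j + 1)
            rw [← ENNReal.ofReal_mul (by positivity), ← ENNReal.ofReal_pow (by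
              have := hr j; positivity), hrs j]
            congr 2
            push_cast
            field_simp
            norm_num
        _ = _ := by
            rw [ENNReal.ofReal_mul (by norm_num)]
            norm_num
            ring
  filter_upwards [eventually_lineIntegral_ne_top hρ hfin, eventually_rectifiable] with γ hγ hγr hs
  by_contra hne
  refine hγ ?_
  rw [Curve.lineIntegral_eq_lintegral hγr hρ]
  have hpos : 0 < dist γ.target γ.source := dist_pos.2 fun h => hne (h.trans hs)
  obtain ⟨J, hJ⟩ : ∃ J, r J ≤ dist γ.target γ.source := by
    obtain ⟨J, hJ⟩ := exists_pow_lt_of_lt_one (div_pos hpos hr₀) (show (1 / 2 : ℝ) < 1 by norm_num)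
    refine ⟨J, ?_⟩
    rw [lt_div_iff₀ hr₀] at hJ
    refine le_trans (le_of_eq ?_) hJ.le
    simp only [r]
    rw [one_div, inv_pow]
    ring
  let U : ℕ → Set ℝ := fun i => γ.ext ⁻¹' R (i + J)
  have hUm : ∀ i, MeasurableSet (U i) := fun i => γ.continuous_ext.measurable (hRm _)
  have hle : ∑' i : ℕ, ENNReal.ofReal (1 / ((i + (J + 1) : ℕ) : ℝ)) ≤
      ∫⁻ u, ⨆ j, f j (γ.ext u) ∂γ.lengthMeasure := by
    calc _ ≤ ∑' i, ∫⁻ u in U i, ⨆ j, f j (γ.ext u) ∂γ.lengthMeasure := by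
          refine ENNReal.tsum_le_tsum fun i => ?_
          have hring := Curve.ofReal_le_lengthMeasure_ring hγr (hr (i + J + 1)).le
            (by linarith [hrs (i + J), hr (i + J + 1)] : r (i + J + 1) < r (i + J))
            ((hranti (Nat.le_add_left J i)).trans hJ)
          calc ENNReal.ofReal (1 / ((i + (J + 1) : ℕ) : ℝ))
              = c (i + J) * ENNReal.ofReal (r (i + J) - r (i + J + 1)) := by
                have := hr (i + J + 1)
                rw [← ENNReal.ofReal_mul (by positivity), hrs (i + J)]
                congr 1
                push_cast
                field_simp
                ring
            _ ≤ c (i + J) * γ.lengthMeasure (U i) := by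
                gcongr
                rwa [hs] at hring
            _ = ∫⁻ _ in U i, c (i + J) ∂γ.lengthMeasure := by rw [setLIntegral_const]
            _ ≤ _ := by
                refine setLIntegral_mono' (hUm i) fun u hu => ?_
                refine le_trans (le_of_eq ?_) (le_iSup _ (i + J))
                exact (indicator_of_mem (show γ.ext u ∈ R (i + J) from hu) fun _ => c (i + J)).symm
      _ = ∫⁻ u in ⋃ i, U i, ⨆ j, f j (γ.ext u) ∂γ.lengthMeasure := by
          rw [lintegral_iUnion hUm]
          exact fun i j hij => (hRd fun h => hij (Nat.add_right_cancel h)).preimage _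
      _ ≤ _ := setLIntegral_le_lintegral _ _
  refine top_unique (le_trans (le_of_eq ?_) hle)
  by_contra hsum
  have h1 := ENNReal.summable_toReal (Ne.symm hsum)
  refine Real.not_summable_one_div_natCast ((summable_nat_add_iff (J + 1)).1 (h1.congr fun i => ?_))
  exact ENNReal.toReal_ofReal (one_div_nonneg.2 (Nat.cast_nonneg _))

end PointCapacity

/-! ### Paths leaving a continuum, and the fibers of `h` -/

section Continua

variable {X : Type*} [MetricSpace X] [MeasurableSpace X] [BorelSpace X]

theorem exists_curve_lineIntegral_le_setLIntegral {K : Set X} (hK : IsCompact K)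
    (hKc : IsConnected K) (hKfin : μH[1] K ≠ ∞) {x y : X} (hx : x ∈ K) (hy : y ∈ K) :
    ∃ γ : Curve X, γ.source = x ∧ γ.target = y ∧ γ.Rectifiable ∧ ∀ ρ : X → ℝ≥0∞, Measurable ρ →
      γ.lineIntegral ρ ≤ ∫⁻ z in K, ρ z ∂μH[1] := by
  have := isCompact_iff_compactSpace.1 hK
  have := isPreconnected_iff_preconnectedSpace.1 hKc.isPreconnected
  have hι : Isometry (Subtype.val : K → X) := isometry_subtype_coe
  have hfin : μH[1] (univ : Set K) ≠ ∞ := by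
    rw [← hι.hausdorffMeasure_image (Or.inl zero_le_one)]
    simpa using hKfin
  obtain ⟨γ, hs, ht, hr, hγ⟩ := exists_curve_lineIntegral_le_lintegral_hausdorffMeasure hfin
    ⟨x, hx⟩ ⟨y, hy⟩
  let ι : C(K, X) := ⟨Subtype.val, continuous_subtype_val⟩
  refine ⟨γ.comp ι, congrArg Subtype.val hs, congrArg Subtype.val ht, ?_, fun ρ hρ => ?_⟩
  · rwa [Curve.Rectifiable, Curve.length_comp_isometry (ι := ι) hι]
  · rw [Curve.lineIntegral_comp_isometry (ι := ι) hι]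
    refine (hγ _ (hρ.comp measurable_subtype_coe)).trans (le_of_eq ?_)
    have hmap := hι.map_hausdorffMeasure (d := 1) (Or.inl zero_le_one)
    rw [Subtype.range_coe] at hmap
    rw [← hmap, lintegral_map hρ measurable_subtype_coe]
    rfl

/-- In a surface of locally finite area, the family of curves leaving a nondegenerate continuum with
empty interior has positive modulus. -/
theorem modulus_leaving_ne_zero [ChartedSpace (EuclideanHalfSpace 2) X]
    [IsLocallyFiniteMeasure (hausdorff2 X)] {E : Set X} (hE : IsClosed E) (hEc : IsPreconnected E)
    (hEi : interior E = ∅) (hEn : E.Nontrivial) :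
    modulus {γ : Curve X | γ.source ∈ E ∧ γ.target ∉ E} ≠ 0 := by
  intro h0
  obtain ⟨D, f, r, hD, hf, hr, hlev⟩ := exists_joining_level_sets hE hEc hEi hEn
  have hκ : ENNReal.ofReal (Real.pi / 4) ≠ 0 := by
    simp [Real.pi_pos]
  have hμ : (hausdorff2 X) D < ∞ := hD.measure_lt_top
  have hDfin : μH[2] D < ∞ := by
    rw [hausdorff2, Measure.smul_apply, smul_eq_mul] at hμ
    exact ENNReal.lt_top_of_mul_ne_top_right hμ.ne hκ
  have hDm := hD.isClosed.measurableSet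
  obtain ⟨G₁, hG₁m, hG₁, hG₁t⟩ := exists_coarea_bound_set hf D
  -- For almost every level the continuum `K` has finite length, so a curve in it leaves `E` and
  -- `∫_K ρ dℋ¹ ≥ 1`; integration over the levels bounds `∫_D ρ` from below.
  have key : ∀ ρ, Admissible {γ : Curve X | γ.source ∈ E ∧ γ.target ∉ E} ρ →
      ENNReal.ofReal r ≤ ∫⁻ x in D, ρ x ∂μH[2] := by
    intro ρ hρ
    obtain ⟨G, hGm, hG, hGt⟩ := exists_coarea_bound hf (hρ.1.indicator hDm)
    rw [lintegral_indicator hDm] at hG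
    have hfin : ∀ᵐ t ∂(volume : Measure ℝ), G₁ t < ∞ := ae_lt_top hG₁m (hG₁.trans_lt hDfin).ne
    calc ENNReal.ofReal r = ∫⁻ _ in Ioo 0 r, 1 := by simp
      _ ≤ ∫⁻ t in Ioo 0 r, G t := by
        refine setLIntegral_mono_ae' measurableSet_Ioo ?_
        filter_upwards [hfin] with t ht htr
        obtain ⟨K, hKD, hKc, hK, hKf, ⟨x, hxK, hxE⟩, y, hyK, hyE⟩ := hlev t htr
        have hKsub : K ⊆ D ∩ f ⁻¹' {t} := fun z hz => ⟨hKD hz, hKf z hz⟩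
        obtain ⟨γ, hs, htg, hγr, hγ⟩ := exists_curve_lineIntegral_le_setLIntegral hK hKc
          ((measure_mono hKsub).trans_lt ((hG₁t t).trans_lt ht)).ne hxK hyK
        calc 1 ≤ γ.lineIntegral ρ := hρ.2 γ ⟨hs ▸ hxE, htg ▸ hyE⟩ hγr
          _ ≤ ∫⁻ z in K, ρ z ∂μH[1] := hγ ρ hρ.1
          _ = ∫⁻ z in K, D.indicator ρ z ∂μH[1] :=
            setLIntegral_congr_fun hK.isClosed.measurableSet fun z hz =>
              (indicator_of_mem (hKD hz) _).symm
          _ ≤ ∫⁻ z in f ⁻¹' {t}, D.indicator ρ z ∂μH[1] :=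
            lintegral_mono_set (hKsub.trans inter_subset_right)
          _ ≤ G t := hGt t
      _ ≤ ∫⁻ t, G t := setLIntegral_le_lintegral _ _
      _ ≤ _ := hG
  have hlim : ∀ N : ℕ, ENNReal.ofReal r ≤ μH[2] D * ((N + 1 : ℕ) : ℝ≥0∞)⁻¹ := by
    intro N
    set M : ℝ≥0∞ := ((N + 1 : ℕ) : ℝ≥0∞) with hM
    have hM0 : M ≠ 0 := by simp [hM]
    have hMt : M ≠ ∞ := ENNReal.natCast_ne_top _
    refine ENNReal.le_of_forall_pos_le_add fun ε hε _ => ?_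
    obtain ⟨ρ, hρ, hlt⟩ := exists_admissible_lt (c := ENNReal.ofReal (Real.pi / 4) * (M⁻¹ * ε))
      (h0 ▸ (ENNReal.mul_pos hκ (mul_ne_zero (ENNReal.inv_ne_zero.2 hMt)
        (ENNReal.coe_pos.2 hε).ne')))
    have hlt' : ∫⁻ x, ρ x ^ 2 ∂μH[2] ≤ M⁻¹ * ε := by
      rw [hausdorff2, lintegral_smul_measure, smul_eq_mul] at hlt
      exact (ENNReal.mul_le_mul_iff_right hκ ENNReal.ofReal_ne_top).1 hlt.le
    calc ENNReal.ofReal r ≤ ∫⁻ x in D, ρ x ∂μH[2] := key ρ hρ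
      -- The pointwise bound `ρ ≤ M⁻¹ + M ρ²` takes the place of the Cauchy–Schwarz inequality.
      _ ≤ ∫⁻ x in D, (M⁻¹ + M * ρ x ^ 2) ∂μH[2] := by
          refine lintegral_mono fun x => ?_
          rcases le_total (M * ρ x) 1 with h | h
          · exact (ENNReal.le_inv_iff_mul_le.2 (by rwa [mul_comm])).trans le_self_add
          · calc ρ x = 1 * ρ x := (one_mul _).symm
              _ ≤ M * ρ x * ρ x := by gcongr
              _ = M * ρ x ^ 2 := by ring
              _ ≤ _ := le_add_self
      _ = μH[2] D * M⁻¹ + M * ∫⁻ x in D, ρ x ^ 2 ∂μH[2] := by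
          rw [lintegral_add_left measurable_const, lintegral_const_mul' _ _ hMt, setLIntegral_const,
            mul_comm M⁻¹]
      _ ≤ μH[2] D * M⁻¹ + M * (M⁻¹ * ε) := by
          gcongr
          exact (setLIntegral_le_lintegral _ _).trans hlt'
      _ = _ := by rw [← mul_assoc M, ENNReal.mul_inv_cancel hM0 hMt, one_mul]
  have hz : Tendsto (fun n : ℕ => μH[2] D * ((n + 1 : ℕ) : ℝ≥0∞)⁻¹) atTop (𝓝 0) := by
    simpa using ENNReal.Tendsto.const_mul
      (ENNReal.tendsto_inv_nat_nhds_zero.comp (tendsto_add_atTop_nat 1)) (Or.inr hDfin.ne)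
  have := ge_of_tendsto hz (Eventually.of_forall hlim)
  exact absurd hr (not_lt.2 (by simpa using this))

/-- A monotone map which does not decrease modulus by more than a constant factor has almost all
fibers reduced to a point. -/
theorem ae_subsingleton_fiber {Y : Type*} [MetricSpace Y] [MeasurableSpace Y] [BorelSpace Y]
    [SecondCountableTopology X] [SecondCountableTopology Y]
    [ChartedSpace (EuclideanHalfSpace 2) X] [IsLocallyFiniteMeasure (hausdorff2 X)]
    [IsLocallyFiniteMeasure (hausdorff2 Y)] {K : ℝ≥0} {h : C(X, Y)}
    (hmono : ∀ y : Y, IsConnected (h ⁻¹' {y}))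
    (hmod : ∀ Γ : Set (Curve X), modulus Γ ≤ K * modulus (Curve.comp h '' Γ)) :
    ∀ᵐ y ∂(hausdorff2 Y), (h ⁻¹' {y}).Subsingleton := by
  refine Measure.ae_smul_measure ?_ _
  have hint : ∀ᵐ y ∂(μH[2] : Measure Y), interior (h ⁻¹' {y}) = ∅ := by
    -- Disjoint sets with interior are countably many in a separable space, and countable sets are
    -- `ℋ²`-null.
    have hc : {y | (interior (h ⁻¹' {y})).Nonempty}.Countable :=
      Set.PairwiseDisjoint.countable_of_nonempty_interior (s := fun y => h ⁻¹' {y})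
        (fun a _ b _ hab => (disjoint_singleton.2 hab).preimage h) fun _ hy => hy
    have := nullSingletonClass_hausdorff Y two_pos
    filter_upwards [hc.ae_notMem μH[2]] with y hy
    exact not_nonempty_iff_eq_empty.1 hy
  filter_upwards [hint, ae_exists_measure_closedBall_le (hausdorff2 Y)] with y hy hdens
  obtain ⟨n, r₀, hr₀, hball⟩ := hdens
  by_contra hns
  refine modulus_leaving_ne_zero (isClosed_singleton.preimage h.continuous)
    (hmono y).isPreconnected hy (not_subsingleton_iff.1 hns)
    (le_antisymm ((hmod _).trans ?_) zero_le)
  have h0 := eventually_modAE.1 (eventually_target_eq_of_source_eq hr₀ hball)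
  have h1 : modulus (Curve.comp h '' {γ : Curve X | γ.source ∈ h ⁻¹' {y} ∧ γ.target ∉ h ⁻¹' {y}})
      ≤ 0 := by
    refine (modulus_mono ?_).trans h0.le
    rintro _ ⟨γ, ⟨hs, ht⟩, rfl⟩
    exact fun H => ht (H hs)
  rw [nonpos_iff_eq_zero.1 h1, mul_zero]

end Continua

end QC

end

/-- A continuous, surjective, monotone map `h` between metric surfaces of locally finite Hausdorff
`2`-measure is weakly `K`-quasiconformal if and only if it is in `N^{1,2}_loc(X, Y)` and, with `g`
its minimal weak upper gradient and `ν` the measure `E ↦ ℋ²(h(E))` (which is part of the claim to be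
a measure), `g² ≤ K J_h` a.e. for the Radon-Nikodym derivative `J_h = dν/dℋ²`. -/
theorem theorem1p4 {X Y : Type*}
    [MetricSpace X] [MeasurableSpace X] [BorelSpace X] [QC.IsMetricSurface X]
    [MetricSpace Y] [MeasurableSpace Y] [BorelSpace Y] [QC.IsMetricSurface Y]
    (hX : IsLocallyFiniteMeasure (QC.hausdorff2 X))
    (hY : IsLocallyFiniteMeasure (QC.hausdorff2 Y))
    (K : ℝ≥0) (hK : 1 ≤ K) (h : X → Y)
    (hcont : Continuous h) (hsurj : Function.Surjective h)
    (hmono : ∀ y : Y, IsConnected (h ⁻¹' {y})) :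
    QC.IsWeaklyQuasiconformal K h ↔
      QC.MemN12loc h ∧
        ∃ (g : X → ℝ≥0∞) (ν : Measure X),
          QC.IsMinimalWeakUpperGradient h g ∧ QC.IsImageMeasure h ν ∧
          ∀ᵐ x ∂(QC.hausdorff2 X), g x ^ 2 ≤ K * ν.rnDeriv (QC.hausdorff2 X) x := by
  obtain ⟨_, ⟨_⟩⟩ := ‹QC.IsMetricSurface X›
  obtain ⟨_, _⟩ := ‹QC.IsMetricSurface Y›
  -- Together with second countability this makes `X` σ-compact, as the Borel image argument
  -- requires.
  have : LocallyCompactSpace X :=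
    Manifold.locallyCompact_of_finiteDimensional (modelWithCornersEuclideanHalfSpace 2)
  have hK0 : K ≠ 0 := (zero_lt_one.trans_le hK).ne'
  constructor
  · intro H
    have hmod : ∀ Γ : Set (QC.Curve X), QC.modulus Γ ≤
        K * QC.modulus (QC.Curve.comp ⟨h, hcont⟩ '' Γ) := H.modulus_le
    exact QC.exists_gradient_and_imageMeasure (h := ⟨h, hcont⟩) hK0 hsurj hmod
      (QC.ae_subsingleton_fiber hmono hmod)
  · rintro ⟨-, g, ν, hg, hν, hle⟩
    exact ⟨hcont, hsurj, hmono,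
      QC.modulus_le_of_sq_le_rnDeriv (h := ⟨h, hcont⟩) hK0 hsurj hg.1 hg.2.1 hν hle⟩
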